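/- Let $X_1,X_2,\dots$ be i.i.d. random variables with $P(X_i=-1)=P(X_i=0)=P(X_i=1)=\tfrac13$. For $N\ge 1$ let $$W_N=\frac{\sum_{i=1}^N X_i}{\sqrt{\sum_{i=1}^N X_i^2}}\qquad(W_N=0\text{ if all }X_i=0,\ i\le N),$$ and let $F_N(w)=P(W_N\le w)$. Let $\Phi$ and $\varphi$ be the standard normal distribution function and density, and let $\operatorname{frac}(x)=x-\lfloor x\rfloor$. Define, for $w\ge 0$, $$\Psi_N(w)=\Phi(w)+N^{-1/2}\Lambda_N(w),\qquad \Lambda_N(w)=-\sqrt{\tfrac32}\,\varphi(w)\sum_{0\le n\le N}\frac{3}{\sqrt{\pi N}}\,e^{-\frac9N\left(n-\frac N3\right)^2}\Big(\operatorname{frac}\big(w\sqrt{2n}\big)-\tfrac12\Big),$$ and, for $w>0$, $\Psi_N(-w)=1-\Psi_N(w-)$, where $\Psi_N(w-)$ denotes the limit from the left at $w$. Then, as $N\to\infty$: (a) $P(W_N=0)\sim\sqrt{\dfrac{3}{4\pi N}}$; in particular $P(W_N=0)=O(N^{-1/2})$. (b) $P(W_N=w)=O(1/N)$ uniformly in $w\ne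 0$. (c) $\sup_{w\in\mathbb R}|F_N(w)-\Psi_N(w)|=O(1/N)$. (d) $\Psi_N$, and hence $F_N$, assigns mass $O(1/N)$ to every closed interval of length $O(1/N)$ that is bounded away from the origin. Precisely: for all $\varepsilon>0$ and $C>0$ there is a $K$ such that for all sufficiently large $N$ and all $a\le b$ with $b-a\le C/N$ and either $a\ge\varepsilon$ or $b\le-\varepsilon$, $$|\Psi_N(b)-\Psi_N(a-)|\le \frac KN\qquad\text{and}\qquad P(a\le W_N\le b)\le\frac KN.$$ -/

import Mathlib

open MeasureTheory ProbabilityTheory Filter Topology Asymptotics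

noncomputable section

/-- `X 0, X 1, …` are i.i.d. real random variables, each uniform on `{-1, 0, 1}`. -/
structure IsIIDUniformTernary {Ω : Type*} [MeasurableSpace Ω] (μ : Measure Ω)
    (X : ℕ → Ω → ℝ) : Prop where
  measurable : ∀ i, Measurable (X i)
  indep : iIndepFun X μ
  prob_neg_one : ∀ i, μ.real {ω | X i ω = -1} = 1 / 3
  prob_zero : ∀ i, μ.real {ω | X i ω = 0} = 1 / 3
  prob_one : ∀ i, μ.real {ω | X i ω = 1} = 1 / 3

/-- The self-normalized sum of the first `N` variables. It is `0` where the sum of squares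
vanishes, by the convention `x / 0 = 0`. -/
def selfNormSum {Ω : Type*} (X : ℕ → Ω → ℝ) (N : ℕ) (ω : Ω) : ℝ :=
  (∑ i ∈ Finset.range N, X i ω) / √(∑ i ∈ Finset.range N, X i ω ^ 2)

/-- The distribution function `F_N` of the self-normalized sum. -/
def selfNormCDF {Ω : Type*} [MeasurableSpace Ω] (μ : Measure Ω) (X : ℕ → Ω → ℝ)
    (N : ℕ) (w : ℝ) : ℝ :=
  μ.real {ω | selfNormSum X N ω ≤ w}

/-- The standard normal distribution function `Φ`. -/
def stdNormalCDF (w : ℝ) : ℝ := cdf (gaussianReal 0 1) w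

/-- The standard normal density `φ`. -/
def stdNormalPDF (w : ℝ) : ℝ := gaussianPDFReal 0 1 w

/-- The oscillating term `Λ_N`, used for `w ≥ 0`. -/
def sawtoothTerm (N : ℕ) (w : ℝ) : ℝ :=
  -√(3 / 2) * stdNormalPDF w *
    ∑ n ∈ Finset.range (N + 1),
      3 / √(Real.pi * N) * Real.exp (-(9 / (N : ℝ)) * ((n : ℝ) - N / 3) ^ 2) *
        (Int.fract (w * √(2 * n)) - 1 / 2)

/-- The formula `Φ + N^{-1/2} Λ_N`, which gives `Ψ_N` on `[0, ∞)`. -/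
def expansionNonneg (N : ℕ) (w : ℝ) : ℝ :=
  stdNormalCDF w + 1 / √(N : ℝ) * sawtoothTerm N w

/-- The expansion `Ψ_N`: the formula above for `w ≥ 0`, extended to negative arguments by
`Ψ_N(-w) = 1 - Ψ_N(w-)` for `w > 0`, where `w-` denotes the limit from the left. -/
def expansion (N : ℕ) (w : ℝ) : ℝ :=
  if 0 ≤ w then expansionNonneg N w
  else 1 - Function.leftLim (expansionNonneg N) (-w)

end

/-! Given that exactly `n` of the first `N` variables are nonzero, the sum of squares is `n` and the
sum is a sum of `n` independent signs. Hence `F_N` is the mixture, with binomial weights of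
parameters `N` and `2/3`, of the distribution functions of standardized symmetric binomials
(`selfNormCDF_eq`).

For fixed `n`, each atom is compared with the normal mass of the cell of length `2/√n` around it. By
symmetry the `ℓ¹` error is `O(1/n)`, and the cells telescope to `Φ` at the right edge of the last
one, which is `w - (2/√n) sawtooth((w√n + n)/2)`. A Taylor step gives
`exists_abs_signSumCDF_sub_le`.

In the mixture the sawtooth term is already of order `N^{-1/2}`, so everything multiplying it is
needed only to relative precision `N^{-1/2}`: `2/√n` becomes `√6/√N`, and the binomial weights
become Gaussian ones. The shift `n/2` depends on the parity of `n`; neighbouring indices `2m` and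
`2m+1` are merged by `sawtooth x + sawtooth (x + 1/2) = sawtooth (2x)`, leaving `sawtooth(w√(2m))`.
The cost of moving from `2m+1` to `2m` is a weighted count of the jumps of a floor along a slowly
growing sequence, which Abel summation bounds by `O((1+w)/√N)` (`sum_gaussWeight_mul_floor_sub_le`);
the density absorbs the factor `1+w`.

The same jump count controls local mass: raising `v` to `w` with `w²N ≤ v²(N+L)` moves the floors no
further than shifting `2m` by `2L`. So the expansion, and with it `F_N`, changes by `O(1/N)`; this
yields the atoms, the short intervals and the left limits. The negative half-line follows from the
symmetry of the law, and the atom at `0` from `P(W_N=0) = 2F_N(0) - 1`.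

Both binomial approximations avoid Stirling's formula: ratios of consecutive weights show
proportionality to a Gaussian in the bulk, Chebyshev handles the tails, and the total masses force
the factor to be near `1` (`sum_abs_sub_le_of_approx_proportional`). -/

/-! ### The standard normal density and distribution function -/

lemma stdNormalPDF_eq (x : ℝ) :
    stdNormalPDF x = (√(2 * Real.pi))⁻¹ * Real.exp (-x ^ 2 / 2) := by
  simp [stdNormalPDF, gaussianPDFReal]

lemma stdNormalPDF_nonneg (x : ℝ) : 0 ≤ stdNormalPDF x := gaussianPDFReal_nonneg _ _ _

lemma inv_sqrt_two_pi_le : (√(2 * Real.pi))⁻¹ ≤ 1 / 2 := by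
  have h : (2 : ℝ) ≤ √(2 * Real.pi) := by
    apply Real.le_sqrt_of_sq_le
    nlinarith [Real.pi_gt_three]
  rw [inv_eq_one_div]
  exact one_div_le_one_div_of_le (by norm_num) h

lemma stdNormalPDF_le (x : ℝ) : stdNormalPDF x ≤ 1 / 2 := by
  rw [stdNormalPDF_eq]
  have h1 : Real.exp (-x ^ 2 / 2) ≤ 1 := Real.exp_le_one_iff.2 (by nlinarith [sq_nonneg x])
  have := inv_sqrt_two_pi_le
  have h0 : 0 ≤ (√(2 * Real.pi))⁻¹ := by positivity
  nlinarith [Real.exp_pos (-x ^ 2 / 2)]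

/-- `(1 + x²) φ(x)` is bounded. -/
lemma one_add_sq_mul_stdNormalPDF_le (x : ℝ) : (1 + x ^ 2) * stdNormalPDF x ≤ 1 := by
  rw [stdNormalPDF_eq]
  have h1 : 1 + x ^ 2 / 2 ≤ Real.exp (x ^ 2 / 2) := by linarith [Real.add_one_le_exp (x ^ 2 / 2)]
  have h2 : Real.exp (-x ^ 2 / 2) * Real.exp (x ^ 2 / 2) = 1 := by
    rw [← Real.exp_add]; simp; ring
  have := inv_sqrt_two_pi_le
  have h0 : 0 ≤ (√(2 * Real.pi))⁻¹ := by positivity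
  have h3 := Real.exp_pos (-x ^ 2 / 2)
  have h4 : (1 + x ^ 2) * Real.exp (-x ^ 2 / 2) ≤ 2 := by nlinarith
  nlinarith

lemma abs_mul_stdNormalPDF_le (x : ℝ) : |x| * stdNormalPDF x ≤ 1 := by
  have := one_add_sq_mul_stdNormalPDF_le x
  have h : |x| ≤ 1 + x ^ 2 := by
    rw [← sq_abs]; nlinarith [sq_nonneg (|x| - 1), abs_nonneg x]
  exact (mul_le_mul_of_nonneg_right h (stdNormalPDF_nonneg x)).trans this

lemma hasDerivAt_stdNormalPDF (x : ℝ) : HasDerivAt stdNormalPDF (-x * stdNormalPDF x) x := by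
  have h : HasDerivAt (fun x : ℝ => (√(2 * Real.pi))⁻¹ * Real.exp (-x ^ 2 / 2))
      ((√(2 * Real.pi))⁻¹ * (Real.exp (-x ^ 2 / 2) * (-(2 * x) / 2))) x := by
    have h1 : HasDerivAt (fun x : ℝ => -x ^ 2 / 2) (-(2 * x) / 2) x := by
      have := ((hasDerivAt_pow 2 x).neg).div_const 2
      simpa using this
    exact (h1.exp).const_mul _
  have e : stdNormalPDF = fun x : ℝ => (√(2 * Real.pi))⁻¹ * Real.exp (-x ^ 2 / 2) :=
    funext stdNormalPDF_eq
  rw [e]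
  convert h using 1
  ring

lemma continuous_stdNormalPDF : Continuous stdNormalPDF :=
  continuous_iff_continuousAt.2 fun x => (hasDerivAt_stdNormalPDF x).continuousAt

lemma abs_stdNormalPDF_sub_le (x y : ℝ) : |stdNormalPDF x - stdNormalPDF y| ≤ |x - y| := by
  have := Convex.norm_image_sub_le_of_norm_hasDerivWithin_le (f := stdNormalPDF) (C := 1)
    (s := Set.univ) (x := y) (y := x)
    (fun z _ => (hasDerivAt_stdNormalPDF z).hasDerivWithinAt)
    (fun z _ => by
      rw [Real.norm_eq_abs, abs_mul, abs_neg, abs_of_nonneg (stdNormalPDF_nonneg z)]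
      exact abs_mul_stdNormalPDF_le z) convex_univ trivial trivial
  simpa using this

lemma stdNormalPDF_antitoneOn : AntitoneOn stdNormalPDF (Set.Ici 0) := by
  intro x hx y _ hxy
  rw [stdNormalPDF_eq, stdNormalPDF_eq]
  have : 0 ≤ x := hx
  gcongr

lemma stdNormalCDF_sub (a b : ℝ) :
    stdNormalCDF b - stdNormalCDF a = ∫ x in a..b, stdNormalPDF x := by
  have h : ∀ x, stdNormalCDF x = ∫ t in Set.Iic x, stdNormalPDF t := by
    intro x
    rw [stdNormalCDF, cdf_eq_real, Measure.real,
      gaussianReal_apply_eq_integral 0 one_ne_zero, ENNReal.toReal_ofReal]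
    · rfl
    · exact integral_nonneg fun t => gaussianPDFReal_nonneg _ _ _
  rw [h, h]
  apply intervalIntegral.integral_Iic_sub_Iic
  · exact (integrable_gaussianPDFReal 0 1).integrableOn
  · exact (integrable_gaussianPDFReal 0 1).integrableOn

lemma stdNormalCDF_nonneg (x : ℝ) : 0 ≤ stdNormalCDF x := cdf_nonneg _ _
lemma stdNormalCDF_le_one (x : ℝ) : stdNormalCDF x ≤ 1 := cdf_le_one _ _
lemma stdNormalCDF_mono : Monotone stdNormalCDF := monotone_cdf _

lemma stdNormalCDF_neg (x : ℝ) : stdNormalCDF (-x) = 1 - stdNormalCDF x := by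
  have hs : (gaussianReal 0 1).real (Set.Iic (-x)) = (gaussianReal 0 1).real (Set.Ici x) := by
    have : Measure.map (fun x : ℝ => -x) (gaussianReal 0 1) = gaussianReal 0 1 := by
      simpa using gaussianReal_map_neg (μ := 0) (v := 1)
    rw [Measure.real, ← this, Measure.map_apply measurable_neg measurableSet_Iic, this,
      Measure.real]
    congr 2
    ext y; simp
  have : NullSingletonClass (gaussianReal 0 1) :=
    nullSingletonClass_gaussianReal one_ne_zero
  have h2 : (gaussianReal 0 1).real (Set.Ici x) = (gaussianReal 0 1).real (Set.Iic x)ᶜ := by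
    rw [Set.compl_Iic, Measure.real, Measure.real, measure_congr Ioi_ae_eq_Ici]
  rw [stdNormalCDF, stdNormalCDF, cdf_eq_real, cdf_eq_real, hs, h2,
    probReal_compl_eq_one_sub measurableSet_Iic]

lemma stdNormalCDF_zero : stdNormalCDF 0 = 1 / 2 := by
  have := stdNormalCDF_neg 0
  rw [neg_zero] at this
  linarith

/-- Chebyshev's inequality. It is applied only at distances of order `√n`, where it already gives
the required `O(1/n)`. -/
lemma stdNormalCDF_neg_le {t : ℝ} (ht : 0 < t) : stdNormalCDF (-t) ≤ 1 / t ^ 2 := by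
  have h := meas_ge_le_variance_div_sq (μ := gaussianReal 0 1) (X := id)
    (memLp_id_gaussianReal 2) ht
  rw [variance_id_gaussianReal] at h
  have h0 : ∫ x, id x ∂(gaussianReal 0 1) = 0 := by simp
  rw [h0] at h
  have h1 : gaussianReal 0 1 (Set.Iic (-t)) ≤ ENNReal.ofReal (1 / t ^ 2) := by
    refine (measure_mono ?_).trans h
    intro y hy
    simp only [Set.mem_Iic] at hy
    simp only [id, sub_zero, Set.mem_ofPred_eq]
    rw [abs_of_neg (by linarith)]
    linarith
  rw [stdNormalCDF, cdf_eq_real, Measure.real]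
  exact ENNReal.toReal_le_of_le_ofReal (by positivity) h1

lemma abs_stdNormalCDF_add_sub_le (x d : ℝ) :
    |stdNormalCDF (x + d) - stdNormalCDF x - d * stdNormalPDF x| ≤ d ^ 2 := by
  have h : stdNormalCDF (x + d) - stdNormalCDF x - d * stdNormalPDF x
      = ∫ t in x..(x + d), (stdNormalPDF t - stdNormalPDF x) := by
    rw [intervalIntegral.integral_sub (continuous_stdNormalPDF.intervalIntegrable _ _)
      (by simp), stdNormalCDF_sub]
    simp
  rw [h]
  have := intervalIntegral.norm_integral_le_of_norm_le_const (a := x) (b := x + d) (C := |d|)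
    (f := fun t => stdNormalPDF t - stdNormalPDF x) (fun t ht => by
      rw [Real.norm_eq_abs]
      refine (abs_stdNormalPDF_sub_le t x).trans ?_
      rcases Set.mem_uIoc.1 ht with h | h
      · rw [abs_of_pos (by linarith), abs_of_pos (by linarith)]; linarith
      · rw [abs_of_nonpos (by linarith), abs_of_nonpos (by linarith)]; linarith)
  simpa [← sq] using this

lemma stdNormalCDF_sub_le {a b : ℝ} (ha : 0 ≤ a) (hab : a ≤ b) :
    stdNormalCDF b - stdNormalCDF a ≤ (b - a) * stdNormalPDF a := by
  rw [stdNormalCDF_sub]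
  have : ∫ x in a..b, stdNormalPDF x ≤ ∫ _ in a..b, stdNormalPDF a :=
    intervalIntegral.integral_mono_on hab (continuous_stdNormalPDF.intervalIntegrable _ _)
      (by simp) (fun x hx => stdNormalPDF_antitoneOn ha (ha.trans hx.1) hx.1)
  simpa using this

/-! ### Sums of unimodal functions -/

section Unimodal

variable {f : ℝ → ℝ} {c : ℝ}

lemma monotone_comp_min (hf : MonotoneOn f (Set.Iic c)) : Monotone fun x => f (min x c) :=
  fun _ _ hxy => hf (Set.mem_Iic.2 (min_le_right _ _)) (Set.mem_Iic.2 (min_le_right _ _))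
    (min_le_min_right c hxy)

lemma antitone_comp_max (hf : AntitoneOn f (Set.Ici c)) : Antitone fun x => f (max x c) :=
  fun _ _ hxy => hf (Set.mem_Ici.2 (le_max_right _ _)) (Set.mem_Ici.2 (le_max_right _ _))
    (max_le_max_right c hxy)

/-- Splits a function unimodal about `c` into a monotone and an antitone part, to which the monotone
comparisons of sums with integrals apply. -/
lemma comp_min_add_comp_max (f : ℝ → ℝ) (c x : ℝ) :
    f x = f (min x c) + f (max x c) - f c := by
  rcases le_total x c with h | h <;> simp [h]

lemma sum_abs_sub_le_of_unimodal (hm : MonotoneOn f (Set.Iic c))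
    (ha : AntitoneOn f (Set.Ici c)) (h0 : ∀ x, 0 ≤ f x) (R : ℕ) :
    ∑ n ∈ Finset.range R, |f ((n : ℝ) + 1) - f n| ≤ 2 * f c := by
  have h : ∀ n ∈ Finset.range R, |f ((n : ℝ) + 1) - f n| ≤
      ((fun k : ℕ => f (min (k : ℝ) c) - f (max (k : ℝ) c)) (n + 1)
        - (fun k : ℕ => f (min (k : ℝ) c) - f (max (k : ℝ) c)) n) := by
    intro n _
    have h1 := monotone_comp_min hm (show (n : ℝ) ≤ n + 1 by linarith)
    have h2 := antitone_comp_max ha (show (n : ℝ) ≤ n + 1 by linarith)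
    have e1 := comp_min_add_comp_max f c (n : ℝ)
    have e2 := comp_min_add_comp_max f c ((n : ℝ) + 1)
    simp only at h1 h2 ⊢
    push_cast
    rw [abs_le]
    constructor <;> linarith
  refine (Finset.sum_le_sum h).trans ?_
  rw [Finset.sum_range_sub (fun k : ℕ => f (min (k : ℝ) c) - f (max (k : ℝ) c))]
  have h1 : f (min (R : ℝ) c) ≤ f c :=
    hm (Set.mem_Iic.2 (min_le_right _ _)) Set.self_mem_Iic (min_le_right _ _)
  have h2 : f (max ((0 : ℕ) : ℝ) c) ≤ f c :=
    ha Set.self_mem_Ici (Set.mem_Ici.2 (le_max_right _ _)) (le_max_right _ _)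
  have h3 := h0 (max (R : ℝ) c)
  have h4 := h0 (min ((0 : ℕ) : ℝ) c)
  linarith

lemma abs_sum_sub_integral_le_of_unimodal (hm : MonotoneOn f (Set.Iic c))
    (ha : AntitoneOn f (Set.Ici c)) (h0 : ∀ x, 0 ≤ f x) (R : ℕ) :
    |∑ n ∈ Finset.range R, f n - ∫ x in (0 : ℝ)..R, f x| ≤ 2 * f c := by
  have m1 := monotone_comp_min hm
  have a1 := antitone_comp_max ha
  have i1 : IntervalIntegrable (fun x => f (min x c)) volume 0 R := m1.intervalIntegrable
  have i2 : IntervalIntegrable (fun x => f (max x c)) volume 0 R := a1.intervalIntegrable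
  have hs : ∑ n ∈ Finset.range R, f n = ∑ n ∈ Finset.range R, f (min (n : ℝ) c)
      + ∑ n ∈ Finset.range R, f (max (n : ℝ) c) - R * f c := by
    rw [Finset.sum_congr (g := fun n : ℕ => f (min (n : ℝ) c) + f (max (n : ℝ) c) - f c) rfl
      fun n _ => comp_min_add_comp_max f c (n : ℝ)]
    simp [Finset.sum_add_distrib, Finset.sum_sub_distrib]
  have hi : ∫ x in (0 : ℝ)..R, f x = (∫ x in (0 : ℝ)..R, f (min x c))
      + (∫ x in (0 : ℝ)..R, f (max x c)) - R * f c := by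
    rw [intervalIntegral.integral_congr (g := fun x => f (min x c) + f (max x c) - f c)
      fun x _ => comp_min_add_comp_max f c x]
    rw [intervalIntegral.integral_sub (i1.add i2) (by simp),
      intervalIntegral.integral_add i1 i2]
    simp
  have b1 := MonotoneOn.sum_le_integral (x₀ := 0) (a := R) (m1.monotoneOn _)
  have b2 := MonotoneOn.integral_le_sum (x₀ := 0) (a := R) (m1.monotoneOn _)
  have b3 := AntitoneOn.sum_le_integral (x₀ := 0) (a := R) (a1.antitoneOn _)
  have b4 := AntitoneOn.integral_le_sum (x₀ := 0) (a := R) (a1.antitoneOn _)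
  simp only [zero_add] at b1 b2 b3 b4
  have t1 := Finset.sum_range_sub (fun n : ℕ => f (min (n : ℝ) c)) R
  have t2 := Finset.sum_range_sub (fun n : ℕ => f (max (n : ℝ) c)) R
  rw [Finset.sum_sub_distrib] at t1 t2
  have h1 : f (min (R : ℝ) c) ≤ f c :=
    hm (Set.mem_Iic.2 (min_le_right _ _)) Set.self_mem_Iic (min_le_right _ _)
  have h2 : f (max ((0 : ℕ) : ℝ) c) ≤ f c :=
    ha Set.self_mem_Ici (Set.mem_Ici.2 (le_max_right _ _)) (le_max_right _ _)
  have h3 := h0 (max (R : ℝ) c)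
  have h4 := h0 (min ((0 : ℕ) : ℝ) c)
  have h5 := h0 c
  rw [hs, hi, abs_le]
  constructor <;> linarith

end Unimodal

/-- The Cauchy kernel is the common majorant for the local errors below: at width `s` of order `√n`
its sum costs only a factor of order `√n`. -/
lemma sum_inv_one_add_sq_le (c : ℝ) {s : ℝ} (hs : 0 < s) (R : ℕ) :
    ∑ n ∈ Finset.range R, (1 + (((n : ℝ) - c) / s) ^ 2)⁻¹ ≤ 2 + Real.pi * s := by
  have h := abs_sum_sub_integral_le_of_unimodal (f := fun x => (1 + ((x - c) / s) ^ 2)⁻¹) (c := c)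
    (fun x hx y hy hxy => by
      have hy' : y ≤ c := hy
      have : ((y - c) / s) ^ 2 ≤ ((x - c) / s) ^ 2 := by
        rw [div_pow, div_pow]
        gcongr ?_ / _
        nlinarith
      simp only
      gcongr)
    (fun x hx y hy hxy => by
      have hx' : c ≤ x := hx
      have : ((x - c) / s) ^ 2 ≤ ((y - c) / s) ^ 2 := by
        rw [div_pow, div_pow]
        gcongr ?_ / _
        nlinarith
      simp only
      gcongr)
    (fun x => by positivity) R
  have hi : ∫ x in (0 : ℝ)..R, (1 + ((x - c) / s) ^ 2)⁻¹ ≤ Real.pi * s := by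
    have e : ∀ x, (x - c) / s = x / s - c / s := fun x => sub_div _ _ _
    simp_rw [e]
    rw [intervalIntegral.integral_comp_div_sub (f := fun x => (1 + x ^ 2)⁻¹) hs.ne',
      integral_inv_one_add_sq, smul_eq_mul, mul_comm]
    gcongr
    linarith [Real.arctan_lt_pi_div_two (↑R / s - c / s),
      Real.neg_pi_div_two_lt_arctan (0 / s - c / s)]
  have h2 := (abs_le.1 h).2
  simp only [sub_self, zero_div] at h2
  norm_num at h2
  simp only [div_pow] at h2 hi ⊢
  linarith

/-! ### Binomial weights -/

/-- The probability that a binomial variable with parameters `n` and `θ` equals `j`. -/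
noncomputable def binomWeight (n : ℕ) (θ : ℝ) (j : ℕ) : ℝ :=
  (n.choose j : ℝ) * θ ^ j * (1 - θ) ^ (n - j)

section BinomWeight

variable {n : ℕ} {θ : ℝ}

lemma binomWeight_eq_eval (n : ℕ) (θ : ℝ) (j : ℕ) :
    binomWeight n θ j = (bernsteinPolynomial ℝ n j).eval θ := by
  simp [binomWeight, bernsteinPolynomial]

lemma binomWeight_nonneg (h0 : 0 ≤ θ) (h1 : θ ≤ 1) (j : ℕ) : 0 ≤ binomWeight n θ j := by
  have : 0 ≤ 1 - θ := by linarith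
  unfold binomWeight; positivity

lemma binomWeight_pos (h0 : 0 < θ) (h1 : θ < 1) {j : ℕ} (hj : j ≤ n) :
    0 < binomWeight n θ j := by
  have : 0 < 1 - θ := by linarith
  have := Nat.choose_pos hj
  unfold binomWeight; positivity

lemma binomWeight_eq_zero {j : ℕ} (hj : n < j) : binomWeight n θ j = 0 := by
  simp [binomWeight, Nat.choose_eq_zero_of_lt hj]

lemma binomWeight_succ_mul {j : ℕ} (hj : j < n) :
    binomWeight n θ (j + 1) * ((1 - θ) * (j + 1)) = binomWeight n θ j * (θ * (n - j)) := by
  have hc : (n.choose (j + 1) : ℝ) * (j + 1) = n.choose j * (n - j) := by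
    have := Nat.choose_succ_right_eq n j
    rw [← Nat.cast_sub hj.le]
    exact_mod_cast this
  have e : n - j = (n - (j + 1)) + 1 := by omega
  unfold binomWeight
  rw [e, pow_succ, pow_succ]
  linear_combination θ ^ j * θ * (1 - θ) ^ (n - (j + 1)) * (1 - θ) * hc

lemma sum_binomWeight_eq_sum_range {R : ℕ} (hR : n + 1 ≤ R) (F : ℕ → ℝ) :
    ∑ j ∈ Finset.range R, F j * binomWeight n θ j
      = ∑ j ∈ Finset.range (n + 1), F j * binomWeight n θ j := by
  symm
  apply Finset.sum_subset (Finset.range_mono hR)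
  intro j _ hj
  rw [binomWeight_eq_zero, mul_zero]
  simpa using hj

lemma sum_binomWeight (n : ℕ) (θ : ℝ) :
    ∑ j ∈ Finset.range (n + 1), binomWeight n θ j = 1 := by
  have := congrArg (Polynomial.eval θ) (bernsteinPolynomial.sum ℝ n)
  simpa [Polynomial.eval_finsetSum, ← binomWeight_eq_eval] using this

lemma sum_sq_sub_mul_binomWeight (n : ℕ) (θ : ℝ) :
    ∑ j ∈ Finset.range (n + 1), ((j : ℝ) - n * θ) ^ 2 * binomWeight n θ j
      = n * θ * (1 - θ) := by
  have := congrArg (Polynomial.eval θ) (bernsteinPolynomial.variance ℝ n)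
  simp only [Polynomial.eval_finsetSum, Polynomial.eval_mul, Polynomial.eval_pow,
    Polynomial.eval_sub, ← binomWeight_eq_eval] at this
  simp only [Polynomial.eval_X, Polynomial.eval_natCast,
    nsmul_eq_mul, Polynomial.eval_mul, Polynomial.eval_one] at this
  rw [← this]
  exact Finset.sum_congr rfl fun j _ => by ring

lemma sum_binomWeight_filter_le (h0 : 0 ≤ θ) (h1 : θ ≤ 1) {t : ℝ} (ht : 0 < t)
    {P : ℕ → Prop} [DecidablePred P] (hP : ∀ j : ℕ, P j → t ≤ |(j : ℝ) - n * θ|) (R : ℕ) :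
    ∑ j ∈ (Finset.range R).filter P, binomWeight n θ j ≤ n * θ * (1 - θ) / t ^ 2 := by
  rw [le_div_iff₀ (by positivity), ← sum_sq_sub_mul_binomWeight, Finset.sum_mul]
  have hnn : ∀ j : ℕ, 0 ≤ ((j : ℝ) - n * θ) ^ 2 * binomWeight n θ j := fun j =>
    mul_nonneg (sq_nonneg _) (binomWeight_nonneg h0 h1 j)
  calc ∑ j ∈ (Finset.range R).filter P, binomWeight n θ j * t ^ 2
      ≤ ∑ j ∈ (Finset.range R).filter P, ((j : ℝ) - n * θ) ^ 2 * binomWeight n θ j := by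
        apply Finset.sum_le_sum
        intro j hj
        rw [mul_comm]
        apply mul_le_mul_of_nonneg_right _ (binomWeight_nonneg h0 h1 j)
        rw [← sq_abs ((j : ℝ) - n * θ)]
        have := hP j (Finset.mem_filter.1 hj).2
        gcongr
    _ ≤ ∑ j ∈ Finset.range (R + (n + 1)), ((j : ℝ) - n * θ) ^ 2 * binomWeight n θ j := by
        apply Finset.sum_le_sum_of_subset_of_nonneg
        · exact (Finset.filter_subset _ _).trans (Finset.range_mono (by omega))
        · intro j _ _; exact hnn j
    _ = _ := sum_binomWeight_eq_sum_range (by omega) _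

end BinomWeight

/-! ### Comparing a probability vector with an approximately proportional one -/

/-- The factor `c` need not be known: since `q` and `g` both have mass within `O(η)` of `1` on the
set `G`, proportionality there forces `|c - 1| ≤ 6η`. Off `G` both masses are small. -/
lemma sum_abs_sub_le_of_approx_proportional {ι : Type*} (s : Finset ι) (G : ι → Prop)
    [DecidablePred G] {q g e : ι → ℝ} {c η : ℝ} (hq : ∀ i ∈ s, 0 ≤ q i)
    (hg : ∀ i ∈ s, 0 ≤ g i) (hc : 0 ≤ c) (hq1 : ∑ i ∈ s, q i = 1)
    (hg1 : |∑ i ∈ s, g i - 1| ≤ η) (hqb : ∑ i ∈ s with ¬ G i, q i ≤ η)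
    (hgb : ∑ i ∈ s with ¬ G i, g i ≤ η) (he : ∑ i ∈ s with G i, e i ≤ η)
    (hqe : ∀ i ∈ s, G i → |q i - c * g i| ≤ c * e i) :
    ∑ i ∈ s, |q i - g i| ≤ 13 * η := by
  have hη : 0 ≤ η := (abs_nonneg _).trans hg1
  obtain ⟨g1, g2⟩ := abs_le.1 hg1
  -- For `η > 1/6` the trivial bound `2 + η` is already below `13η`.
  rcases lt_or_ge (1 / 6) η with h | h
  · calc ∑ i ∈ s, |q i - g i| ≤ ∑ i ∈ s, (q i + g i) := by
          apply Finset.sum_le_sum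
          intro i hi
          have := hq i hi; have := hg i hi
          rw [abs_le]; constructor <;> linarith
      _ ≤ 13 * η := by rw [Finset.sum_add_distrib]; linarith
  have sq := Finset.sum_filter_add_sum_filter_not s G q
  have sg := Finset.sum_filter_add_sum_filter_not s G g
  have sd := Finset.sum_filter_add_sum_filter_not s G (fun i => |q i - g i|)
  have nq : 0 ≤ ∑ i ∈ s with ¬ G i, q i :=
    Finset.sum_nonneg fun i hi => hq i (Finset.mem_filter.1 hi).1
  have ng : 0 ≤ ∑ i ∈ s with ¬ G i, g i :=
    Finset.sum_nonneg fun i hi => hg i (Finset.mem_filter.1 hi).1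
  set Qg := ∑ i ∈ s with G i, q i
  set Gg := ∑ i ∈ s with G i, g i
  have h1 : ∑ i ∈ s with G i, |q i - c * g i| ≤ c * η := by
    calc ∑ i ∈ s with G i, |q i - c * g i| ≤ ∑ i ∈ s with G i, c * e i :=
          Finset.sum_le_sum fun i hi =>
            hqe i (Finset.mem_filter.1 hi).1 (Finset.mem_filter.1 hi).2
      _ ≤ c * η := by rw [← Finset.mul_sum]; gcongr
  have h2 : |Qg - c * Gg| ≤ c * η := by
    refine le_trans ?_ h1
    have : Qg - c * Gg = ∑ i ∈ s with G i, (q i - c * g i) := by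
      rw [Finset.sum_sub_distrib, ← Finset.mul_sum]
    rw [this]
    exact Finset.abs_sum_le_sum_abs _ _
  obtain ⟨h3, h4⟩ := abs_le.1 h2
  -- The mass of `g` on `G` is at least `1 - 2η`, so `c(1 - 3η) ≤ 1`, and `3η ≤ 1/2`.
  have c2 : c ≤ 2 := by nlinarith
  have c3 : |c - 1| ≤ 6 * η := by
    rw [abs_le]; constructor <;> nlinarith
  have h5 : ∑ i ∈ s with G i, |q i - g i| ≤ c * η + |c - 1| * Gg := by
    have : ∑ i ∈ s with G i, |q i - g i|
        ≤ ∑ i ∈ s with G i, (|q i - c * g i| + |c - 1| * g i) := by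
      apply Finset.sum_le_sum
      intro i hi
      have e1 : q i - g i = (q i - c * g i) + (c - 1) * g i := by ring
      rw [e1]
      refine (abs_add_le _ _).trans ?_
      rw [abs_mul, abs_of_nonneg (hg i (Finset.mem_filter.1 hi).1)]
    rw [Finset.sum_add_distrib, ← Finset.mul_sum] at this
    linarith
  have h6 : ∑ i ∈ s with ¬ G i, |q i - g i| ≤ 2 * η := by
    calc ∑ i ∈ s with ¬ G i, |q i - g i| ≤ ∑ i ∈ s with ¬ G i, (q i + g i) := by
          apply Finset.sum_le_sum
          intro i hi
          have := hq i (Finset.mem_filter.1 hi).1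
          have := hg i (Finset.mem_filter.1 hi).1
          rw [abs_le]; constructor <;> linarith
      _ ≤ 2 * η := by rw [Finset.sum_add_distrib]; linarith
  have hG : Gg ≤ 7 / 6 := by linarith
  have : |c - 1| * Gg ≤ 6 * η * (7 / 6) := by
    have : 0 ≤ Gg := Finset.sum_nonneg fun i hi => hg i (Finset.mem_filter.1 hi).1
    gcongr
  have : c * η ≤ 2 * η := by gcongr
  linarith

/-! ### Elementary estimates for increments, exponentials and logarithms -/

lemma abs_sub_le_of_abs_succ_sub_le {r : ℕ → ℝ} {A : ℝ} {a b : ℕ} (hab : a ≤ b)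
    (h : ∀ i, a ≤ i → i < b → |r (i + 1) - r i| ≤ A) :
    |r b - r a| ≤ ((b : ℝ) - a) * A := by
  induction b, hab using Nat.le_induction with
  | base => simp
  | succ b hb ih =>
    have h1 := ih fun i hi hi' => h i hi (by omega)
    have h2 := h b hb (by omega)
    have e : r (b + 1) - r a = (r (b + 1) - r b) + (r b - r a) := by ring
    rw [e]
    refine (abs_add_le _ _).trans ?_
    push_cast
    linarith

/-- This is the `k`-th power of `1 + y ≤ exp y` at `y = a x² / k`; the condition `a ≤ k` gives
`(a/k)(1 + x²) ≤ 1 + y`. -/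
lemma one_add_sq_pow_mul_exp_le {a : ℝ} (ha : 0 < a) {k : ℕ} (hk : a ≤ k) (x : ℝ) :
    (1 + x ^ 2) ^ k * Real.exp (-(a * x ^ 2)) ≤ (k / a) ^ k := by
  have hk0 : (0 : ℝ) < k := ha.trans_le hk
  have h1 : a / k * (1 + x ^ 2) ≤ Real.exp (a * x ^ 2 / k) := by
    have h := Real.add_one_le_exp (a * x ^ 2 / k)
    have : a / k ≤ 1 := by rw [div_le_one hk0]; exact hk
    have e : a / k * (1 + x ^ 2) = a / k + a * x ^ 2 / k := by ring
    linarith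
  have h2 : (a / k * (1 + x ^ 2)) ^ k ≤ Real.exp (a * x ^ 2) := by
    calc (a / k * (1 + x ^ 2)) ^ k ≤ Real.exp (a * x ^ 2 / k) ^ k := by gcongr
      _ = Real.exp (a * x ^ 2) := by
        rw [← Real.exp_nat_mul]; congr 1; field_simp
  rw [mul_pow] at h2
  rw [Real.exp_neg, ← div_eq_mul_inv, div_le_iff₀ (Real.exp_pos _)]
  calc (1 + x ^ 2) ^ k = (k / a) ^ k * ((a / k) ^ k * (1 + x ^ 2) ^ k) := by
        rw [← mul_assoc, ← mul_pow]
        have : (k : ℝ) / a * (a / k) = 1 := by field_simp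
        rw [this]; simp
    _ ≤ _ := by gcongr

lemma abs_exp_sub_one_le_mul_exp {x E : ℝ} (h : |x| ≤ E) :
    |Real.exp x - 1| ≤ E * Real.exp E := by
  have hE : 0 ≤ E := (abs_nonneg x).trans h
  obtain ⟨h1, h2⟩ := abs_le.1 h
  have h3 : Real.exp x ≤ Real.exp E := Real.exp_le_exp.2 h2
  have h4 := Real.add_one_le_exp x
  have h5 : 1 ≤ Real.exp E := Real.one_le_exp hE
  have h6 : Real.exp E - 1 ≤ E * Real.exp E := by
    have := Real.add_one_le_exp (-E)
    have e : Real.exp E * Real.exp (-E) = 1 := by rw [← Real.exp_add]; simp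
    nlinarith
  rw [abs_le]; constructor <;> nlinarith

lemma abs_log_one_add_sub_le {x : ℝ} (hx : |x| ≤ 1 / 2) :
    |Real.log (1 + x) - x| ≤ 2 * x ^ 2 := by
  have h := Real.abs_log_sub_add_sum_range_le (x := -x) (by rw [abs_neg]; linarith) 1
  simp only [Finset.sum_range_one, abs_neg, sub_neg_eq_add] at h
  norm_num at h
  have h2 : x ^ 2 / (1 - |x|) ≤ 2 * x ^ 2 := by
    rw [div_le_iff₀ (by linarith)]
    nlinarith [sq_nonneg x]
  have e : Real.log (1 + x) - x = -x + Real.log (1 + x) := by ring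
  rw [e]; linarith

/-- The function is odd in `z`, so the quadratic terms cancel. This cancellation is what makes the
symmetric binomial approximation accurate to `1/n` rather than `1/√n`. -/
lemma abs_log_div_add_two_mul_le {z : ℝ} (hz : |z| ≤ 1 / 2) :
    |Real.log ((1 - z) / (1 + z)) + 2 * z| ≤ 4 * |z| ^ 3 := by
  have h1 := Real.abs_log_sub_add_sum_range_le (x := z) (by linarith) 2
  have h2 := Real.abs_log_sub_add_sum_range_le (x := -z) (by rw [abs_neg]; linarith) 2
  simp only [Finset.sum_range_succ, Finset.sum_range_zero, abs_neg, sub_neg_eq_add] at h1 h2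
  norm_num at h1 h2
  have h3 : |z| ^ 3 / (1 - |z|) ≤ 2 * |z| ^ 3 := by
    rw [div_le_iff₀ (by linarith)]
    nlinarith [pow_nonneg (abs_nonneg z) 3]
  obtain ⟨z1, z2⟩ := abs_le.1 hz
  rw [Real.log_div (by linarith) (by linarith)]
  obtain ⟨a1, a2⟩ := abs_le.1 h1
  obtain ⟨b1, b2⟩ := abs_le.1 h2
  rw [abs_le]; constructor <;> linarith

/-! ### The symmetric binomial distribution -/

lemma stdNormalCDF_sub_le_of_le {a b M : ℝ} (hab : a ≤ b)
    (hM : ∀ t ∈ Set.Icc a b, stdNormalPDF t ≤ M) :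
    stdNormalCDF b - stdNormalCDF a ≤ (b - a) * M := by
  rw [stdNormalCDF_sub]
  have : ∫ x in a..b, stdNormalPDF x ≤ ∫ _ in a..b, M :=
    intervalIntegral.integral_mono_on hab (continuous_stdNormalPDF.intervalIntegrable _ _)
      (by simp) hM
  simpa using this

lemma stdNormalPDF_add (x s : ℝ) :
    stdNormalPDF (x + s) = stdNormalPDF x * Real.exp (-(x * s + s ^ 2 / 2)) := by
  rw [stdNormalPDF_eq, stdNormalPDF_eq, mul_assoc, ← Real.exp_add]
  congr 2; ring

/-- A midpoint rule with error relative to the density at `x`, so that it remains summable over all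
cells. -/
lemma abs_stdNormalCDF_cell_sub_le {x δ : ℝ} (h0 : 0 ≤ δ) (h1 : δ ≤ 1) (hx : |x| * δ ≤ 1 / 2) :
    |stdNormalCDF (x + δ) - stdNormalCDF (x - δ) - 2 * δ * stdNormalPDF x|
      ≤ 2 * δ * stdNormalPDF x * ((2 * x ^ 2 + 1) * δ ^ 2) := by
  have hφ := stdNormalPDF_nonneg x
  -- The subtracted linear term integrates to zero over the symmetric interval.
  have h : stdNormalCDF (x + δ) - stdNormalCDF (x - δ) - 2 * δ * stdNormalPDF x
      = ∫ s in (-δ)..δ, (stdNormalPDF (x + s) - (stdNormalPDF x - x * stdNormalPDF x * s)) := by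
    have hc : Continuous fun s => stdNormalPDF (x + s) :=
      continuous_stdNormalPDF.comp (continuous_const.add continuous_id)
    rw [intervalIntegral.integral_sub (hc.intervalIntegrable _ _)
      ((by fun_prop : Continuous fun s => stdNormalPDF x - x * stdNormalPDF x * s).intervalIntegrable
        _ _), intervalIntegral.integral_sub (by simp)
      ((by fun_prop : Continuous fun s => x * stdNormalPDF x * s).intervalIntegrable _ _),
      stdNormalCDF_sub, intervalIntegral.integral_comp_add_left (f := stdNormalPDF),
      intervalIntegral.integral_const_mul, integral_id, ← sub_eq_add_neg,
      intervalIntegral.integral_const, smul_eq_mul]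
    ring
  rw [h]
  have := intervalIntegral.norm_integral_le_of_norm_le_const (a := -δ) (b := δ)
    (C := stdNormalPDF x * ((2 * x ^ 2 + 1) * δ ^ 2))
    (f := fun s => stdNormalPDF (x + s) - (stdNormalPDF x - x * stdNormalPDF x * s))
    (fun s hs => by
      rw [Set.uIoc_of_le (by linarith)] at hs
      have hsδ : |s| ≤ δ := abs_le.2 ⟨hs.1.le, hs.2⟩
      have hs2 : s ^ 2 ≤ δ ^ 2 := by rw [← sq_abs]; gcongr
      have hs3 : s ^ 2 ≤ 1 := hs2.trans (by nlinarith)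
      have hxs : |x * s| ≤ 1 / 2 := by
        rw [abs_mul]; exact (mul_le_mul_of_nonneg_left hsδ (abs_nonneg x)).trans hx
      have hv : |-(x * s + s ^ 2 / 2)| ≤ 1 := by
        rw [abs_neg]
        refine (abs_add_le _ _).trans ?_
        rw [abs_of_nonneg (by positivity : 0 ≤ s ^ 2 / 2)]
        linarith
      have he := Real.abs_exp_sub_one_sub_id_le hv
      have e : stdNormalPDF (x + s) - (stdNormalPDF x - x * stdNormalPDF x * s)
          = stdNormalPDF x * ((Real.exp (-(x * s + s ^ 2 / 2)) - 1 - -(x * s + s ^ 2 / 2))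
            - s ^ 2 / 2) := by
        rw [stdNormalPDF_add]; ring
      rw [Real.norm_eq_abs, e, abs_mul, abs_of_nonneg hφ]
      gcongr
      refine (abs_sub _ _).trans ?_
      rw [abs_of_nonneg (by positivity : 0 ≤ s ^ 2 / 2)]
      have h4 : (-(x * s + s ^ 2 / 2)) ^ 2 ≤ 2 * (x ^ 2 * s ^ 2) + s ^ 2 * s ^ 2 / 2 := by
        nlinarith [sq_nonneg (x * s - s ^ 2 / 2)]
      have h5 : x ^ 2 * s ^ 2 ≤ x ^ 2 * δ ^ 2 := by gcongr
      have h6 : s ^ 2 * s ^ 2 ≤ 1 * s ^ 2 := by gcongr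
      nlinarith)
  rw [Real.norm_eq_abs] at this
  refine this.trans (le_of_eq ?_)
  rw [abs_of_nonneg (by linarith)]
  ring

/-- The normal mass of the cell of length `2 / √n` around the standardized binomial atom `j`. -/
noncomputable def normalCell (n j : ℕ) : ℝ :=
  stdNormalCDF ((2 * j + 1 - n) / √n) - stdNormalCDF ((2 * j - 1 - n) / √n)

lemma normalCell_nonneg (n j : ℕ) : 0 ≤ normalCell n j := by
  unfold normalCell
  rw [sub_nonneg]
  apply stdNormalCDF_mono
  gcongr ?_ / _
  linarith

lemma sum_normalCell (n R : ℕ) : ∑ j ∈ Finset.range R, normalCell n j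
    = stdNormalCDF ((2 * R - 1 - n) / √n) - stdNormalCDF ((-1 - n) / √n) := by
  have := Finset.sum_range_sub (fun j : ℕ => stdNormalCDF ((2 * (j : ℝ) - 1 - n) / √n)) R
  simp only [Nat.cast_zero, mul_zero, zero_sub] at this
  rw [← this]
  refine Finset.sum_congr rfl fun j _ => ?_
  unfold normalCell
  push_cast
  congr 3; ring

lemma stdNormalCDF_neg_div_sqrt_le {n : ℕ} (hn : 0 < n) {y : ℝ} (hy : n ≤ y) :
    stdNormalCDF (-(y / √n)) ≤ 1 / n := by
  have hn' : (0 : ℝ) < n := by exact_mod_cast hn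
  have hs : 0 < √(n : ℝ) := by positivity
  have hy' : 0 < y := hn'.trans_le hy
  calc stdNormalCDF (-(y / √n)) ≤ 1 / (y / √n) ^ 2 := stdNormalCDF_neg_le (by positivity)
    _ = n / (y * y) := by rw [div_pow, Real.sq_sqrt hn'.le]; field_simp
    _ ≤ n / (n * n) := by gcongr
    _ = 1 / n := by field_simp

lemma abs_sum_normalCell_sub_one_le {n : ℕ} (hn : 0 < n) :
    |∑ j ∈ Finset.range (n + 1), normalCell n j - 1| ≤ 2 / n := by
  rw [sum_normalCell]
  have h1 : stdNormalCDF ((-1 - n) / √n) ≤ 1 / n := by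
    have := stdNormalCDF_neg_div_sqrt_le hn (y := n + 1) (by linarith)
    convert this using 2; ring
  have h2 : 1 - stdNormalCDF ((2 * (n + 1 : ℕ) - 1 - n) / √n) ≤ 1 / n := by
    rw [← stdNormalCDF_neg]
    have := stdNormalCDF_neg_div_sqrt_le hn (y := n + 1) (by linarith)
    convert this using 3; push_cast; ring
  have h3 := stdNormalCDF_nonneg ((-1 - n) / √n)
  have h4 := stdNormalCDF_le_one ((2 * (n + 1 : ℕ) - 1 - n) / √n)
  have e : (2 : ℝ) / n = 1 / n + 1 / n := by ring
  rw [abs_le]; constructor <;> linarith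

/-- Logarithm of the symmetric binomial weight, with its Gaussian part removed. -/
noncomputable def logRatioHalf (n j : ℕ) : ℝ :=
  Real.log (binomWeight n (1 / 2) j) + (2 * j - n : ℝ) ^ 2 / (2 * n)

/-- With `z = (2i - n + 1)/(n + 1)` the ratio of consecutive weights is `(1 - z)/(1 + z)`. Its
logarithm `-2z + O(z³)` is cancelled by the increment of the quadratic, up to `2(2i - n + 1)/(n(n +
1))`. -/
lemma abs_logRatioHalf_succ_sub_le {n i : ℕ} (hi : i < n) {Y : ℝ}
    (hY : |(2 * i - n + 1 : ℝ)| ≤ Y) (hYn : Y ≤ n / 2) :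
    |logRatioHalf n (i + 1) - logRatioHalf n i| ≤ 4 * Y ^ 3 / n ^ 3 + 2 * Y / n ^ 2 := by
  have hn : (0 : ℝ) < n := by exact_mod_cast (Nat.zero_le i).trans_lt hi
  have hin : (i : ℝ) < n := by exact_mod_cast hi
  have hi0 : (0 : ℝ) ≤ i := by positivity
  set y : ℝ := 2 * i - n + 1 with hy
  set z : ℝ := y / (n + 1) with hz
  have hn1 : (0 : ℝ) < n + 1 := by linarith
  have hq := binomWeight_pos (n := n) (θ := 1 / 2) (by norm_num) (by norm_num) hi.le
  have hrec := binomWeight_succ_mul (n := n) (θ := 1 / 2) hi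
  have hratio : binomWeight n (1 / 2) (i + 1) = binomWeight n (1 / 2) i * ((1 - z) / (1 + z)) := by
    have e1 : 1 - z = 2 * (n - i) / (n + 1) := by rw [hz, hy]; field_simp; ring
    have e2 : 1 + z = 2 * (i + 1) / (n + 1) := by rw [hz, hy]; field_simp; ring
    rw [e1, e2]
    field_simp
    norm_num at hrec
    linarith
  have hz2 : |z| ≤ Y / n := by
    rw [hz, abs_div, abs_of_pos hn1]
    exact div_le_div₀ ((abs_nonneg _).trans hY) hY hn (by linarith)
  have hzh : |z| ≤ 1 / 2 := hz2.trans (by rw [div_le_iff₀ hn]; linarith)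
  obtain ⟨z1, z2⟩ := abs_le.1 hzh
  have hlog := abs_log_div_add_two_mul_le hzh
  have e : logRatioHalf n (i + 1) - logRatioHalf n i
      = (Real.log ((1 - z) / (1 + z)) + 2 * z) + 2 * y / (n * (n + 1)) := by
    unfold logRatioHalf
    rw [hratio, Real.log_mul hq.ne' (by
      have : 0 < 1 - z := by linarith
      have : 0 < 1 + z := by linarith
      positivity)]
    have : ((2 * ((i + 1 : ℕ) : ℝ) - n) ^ 2 / (2 * n) : ℝ)
        = (2 * i - n : ℝ) ^ 2 / (2 * n) + 2 * z + 2 * y / (n * (n + 1)) := by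
      rw [hz, hy]; push_cast; field_simp; ring
    rw [this]; ring
  rw [e]
  refine (abs_add_le _ _).trans (add_le_add (hlog.trans ?_) ?_)
  · calc 4 * |z| ^ 3 ≤ 4 * (Y / n) ^ 3 := by gcongr
      _ = _ := by rw [div_pow]; ring
  · rw [abs_div, abs_mul, abs_of_pos (by positivity : (0 : ℝ) < n * (n + 1)), abs_two]
    have : (0 : ℝ) ≤ Y := (abs_nonneg _).trans hY
    apply div_le_div₀ (by positivity) (by linarith) (by positivity)
    nlinarith

/-- Telescopes from the central index `n / 2` in at most `Y` steps; the extra `1` in `Y` absorbs the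
rounding of `n / 2` and the shift in the one-step bound. -/
lemma abs_logRatioHalf_sub_le {n j : ℕ} (hj : j ≤ n) {Y : ℝ}
    (hY : |(2 * j - n : ℝ)| + 1 ≤ Y) (hYn : Y ≤ n / 2) :
    |logRatioHalf n j - logRatioHalf n (n / 2)| ≤ Y * (4 * Y ^ 3 / n ^ 3 + 2 * Y / n ^ 2) := by
  have hY0 : 0 ≤ Y := by linarith [abs_nonneg (2 * j - n : ℝ)]
  have hA : 0 ≤ 4 * Y ^ 3 / n ^ 3 + 2 * Y / n ^ 2 := by positivity
  have c1 : (2 * (n / 2 : ℕ) : ℝ) ≤ n := by exact_mod_cast Nat.mul_div_le n 2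
  have c2 : (n : ℝ) ≤ 2 * (n / 2 : ℕ) + 1 := by
    have : n ≤ 2 * (n / 2) + 1 := by omega
    exact_mod_cast this
  obtain ⟨a1, a2⟩ := abs_le.1 (le_sub_iff_add_le.2 hY)
  rcases le_total (n / 2) j with h | h
  · refine (abs_sub_le_of_abs_succ_sub_le h (A := 4 * Y ^ 3 / n ^ 3 + 2 * Y / n ^ 2) ?_).trans ?_
    · intro i hi1 hi2
      apply abs_logRatioHalf_succ_sub_le (by omega) _ hYn
      have b1 : ((n / 2 : ℕ) : ℝ) ≤ i := by exact_mod_cast hi1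
      have b2 : (i : ℝ) + 1 ≤ j := by exact_mod_cast hi2
      rw [abs_le]; constructor <;> linarith
    · gcongr; linarith
  · rw [abs_sub_comm]
    refine (abs_sub_le_of_abs_succ_sub_le h (A := 4 * Y ^ 3 / n ^ 3 + 2 * Y / n ^ 2) ?_).trans ?_
    · intro i hi1 hi2
      apply abs_logRatioHalf_succ_sub_le (by omega) _ hYn
      have b1 : (j : ℝ) ≤ i := by exact_mod_cast hi1
      have b2 : (i : ℝ) + 1 ≤ (n / 2 : ℕ) := by exact_mod_cast hi2
      rw [abs_le]; constructor <;> linarith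
    · gcongr; linarith

lemma one_add_sq_pow_mul_stdNormalPDF_le (x : ℝ) : (1 + x ^ 2) ^ 2 * stdNormalPDF x ≤ 8 := by
  have h := one_add_sq_pow_mul_exp_le (a := 1 / 2) (k := 2) (by norm_num) (by norm_num) x
  rw [stdNormalPDF_eq]
  have e : -(1 / 2 * x ^ 2) = -x ^ 2 / 2 := by ring
  rw [e] at h
  have h1 := inv_sqrt_two_pi_le
  norm_num at h
  calc (1 + x ^ 2) ^ 2 * ((√(2 * Real.pi))⁻¹ * Real.exp (-x ^ 2 / 2))
      = (√(2 * Real.pi))⁻¹ * ((1 + x ^ 2) ^ 2 * Real.exp (-x ^ 2 / 2)) := by ring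
    _ ≤ 1 / 2 * 16 := by gcongr
    _ = 8 := by norm_num

lemma stdNormalPDF_le_of_le_abs {n : ℕ} (hn : 0 < n) {y : ℝ} (hy : √n / 16 ≤ |y|) :
    stdNormalPDF y ≤ 524288 / n ^ 2 := by
  have hn' : (0 : ℝ) < n := by exact_mod_cast hn
  have h := one_add_sq_pow_mul_stdNormalPDF_le y
  have h1 : (n : ℝ) / 256 ≤ 1 + y ^ 2 := by
    have : (√n / 16) ^ 2 ≤ |y| ^ 2 := by gcongr
    rw [sq_abs, div_pow, Real.sq_sqrt hn'.le] at this
    linarith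
  have h2 : ((n : ℝ) / 256) ^ 2 * stdNormalPDF y ≤ 8 := by
    refine le_trans ?_ h
    have := stdNormalPDF_nonneg y
    gcongr
  rw [le_div_iff₀ (by positivity)]
  linarith

lemma normalCell_le_of_not_good {n j : ℕ} (hn : 32 ≤ n)
    (hj : ¬ |(2 * j - n : ℝ)| + 1 ≤ n / 8) : normalCell n j ≤ 2 / √n * (524288 / n ^ 2) := by
  have hn' : (32 : ℝ) ≤ n := by exact_mod_cast hn
  have hs : 0 < √(n : ℝ) := by positivity
  have hss : √(n : ℝ) * √n = n := Real.mul_self_sqrt (by positivity)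
  unfold normalCell
  have h := stdNormalCDF_sub_le_of_le (a := (2 * j - 1 - n) / √n) (b := (2 * j + 1 - n) / √n)
    (M := 524288 / n ^ 2) (by gcongr ?_ / _; linarith) (by
      intro t ht
      apply stdNormalPDF_le_of_le_abs (by omega)
      obtain ⟨h1, h2⟩ := ht
      rw [div_le_iff₀ hs] at h1
      rw [le_div_iff₀ hs] at h2
      push Not at hj
      -- A point `t` of the cell has `|t|√n ≥ |2j - n| - 1 > n/8 - 2`, and `n ≥ 32` makes this at
      -- least `n/16`.
      have h3 : (n : ℝ) / 16 ≤ |t| * √n := by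
        rcases le_or_gt 0 (2 * j - n : ℝ) with h | h
        · rw [abs_of_nonneg h] at hj
          have := le_abs_self t
          nlinarith
        · rw [abs_of_neg h] at hj
          have := neg_abs_le t
          nlinarith
      have h4 : √(n : ℝ) / 16 * √n ≤ |t| * √n := by linarith
      exact le_of_mul_le_mul_right h4 hs)
  refine h.trans (le_of_eq ?_)
  congr 1
  field_simp; ring

/-- The exponent error `E` has two bounds: `O((1 + x²)²/n)` for its size, and `x²/8 + 1/4`, valid in
the bulk, for its exponential. The density absorbs both the exponential and the polynomial factors,
and a Cauchy kernel is left. -/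
lemma exp_error_mul_stdNormalPDF_le {n : ℕ} (hn : 0 < n) {x Y : ℝ}
    (hY : Y = |x| * √n + 1) (hYn : Y ≤ n / 8) :
    stdNormalPDF x * (Y * (4 * Y ^ 3 / n ^ 3 + 2 * Y / n ^ 2)
      * Real.exp (Y * (4 * Y ^ 3 / n ^ 3 + 2 * Y / n ^ 2)) + (2 * x ^ 2 + 1) / n)
      ≤ 10300 / n * (1 + x ^ 2)⁻¹ := by
  have hn' : (1 : ℝ) ≤ n := by exact_mod_cast hn
  have hn0 : (0 : ℝ) < n := by linarith
  have hY0 : 0 ≤ Y := by rw [hY]; positivity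
  have hYs : Y ^ 2 / n ≤ 2 * (1 + x ^ 2) := by
    rw [div_le_iff₀ hn0, hY]
    have e : (|x| * √n) ^ 2 = x ^ 2 * n := by
      rw [mul_pow, sq_abs, Real.sq_sqrt hn0.le]
    nlinarith [sq_nonneg (|x| * √n - 1)]
  have hYs0 : 0 ≤ Y ^ 2 / n := by positivity
  set E := Y * (4 * Y ^ 3 / n ^ 3 + 2 * Y / n ^ 2) with hE
  have eE : E = 1 / n * (4 * (Y ^ 2 / n) ^ 2 + 2 * (Y ^ 2 / n)) := by
    rw [hE]; field_simp
  have hE1 : E ≤ 20 / n * (1 + x ^ 2) ^ 2 := by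
    have : 4 * (Y ^ 2 / n) ^ 2 + 2 * (Y ^ 2 / n) ≤ 20 * (1 + x ^ 2) ^ 2 := by
      have h1 : (Y ^ 2 / n) ^ 2 ≤ (2 * (1 + x ^ 2)) ^ 2 := by gcongr
      nlinarith [sq_nonneg x, sq_nonneg (x ^ 2)]
    rw [eE]
    calc 1 / n * (4 * (Y ^ 2 / n) ^ 2 + 2 * (Y ^ 2 / n)) ≤ 1 / n * (20 * (1 + x ^ 2) ^ 2) := by
          gcongr
      _ = _ := by ring
  have hYd : Y / n ≤ 1 / 8 := by rw [div_le_iff₀ hn0]; linarith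
  have hYd0 : 0 ≤ Y / n := by positivity
  have hE2 : E ≤ x ^ 2 / 8 + 1 / 4 := by
    have e2 : E = 4 * (Y / n) ^ 2 * (Y ^ 2 / n) + 2 * (Y / n) ^ 2 := by
      rw [hE]; field_simp
    have h1 : (Y / n) ^ 2 ≤ (1 / 8) ^ 2 := by gcongr
    rw [e2]
    have h2 : 4 * (Y / n) ^ 2 * (Y ^ 2 / n) ≤ 4 * (1 / 8) ^ 2 * (2 * (1 + x ^ 2)) := by gcongr
    linarith
  have hE0 : 0 ≤ E := by rw [hE]; positivity
  have hexp : Real.exp E ≤ 2 * Real.exp (x ^ 2 / 8) := by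
    have h1 : Real.exp E ≤ Real.exp (1 / 4 + x ^ 2 / 8) := Real.exp_le_exp.2 (by linarith)
    rw [Real.exp_add] at h1
    have h2 := (abs_le.1 (Real.abs_exp_sub_one_le (x := 1 / 4) (by norm_num))).2
    norm_num at h2
    refine h1.trans ?_
    gcongr
    norm_num
    linarith
  have h3 := one_add_sq_pow_mul_exp_le (a := 3 / 8) (k := 3) (by norm_num) (by norm_num) x
  norm_num at h3
  have h4 := one_add_sq_pow_mul_stdNormalPDF_le x
  have hφ := stdNormalPDF_nonneg x
  have hφe : stdNormalPDF x * Real.exp E ≤ Real.exp (-(3 / 8 * x ^ 2)) := by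
    have e1 : Real.exp (-x ^ 2 / 2) * Real.exp (x ^ 2 / 8) = Real.exp (-(3 / 8 * x ^ 2)) := by
      rw [← Real.exp_add]; congr 1; ring
    rw [← e1]
    calc stdNormalPDF x * Real.exp E ≤ stdNormalPDF x * (2 * Real.exp (x ^ 2 / 8)) := by gcongr
      _ = ((√(2 * Real.pi))⁻¹ * 2) * (Real.exp (-x ^ 2 / 2) * Real.exp (x ^ 2 / 8)) := by
        rw [stdNormalPDF_eq]; ring
      _ ≤ 1 * (Real.exp (-x ^ 2 / 2) * Real.exp (x ^ 2 / 8)) := by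
        gcongr; linarith [inv_sqrt_two_pi_le]
      _ = _ := one_mul _
  have hx : (0 : ℝ) < 1 + x ^ 2 := by positivity
  rw [← div_eq_mul_inv, le_div_iff₀ hx]
  have p1 : stdNormalPDF x * (E * Real.exp E) * (1 + x ^ 2) ≤ 10240 / n := by
    calc stdNormalPDF x * (E * Real.exp E) * (1 + x ^ 2)
        = (stdNormalPDF x * Real.exp E) * (E * (1 + x ^ 2)) := by ring
      _ ≤ Real.exp (-(3 / 8 * x ^ 2)) * (20 / n * (1 + x ^ 2) ^ 2 * (1 + x ^ 2)) := by gcongr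
      _ = 20 / n * ((1 + x ^ 2) ^ 3 * Real.exp (-(3 / 8 * x ^ 2))) := by ring
      _ ≤ 20 / n * 512 := by gcongr
      _ = _ := by ring
  have p2 : stdNormalPDF x * ((2 * x ^ 2 + 1) / n) * (1 + x ^ 2) ≤ 16 / n := by
    calc stdNormalPDF x * ((2 * x ^ 2 + 1) / n) * (1 + x ^ 2)
        ≤ stdNormalPDF x * ((2 * (1 + x ^ 2)) / n) * (1 + x ^ 2) := by gcongr; linarith
      _ = 2 / n * ((1 + x ^ 2) ^ 2 * stdNormalPDF x) := by ring
      _ ≤ 2 / n * 8 := by gcongr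
      _ = _ := by ring
  have : (10240 : ℝ) / n + 16 / n ≤ 10300 / n := by
    rw [← add_div]; gcongr; norm_num
  linarith

/-- The scale at which `binomWeight n (1 / 2)` matches the Gaussian density. -/
noncomputable def scaleHalf (n : ℕ) : ℝ :=
  Real.exp (logRatioHalf n (n / 2)) * (√(2 * Real.pi) * √n / 2)

lemma abs_binomWeight_half_sub_le {n j : ℕ} (hn : 0 < n) (hj : j ≤ n)
    (hg : |(2 * j - n : ℝ)| + 1 ≤ n / 8) :
    |binomWeight n (1 / 2) j - scaleHalf n * normalCell n j|
      ≤ scaleHalf n * (20600 / (n * √n) * (1 + (((j : ℝ) - n / 2) / (√n / 2)) ^ 2)⁻¹) := by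
  have hn' : (1 : ℝ) ≤ n := by exact_mod_cast hn
  have hn0 : (0 : ℝ) < n := by linarith
  have hs : 0 < √(n : ℝ) := by positivity
  have hs1 : 1 ≤ √(n : ℝ) := Real.one_le_sqrt.2 hn'
  have hss : √(n : ℝ) ^ 2 = n := Real.sq_sqrt hn0.le
  have hπ : 0 < √(2 * Real.pi) := by positivity
  set x : ℝ := (2 * j - n) / √n with hx
  have ex : ((j : ℝ) - n / 2) / (√n / 2) = x := by rw [hx]; field_simp
  have hxs : |x| * √n = |(2 * j - n : ℝ)| := by
    rw [hx, abs_div, abs_of_pos hs]; field_simp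
  set Y : ℝ := |x| * √n + 1 with hY
  have hYn : Y ≤ n / 8 := by rw [hY, hxs]; exact hg
  set E := Y * (4 * Y ^ 3 / n ^ 3 + 2 * Y / n ^ 2) with hE
  have hmain := exp_error_mul_stdNormalPDF_le hn hY hYn
  rw [← hE] at hmain
  have hr : |logRatioHalf n j - logRatioHalf n (n / 2)| ≤ E :=
    abs_logRatioHalf_sub_le hj (by rw [hY, hxs]) (by linarith)
  have hφ := stdNormalPDF_nonneg x
  have hc : 0 < scaleHalf n := by unfold scaleHalf; positivity
  have hq : binomWeight n (1 / 2) j = scaleHalf n * (2 / √n * stdNormalPDF x)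
      * Real.exp (logRatioHalf n j - logRatioHalf n (n / 2)) := by
    have hp := binomWeight_pos (n := n) (θ := 1 / 2) (by norm_num) (by norm_num) hj
    have e1 : Real.exp (logRatioHalf n j) = binomWeight n (1 / 2) j * Real.exp (x ^ 2 / 2) := by
      rw [logRatioHalf, Real.exp_add, Real.exp_log hp]
      congr 2
      rw [hx, div_pow, hss]; field_simp
    have e2 : Real.exp (x ^ 2 / 2) * Real.exp (-(x ^ 2 / 2)) = 1 := by
      rw [← Real.exp_add]; simp
    rw [Real.exp_sub, e1, scaleHalf, stdNormalPDF_eq]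
    field_simp
    linear_combination -e2
  have h1 : |binomWeight n (1 / 2) j - scaleHalf n * (2 / √n * stdNormalPDF x)|
      ≤ scaleHalf n * (2 / √n * stdNormalPDF x) * (E * Real.exp E) := by
    rw [hq, ← mul_sub_one, abs_mul, abs_of_nonneg (by positivity)]
    gcongr
    exact abs_exp_sub_one_le_mul_exp hr
  have h2 : |normalCell n j - 2 / √n * stdNormalPDF x|
      ≤ 2 / √n * stdNormalPDF x * ((2 * x ^ 2 + 1) / n) := by
    have := abs_stdNormalCDF_cell_sub_le (x := x) (δ := 1 / √n) (by positivity)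
      (by rw [div_le_one hs]; exact hs1) (by
        rw [mul_one_div, div_le_iff₀ hs]
        have : |x| * √n ≤ n / 8 := by linarith
        nlinarith [abs_nonneg x])
    have e1 : x + 1 / √n = (2 * j + 1 - n) / √n := by rw [hx]; ring
    have e2 : x - 1 / √n = (2 * j - 1 - n) / √n := by rw [hx]; ring
    rw [e1, e2] at this
    have e3 : (1 / √(n : ℝ)) ^ 2 = 1 / n := by rw [div_pow, hss, one_pow]
    rw [e3] at this
    rw [normalCell]
    convert this using 1
    · congr 1; ring
    · ring
  rw [ex]
  have e3 : binomWeight n (1 / 2) j - scaleHalf n * normalCell n j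
      = (binomWeight n (1 / 2) j - scaleHalf n * (2 / √n * stdNormalPDF x))
        - scaleHalf n * (normalCell n j - 2 / √n * stdNormalPDF x) := by ring
  rw [e3]
  refine (abs_sub _ _).trans ?_
  rw [abs_mul, abs_of_pos hc]
  calc _ ≤ scaleHalf n * (2 / √n * stdNormalPDF x) * (E * Real.exp E)
        + scaleHalf n * (2 / √n * stdNormalPDF x * ((2 * x ^ 2 + 1) / n)) := by gcongr
    _ = scaleHalf n * (2 / √n) * (stdNormalPDF x * (E * Real.exp E + (2 * x ^ 2 + 1) / n)) := by
        ring
    _ ≤ scaleHalf n * (2 / √n) * (10300 / n * (1 + x ^ 2)⁻¹) := by gcongr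
    _ = _ := by field_simp; ring

/-- In the bulk each error is `1/(n√n)` times a Cauchy kernel of width `√n/2`, which sums to
`O(1/n)`; outside it Chebyshev bounds the binomial mass and the decay of the density bounds the
cells. -/
lemma exists_sum_abs_binomWeight_half_sub_le : ∃ C : ℝ, 0 ≤ C ∧ ∀ n : ℕ, 0 < n →
    ∑ j ∈ Finset.range (n + 1), |binomWeight n (1 / 2) j - normalCell n j| ≤ C / n := by
  refine ⟨13 * 2200000, by norm_num, fun n hn => ?_⟩
  have hn' : (1 : ℝ) ≤ n := by exact_mod_cast hn
  have hn0 : (0 : ℝ) < n := by linarith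
  have hs : 0 < √(n : ℝ) := by positivity
  have hs1 : 1 ≤ √(n : ℝ) := Real.one_le_sqrt.2 hn'
  have hss : √(n : ℝ) * √n = n := Real.mul_self_sqrt hn0.le
  have hq0 : ∀ j, 0 ≤ binomWeight n (1 / 2) j :=
    binomWeight_nonneg (by norm_num) (by norm_num)
  -- For small `n` the total masses are bounded and the constant dominates.
  rcases lt_or_ge n 32 with h32 | h32
  · have h1 := sum_binomWeight n (1 / 2)
    have h2 := (abs_le.1 (abs_sum_normalCell_sub_one_le hn)).2
    have h3 : (2 : ℝ) / n ≤ 2 := by rw [div_le_iff₀ hn0]; linarith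
    calc ∑ j ∈ Finset.range (n + 1), |binomWeight n (1 / 2) j - normalCell n j|
        ≤ ∑ j ∈ Finset.range (n + 1), (binomWeight n (1 / 2) j + normalCell n j) := by
          apply Finset.sum_le_sum
          intro i hi
          have := hq0 i; have := normalCell_nonneg n i
          rw [abs_le]; constructor <;> linarith
      _ ≤ 4 := by rw [Finset.sum_add_distrib]; linarith
      _ ≤ _ := by
        rw [le_div_iff₀ hn0]
        have : (n : ℝ) ≤ 32 := by exact_mod_cast h32.le
        linarith
  classical
  have := sum_abs_sub_le_of_approx_proportional (Finset.range (n + 1))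
    (fun j : ℕ => |(2 * j - n : ℝ)| + 1 ≤ n / 8)
    (q := binomWeight n (1 / 2)) (g := normalCell n)
    (e := fun j => 20600 / (n * √n) * (1 + (((j : ℝ) - n / 2) / (√n / 2)) ^ 2)⁻¹)
    (c := scaleHalf n) (η := 2200000 / n) (fun i _ => hq0 i) (fun i _ => normalCell_nonneg n i)
    (by unfold scaleHalf; positivity) (sum_binomWeight n _)
    ((abs_sum_normalCell_sub_one_le hn).trans (by gcongr; norm_num))
    (by
      have h32' : (32 : ℝ) ≤ n := by exact_mod_cast h32
      refine (sum_binomWeight_filter_le (t := n / 64) (by norm_num) (by norm_num) (by positivity)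
        (fun j hj => ?_) _).trans ?_
      · push Not at hj
        have e : (2 * j - n : ℝ) = 2 * ((j : ℝ) - n * (1 / 2)) := by ring
        rw [e, abs_mul, abs_two] at hj
        linarith
      · rw [div_pow]
        rw [div_le_div_iff₀ (by positivity) (by positivity)]
        nlinarith)
    (by
      calc ∑ j ∈ (Finset.range (n + 1)).filter (fun j : ℕ => ¬ |(2 * j - n : ℝ)| + 1 ≤ n / 8),
            normalCell n j
          ≤ ∑ j ∈ (Finset.range (n + 1)).filter (fun j : ℕ => ¬ |(2 * j - n : ℝ)| + 1 ≤ n / 8),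
           
            2 / √n * (524288 / n ^ 2) :=
            Finset.sum_le_sum fun j hj =>
              normalCell_le_of_not_good h32 (Finset.mem_filter.1 hj).2
        _ ≤ ∑ j ∈ Finset.range (n + 1), 2 / √n * (524288 / n ^ 2) :=
            Finset.sum_le_sum_of_subset_of_nonneg (Finset.filter_subset _ _)
              fun _ _ _ => by positivity
        _ = (n + 1) * (2 / √n * (524288 / n ^ 2)) := by simp
        _ ≤ (2 * n) * (2 / 1 * (524288 / n ^ 2)) := by gcongr; linarith
        _ ≤ 2200000 / n := by
            have e : (2 * n) * (2 / 1 * (524288 / n ^ 2)) = (2097152 : ℝ) / n := by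
              field_simp; norm_num
            rw [e]; gcongr; norm_num)
    (by
      calc _ ≤ ∑ j ∈ Finset.range (n + 1),
            20600 / (n * √n) * (1 + (((j : ℝ) - n / 2) / (√n / 2)) ^ 2)⁻¹ :=
            Finset.sum_le_sum_of_subset_of_nonneg (Finset.filter_subset _ _)
              fun _ _ _ => by positivity
        _ ≤ 20600 / (n * √n) * (2 + Real.pi * (√n / 2)) := by
            rw [← Finset.mul_sum]
            gcongr
            exact sum_inv_one_add_sq_le _ (by positivity) _
        _ ≤ 20600 / (n * √n) * (4 * √n) := by
            gcongr
            nlinarith [Real.pi_lt_d2]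
        _ ≤ 2200000 / n := by
            have e : 20600 / (n * √n) * (4 * √n) = (82400 : ℝ) / n := by
              field_simp; norm_num
            rw [e]; gcongr; norm_num)
    (fun j hj hg => abs_binomWeight_half_sub_le hn (by
      have := Finset.mem_range.1 hj; omega) hg)
  refine this.trans (le_of_eq ?_)
  ring

/-! ### The sawtooth correction for sums of signs -/

/-- The centred sawtooth function. -/
noncomputable def sawtooth (x : ℝ) : ℝ := Int.fract x - 1 / 2

lemma abs_sawtooth_le (x : ℝ) : |sawtooth x| ≤ 1 / 2 := by
  have h0 := Int.fract_nonneg x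
  have h1 := (Int.fract_lt_one x).le
  unfold sawtooth
  rw [abs_le]; constructor <;> linarith

lemma sawtooth_add_nat (x : ℝ) (k : ℕ) : sawtooth (x + k) = sawtooth x := by
  simp [sawtooth]

/-- Even and odd numbers of signs produce sawtooths half a period apart; this identity merges them
into one of doubled frequency. -/
lemma sawtooth_add_half (x : ℝ) : sawtooth x + sawtooth (x + 1 / 2) = sawtooth (2 * x) := by
  have h0 := Int.floor_le x
  have h1 := Int.lt_floor_add_one x
  unfold sawtooth Int.fract
  rcases lt_or_ge (x - ⌊x⌋) (1 / 2) with h | h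
  · have e1 : ⌊x + 1 / 2⌋ = ⌊x⌋ := by
      rw [Int.floor_eq_iff]; constructor <;> linarith
    have e2 : ⌊2 * x⌋ = 2 * ⌊x⌋ := by
      rw [Int.floor_eq_iff]; push_cast; constructor <;> linarith
    rw [e1, e2]; push_cast; ring
  · have e1 : ⌊x + 1 / 2⌋ = ⌊x⌋ + 1 := by
      rw [Int.floor_eq_iff]; push_cast; constructor <;> linarith
    have e2 : ⌊2 * x⌋ = 2 * ⌊x⌋ + 1 := by
      rw [Int.floor_eq_iff]; push_cast; constructor <;> linarith
    rw [e1, e2]; push_cast; ring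

/-- The distribution function of the standardized sum of `n` independent signs. -/
noncomputable def signSumCDF (n : ℕ) (x : ℝ) : ℝ :=
  ∑ j ∈ Finset.range (n + 1), if (2 * j - n : ℝ) / √n ≤ x then binomWeight n (1 / 2) j else 0

lemma signSumCDF_nonneg (n : ℕ) (x : ℝ) : 0 ≤ signSumCDF n x :=
  Finset.sum_nonneg fun j _ => by
    split_ifs
    · exact binomWeight_nonneg (by norm_num) (by norm_num) j
    · rfl

lemma signSumCDF_le_one (n : ℕ) (x : ℝ) : signSumCDF n x ≤ 1 := by
  rw [← sum_binomWeight n (1 / 2)]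
  refine Finset.sum_le_sum fun j _ => ?_
  split_ifs
  · rfl
  · exact binomWeight_nonneg (by norm_num) (by norm_num) j

/-- The atoms up to `x` are those with `j ≤ J = ⌊(x√n + n)/2⌋`. Their cells telescope to `Φ` at `(2J
+ 1 - n)/√n`, which differs from `x` by exactly `-(2/√n)` times the sawtooth; the second-order
Taylor error is at most `1/n`. The denominator `n + 1` keeps `n = 0` in the statement. -/
lemma exists_abs_signSumCDF_sub_le : ∃ C : ℝ, 0 ≤ C ∧ ∀ (n : ℕ) (x : ℝ), 0 ≤ x →
    |signSumCDF n x - (stdNormalCDF x - 2 / √n * stdNormalPDF x * sawtooth ((x * √n + n) / 2))|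
      ≤ C / (n + 1) := by
  obtain ⟨C, hC0, hC⟩ := exists_sum_abs_binomWeight_half_sub_le
  refine ⟨2 * (C + 2), by positivity, fun n x hx => ?_⟩
  rcases Nat.eq_zero_or_pos n with rfl | hn
  · have h1 := signSumCDF_nonneg 0 x
    have h2 := signSumCDF_le_one 0 x
    have h3 := stdNormalCDF_nonneg x
    have h4 := stdNormalCDF_le_one x
    -- For `n = 0` division by zero removes the correction, and only values in `[0, 1]` are
    -- compared.
    simp only [Nat.cast_zero, Real.sqrt_zero, div_zero, zero_mul, sub_zero, zero_add, div_one]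
    rw [abs_le]; constructor <;> linarith
  have hn' : (1 : ℝ) ≤ n := by exact_mod_cast hn
  have hn0 : (0 : ℝ) < n := by linarith
  have hs : 0 < √(n : ℝ) := by positivity
  have hss : √(n : ℝ) ^ 2 = n := Real.sq_sqrt hn0.le
  set y : ℝ := (x * √n + n) / 2 with hy
  have hy0 : 0 ≤ y := by positivity
  have hcond : ∀ j : ℕ, (2 * j - n : ℝ) / √n ≤ x ↔ j < ⌊y⌋₊ + 1 := by
    intro j
    rw [div_le_iff₀ hs, Nat.lt_add_one_iff, Nat.le_floor_iff hy0, hy]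
    constructor <;> intro h <;> linarith
  set J := ⌊y⌋₊ with hJ
  have hmid : |signSumCDF n x - stdNormalCDF ((2 * J + 1 - n) / √n)| ≤ (C + 1) / n := by
    -- If `n < J`, then `x` lies beyond the last atom: the sum is `1`, and so is `Φ` up to the tail
    -- bound `1/n`.
    rcases lt_or_ge n J with hJn | hJn
    · have e : signSumCDF n x = 1 := by
        rw [← sum_binomWeight n (1 / 2)]
        refine Finset.sum_congr rfl fun j hj => ?_
        rw [if_pos ((hcond j).2 (by have := Finset.mem_range.1 hj; omega))]
      have h1 : (n : ℝ) + 1 ≤ J := by exact_mod_cast hJn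
      have h2 := stdNormalCDF_neg_div_sqrt_le hn (y := 2 * J + 1 - n) (by linarith)
      rw [stdNormalCDF_neg] at h2
      have h3 := stdNormalCDF_le_one ((2 * J + 1 - n) / √n)
      have h4 : 1 / (n : ℝ) ≤ (C + 1) / n := by gcongr; linarith
      rw [e, abs_of_nonneg (by linarith)]
      linarith
    · have e : signSumCDF n x = ∑ j ∈ Finset.range (J + 1), binomWeight n (1 / 2) j := by
        unfold signSumCDF
        rw [← Finset.sum_filter]
        congr 1
        ext j
        simp only [Finset.mem_filter, Finset.mem_range, hcond]
        omega
      have h1 := sum_normalCell n (J + 1)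
      have h2 : |∑ j ∈ Finset.range (J + 1), binomWeight n (1 / 2) j
          - ∑ j ∈ Finset.range (J + 1), normalCell n j| ≤ C / n := by
        rw [← Finset.sum_sub_distrib]
        refine (Finset.abs_sum_le_sum_abs _ _).trans (le_trans ?_ (hC n hn))
        exact Finset.sum_le_sum_of_subset_of_nonneg (Finset.range_mono (by omega))
          fun _ _ _ => abs_nonneg _
      have h3 : stdNormalCDF ((-1 - n) / √n) ≤ 1 / n := by
        have := stdNormalCDF_neg_div_sqrt_le hn (y := n + 1) (by linarith)
        convert this using 2; ring
      have h4 := stdNormalCDF_nonneg ((-1 - n) / √n)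
      have e2 : (2 * ((J + 1 : ℕ) : ℝ) - 1 - n) = 2 * J + 1 - n := by push_cast; ring
      rw [e2] at h1
      rw [e, add_div]
      rw [h1] at h2
      obtain ⟨a1, a2⟩ := abs_le.1 h2
      rw [abs_le]; constructor <;> linarith
  have hd : (2 * J + 1 - n : ℝ) / √n = x + -(2 / √n * sawtooth y) := by
    have : (J : ℝ) = ⌊y⌋ := by rw [hJ]; exact natCast_floor_eq_intCast_floor hy0
    rw [sawtooth, Int.fract, this, hy]
    field_simp
    ring
  have ht := abs_stdNormalCDF_add_sub_le x (-(2 / √n * sawtooth y))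
  rw [← hd] at ht
  have hd2 : (-(2 / √n * sawtooth y)) ^ 2 ≤ 1 / n := by
    have h1 : sawtooth y ^ 2 ≤ (1 / 2) ^ 2 := by
      rw [← sq_abs]; gcongr; exact abs_sawtooth_le y
    rw [neg_sq, mul_pow, div_pow, hss]
    calc (2 : ℝ) ^ 2 / (n : ℝ) * sawtooth y ^ 2 ≤ 2 ^ 2 / (n : ℝ) * (1 / 2) ^ 2 := by gcongr
      _ = 1 / (n : ℝ) := by ring
  have h5 : (C + 2) / n ≤ 2 * (C + 2) / (n + 1) := by
    rw [div_le_div_iff₀ hn0 (by linarith)]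
    nlinarith
  have e3 : (C + 2) / n = (C + 1) / n + 1 / n := by ring
  obtain ⟨a1, a2⟩ := abs_le.1 hmid
  obtain ⟨b1, b2⟩ := abs_le.1 (ht.trans hd2)
  rw [abs_le]; constructor <;> linarith

/-! ### The number of nonzero summands -/

/-- The Gaussian approximation to the binomial weights with parameters `N` and `2 / 3`. -/
noncomputable def gaussWeight (N : ℕ) (x : ℝ) : ℝ :=
  3 / (2 * √(Real.pi * N)) * Real.exp (-(9 / (4 * (N : ℝ))) * (x - 2 * N / 3) ^ 2)

lemma gaussWeight_nonneg (N : ℕ) (x : ℝ) : 0 ≤ gaussWeight N x := by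
  unfold gaussWeight; positivity

lemma gaussWeight_coeff_le (N : ℕ) : 3 / (2 * √(Real.pi * N)) ≤ 1 / √N := by
  have h : (3 : ℝ) / 2 ≤ √Real.pi := by
    apply Real.le_sqrt_of_sq_le; nlinarith [Real.pi_gt_three]
  have hp : 0 < √Real.pi := by linarith
  rw [Real.sqrt_mul Real.pi_pos.le]
  calc 3 / (2 * (√Real.pi * √N)) = (3 / 2) / √Real.pi * (1 / √N) := by
        rw [div_mul_div_comm, mul_one, div_div]
    _ ≤ 1 * (1 / √N) := by
        gcongr; rw [div_le_one hp]; exact h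
    _ = _ := one_mul _

lemma gaussWeight_le (N : ℕ) (x : ℝ) : gaussWeight N x ≤ 1 / √N := by
  have h1 : Real.exp (-(9 / (4 * (N : ℝ))) * (x - 2 * N / 3) ^ 2) ≤ 1 := by
    rw [Real.exp_le_one_iff, neg_mul, neg_nonpos]; positivity
  calc gaussWeight N x ≤ 3 / (2 * √(Real.pi * N)) * 1 := by unfold gaussWeight; gcongr
    _ ≤ _ := by rw [mul_one]; exact gaussWeight_coeff_le N

lemma gaussWeight_monotoneOn (N : ℕ) : MonotoneOn (gaussWeight N) (Set.Iic (2 * N / 3)) := by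
  intro x hx y hy hxy
  have hy' : y ≤ 2 * N / 3 := hy
  unfold gaussWeight
  rw [neg_mul, neg_mul]
  gcongr 3 / (2 * √(Real.pi * N)) * Real.exp (-(9 / (4 * (N : ℝ)) * ?_))
  nlinarith

lemma gaussWeight_antitoneOn (N : ℕ) : AntitoneOn (gaussWeight N) (Set.Ici (2 * N / 3)) := by
  intro x hx y hy hxy
  have hx' : 2 * N / 3 ≤ x := hx
  unfold gaussWeight
  rw [neg_mul, neg_mul]
  gcongr 3 / (2 * √(Real.pi * N)) * Real.exp (-(9 / (4 * (N : ℝ)) * ?_))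
  nlinarith

lemma sum_abs_gaussWeight_sub_le (N R : ℕ) :
    ∑ n ∈ Finset.range R, |gaussWeight N ((n : ℝ) + 1) - gaussWeight N n| ≤ 2 / √N := by
  refine (sum_abs_sub_le_of_unimodal (gaussWeight_monotoneOn N) (gaussWeight_antitoneOn N)
    (gaussWeight_nonneg N) R).trans ?_
  have := gaussWeight_le N (2 * N / 3)
  have e : (2 : ℝ) / √N = 2 * (1 / √N) := by ring
  rw [e]; gcongr

lemma integral_gaussWeight {N : ℕ} (hN : 0 < N) (R : ℝ) :
    ∫ x in (0 : ℝ)..R, gaussWeight N x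
      = stdNormalCDF ((R - 2 * N / 3) / (√(2 * N) / 3))
        - stdNormalCDF (-(2 * N / 3 / (√(2 * N) / 3))) := by
  have hN' : (0 : ℝ) < N := by exact_mod_cast hN
  have hs : 0 < √(2 * (N : ℝ)) / 3 := by positivity
  have e : ∀ x, gaussWeight N x
      = (√(2 * (N : ℝ)) / 3)⁻¹ * stdNormalPDF (x / (√(2 * N) / 3) - 2 * N / 3 / (√(2 * N) / 3)) := by
    intro x
    have e1 : (x / (√(2 * N) / 3) - 2 * N / 3 / (√(2 * N) / 3)) ^ 2
        = 2 * (9 / (4 * (N : ℝ)) * (x - 2 * N / 3) ^ 2) := by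
      rw [← sub_div, div_pow, div_pow, Real.sq_sqrt (by positivity)]; field_simp; ring
    have e2 : √(2 * (N : ℝ)) * √(2 * Real.pi) = 2 * √(Real.pi * N) := by
      rw [← Real.sqrt_mul (by positivity)]
      have : 2 * (N : ℝ) * (2 * Real.pi) = 2 ^ 2 * (Real.pi * N) := by ring
      rw [this, Real.sqrt_mul (by positivity), Real.sqrt_sq (by norm_num)]
    rw [stdNormalPDF_eq, neg_div, e1, gaussWeight, ← e2]
    have e3 : -(2 * (9 / (4 * (N : ℝ)) * (x - 2 * N / 3) ^ 2) / 2)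
        = -(9 / (4 * (N : ℝ))) * (x - 2 * N / 3) ^ 2 := by ring
    rw [e3, ← mul_assoc]
    congr 1
    field_simp
  simp_rw [e]
  rw [intervalIntegral.integral_const_mul,
    intervalIntegral.integral_comp_div_sub (f := stdNormalPDF) hs.ne', stdNormalCDF_sub,
    smul_eq_mul, ← mul_assoc, inv_mul_cancel₀ hs.ne', one_mul, sub_div, zero_div, zero_sub]

/-- Sum and integral differ by at most twice the maximum of the weight, and the missing tails are
`O(1/N)`. The range stops at `2(N + 1)` because it is later cut into the pairs `2m, 2m + 1` with `m
≤ N`. -/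
lemma abs_sum_gaussWeight_sub_one_le {N : ℕ} (hN : 0 < N) :
    |∑ n ∈ Finset.range (2 * (N + 1)), gaussWeight N n - 1| ≤ 3 / √N := by
  have hN' : (1 : ℝ) ≤ N := by exact_mod_cast hN
  have hN0 : (0 : ℝ) < N := by linarith
  have hs : 0 < √(2 * (N : ℝ)) / 3 := by positivity
  have hsN : 0 < √(N : ℝ) := by positivity
  have h1 := abs_sum_sub_integral_le_of_unimodal (gaussWeight_monotoneOn N)
    (gaussWeight_antitoneOn N) (gaussWeight_nonneg N) (2 * (N + 1))
  rw [integral_gaussWeight hN] at h1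
  have h2 := gaussWeight_le N (2 * N / 3)
  have ht : stdNormalCDF (-(2 * N / 3 / (√(2 * N) / 3))) ≤ 1 / (2 * N) := by
    refine (stdNormalCDF_neg_le (by positivity)).trans (le_of_eq ?_)
    rw [div_pow, div_pow, div_pow, Real.sq_sqrt (by positivity)]; field_simp
  have ht0 := stdNormalCDF_nonneg (-(2 * N / 3 / (√(2 * N) / 3)))
  have hu : 1 - 1 / (2 * N) ≤ stdNormalCDF (((2 * (N + 1) : ℕ) - 2 * N / 3) / (√(2 * N) / 3)) := by
    have : stdNormalCDF (2 * N / 3 / (√(2 * N) / 3))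
        ≤ stdNormalCDF (((2 * (N + 1) : ℕ) - 2 * N / 3) / (√(2 * N) / 3)) := by
      apply stdNormalCDF_mono
      gcongr ?_ / _
      push_cast; linarith
    rw [stdNormalCDF_neg] at ht
    linarith
  have hu1 := stdNormalCDF_le_one (((2 * (N + 1) : ℕ) - 2 * N / 3) / (√(2 * N) / 3))
  have h4 : 1 / (N : ℝ) ≤ 1 / √N := by
    apply one_div_le_one_div_of_le hsN
    rw [Real.sqrt_le_left hN0.le]; nlinarith
  have e1 : (3 : ℝ) / √N = 2 * (1 / √N) + 1 / √N := by ring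
  have e2 : (1 : ℝ) / N = 1 / (2 * N) + 1 / (2 * N) := by field_simp; norm_num
  obtain ⟨a1, a2⟩ := abs_le.1 h1
  rw [abs_le]; constructor <;> linarith

/-- Logarithm of the binomial weight, with its Gaussian part removed. -/
noncomputable def logRatioTwoThirds (N j : ℕ) : ℝ :=
  Real.log (binomWeight N (2 / 3) j) + 9 / (4 * (N : ℝ)) * ((j : ℝ) - 2 * N / 3) ^ 2

/-- The parameter `2/3` is skew, so the quadratic terms of the two logarithms do not cancel as they
do for `1/2`. The resulting `ℓ¹` precision is only `N^{-1/2}`, which suffices because these weights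
multiply a term of that order. -/
lemma abs_logRatioTwoThirds_succ_sub_le {N i : ℕ} (hi : i < N) {Y : ℝ}
    (hY : |(i : ℝ) - 2 * N / 3| + 1 ≤ Y) (hYN : Y ≤ N / 24) :
    |logRatioTwoThirds N (i + 1) - logRatioTwoThirds N i| ≤ 1 / N + 23 * Y ^ 2 / N ^ 2 := by
  have hN : (0 : ℝ) < N := by exact_mod_cast (Nat.zero_le i).trans_lt hi
  have hiN : (i : ℝ) < N := by exact_mod_cast hi
  have hi0 : (0 : ℝ) ≤ i := by positivity
  set t : ℝ := i - 2 * N / 3 with ht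
  have hq := binomWeight_pos (n := N) (θ := 2 / 3) (by norm_num) (by norm_num) hi.le
  have hrec := binomWeight_succ_mul (n := N) (θ := 2 / 3) hi
  set a : ℝ := -(3 * t / N) with ha
  set b : ℝ := 3 * (t + 1) / (2 * N) with hb
  have hratio : binomWeight N (2 / 3) (i + 1)
      = binomWeight N (2 / 3) i * ((1 + a) / (1 + b)) := by
    have e1 : 1 + a = 3 * (N - i) / N := by rw [ha, ht]; field_simp; ring
    have e2 : 1 + b = 3 * (i + 1) / (2 * N) := by rw [hb, ht]; field_simp; ring
    rw [e1, e2]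
    field_simp
    norm_num at hrec
    linarith
  obtain ⟨t1, t2⟩ := abs_le.1 (le_sub_iff_add_le.2 hY)
  have hY0 : 0 ≤ Y := by linarith [abs_nonneg t]
  have ha2 : |a| ≤ 3 * Y / N := by
    rw [ha, abs_neg, abs_div, abs_mul, abs_of_pos hN, abs_of_pos (by norm_num : (0 : ℝ) < 3)]
    gcongr; linarith
  have hb2 : |b| ≤ 3 * Y / (2 * N) := by
    rw [hb, abs_div, abs_mul, abs_of_pos (by positivity : (0 : ℝ) < 2 * N),
      abs_of_pos (by norm_num : (0 : ℝ) < 3)]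
    gcongr
    rw [abs_le]; constructor <;> linarith
  have hah : |a| ≤ 1 / 2 := ha2.trans (by rw [div_le_iff₀ hN]; linarith)
  have hbh : |b| ≤ 1 / 2 := hb2.trans (by rw [div_le_iff₀ (by positivity)]; linarith)
  obtain ⟨a1, a2⟩ := abs_le.1 hah
  obtain ⟨b1, b2⟩ := abs_le.1 hbh
  have e : logRatioTwoThirds N (i + 1) - logRatioTwoThirds N i
      = (Real.log (1 + a) - a) - (Real.log (1 + b) - b) + 3 / (4 * N) := by
    unfold logRatioTwoThirds
    have p1 : 0 < 1 + a := by linarith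
    have p2 : 0 < 1 + b := by linarith
    rw [hratio, Real.log_mul hq.ne' (by positivity), Real.log_div p1.ne' p2.ne']
    have : 9 / (4 * (N : ℝ)) * (((i + 1 : ℕ) : ℝ) - 2 * N / 3) ^ 2
        = 9 / (4 * (N : ℝ)) * (i - 2 * N / 3) ^ 2 - a + b + 3 / (4 * N) := by
      rw [ha, hb, ht]; push_cast; field_simp; ring
    rw [this]; ring
  have l1 : |Real.log (1 + a) - a| ≤ 18 * Y ^ 2 / N ^ 2 := by
    refine (abs_log_one_add_sub_le hah).trans ?_
    have : |a| ^ 2 ≤ (3 * Y / N) ^ 2 := by gcongr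
    rw [sq_abs] at this
    calc 2 * a ^ 2 ≤ 2 * (3 * Y / N) ^ 2 := by linarith
      _ = _ := by rw [div_pow]; ring
  have l2 : |Real.log (1 + b) - b| ≤ 5 * Y ^ 2 / N ^ 2 := by
    refine (abs_log_one_add_sub_le hbh).trans ?_
    have : |b| ^ 2 ≤ (3 * Y / (2 * N)) ^ 2 := by gcongr
    rw [sq_abs] at this
    calc 2 * b ^ 2 ≤ 2 * (3 * Y / (2 * N)) ^ 2 := by linarith
      _ = (9 / 2) * (Y ^ 2 / N ^ 2) := by field_simp; ring
      _ ≤ 5 * (Y ^ 2 / N ^ 2) := by gcongr; norm_num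
      _ = _ := by ring
  have l3 : 3 / (4 * (N : ℝ)) ≤ 1 / N := by
    rw [div_le_div_iff₀ (by positivity) hN]; linarith
  have l4 : 0 < 3 / (4 * (N : ℝ)) := by positivity
  have e5 : 23 * Y ^ 2 / (N : ℝ) ^ 2 = 18 * Y ^ 2 / N ^ 2 + 5 * Y ^ 2 / N ^ 2 := by ring
  obtain ⟨c1, c2⟩ := abs_le.1 l1
  obtain ⟨d1, d2⟩ := abs_le.1 l2
  rw [e, e5, abs_le]; constructor <;> linarith

lemma abs_logRatioTwoThirds_sub_le {N j : ℕ} (hj : j ≤ N) {Y : ℝ}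
    (hY : |(j : ℝ) - 2 * N / 3| + 2 ≤ Y) (hYN : Y ≤ N / 24) :
    |logRatioTwoThirds N j - logRatioTwoThirds N (2 * N / 3)|
      ≤ Y * (1 / N + 23 * Y ^ 2 / N ^ 2) := by
  have hY0 : 0 ≤ Y := by linarith [abs_nonneg ((j : ℝ) - 2 * N / 3)]
  have c1 : (3 * (2 * N / 3 : ℕ) : ℝ) ≤ 2 * N := by
    exact_mod_cast Nat.mul_div_le (2 * N) 3
  have c2 : (2 * N : ℝ) ≤ 3 * (2 * N / 3 : ℕ) + 2 := by
    have : 2 * N ≤ 3 * (2 * N / 3) + 2 := by omega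
    exact_mod_cast this
  obtain ⟨a1, a2⟩ := abs_le.1 (le_sub_iff_add_le.2 hY)
  rcases le_total (2 * N / 3) j with h | h
  · refine (abs_sub_le_of_abs_succ_sub_le h (A := 1 / N + 23 * Y ^ 2 / N ^ 2) ?_).trans ?_
    · intro i hi1 hi2
      apply abs_logRatioTwoThirds_succ_sub_le (by omega) _ hYN
      have b1 : ((2 * N / 3 : ℕ) : ℝ) ≤ i := by exact_mod_cast hi1
      have b2 : (i : ℝ) + 1 ≤ j := by exact_mod_cast hi2
      rw [← le_sub_iff_add_le, abs_le]; constructor <;> linarith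
    · gcongr; linarith
  · rw [abs_sub_comm]
    refine (abs_sub_le_of_abs_succ_sub_le h (A := 1 / N + 23 * Y ^ 2 / N ^ 2) ?_).trans ?_
    · intro i hi1 hi2
      apply abs_logRatioTwoThirds_succ_sub_le (by omega) _ hYN
      have b1 : (j : ℝ) ≤ i := by exact_mod_cast hi1
      have b2 : (i : ℝ) + 1 ≤ (2 * N / 3 : ℕ) := by exact_mod_cast hi2
      rw [← le_sub_iff_add_le, abs_le]; constructor <;> linarith
    · gcongr; linarith

lemma gaussWeight_eq_of_pos {N : ℕ} (hN : 0 < N) (j : ℝ) :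
    gaussWeight N j = 3 / (2 * √(Real.pi * N))
      * Real.exp (-(9 / 4 * ((j - 2 * N / 3) / √N) ^ 2)) := by
  have hN0 : (0 : ℝ) < N := by exact_mod_cast hN
  rw [gaussWeight, div_pow, Real.sq_sqrt hN0.le]
  congr 2
  field_simp

lemma gaussWeight_le_of_far {N : ℕ} (hN : 0 < N) {j : ℝ} (hj : N / 96 ≤ |j - 2 * N / 3|) :
    gaussWeight N j ≤ 1 / √N * (84934656 / N ^ 2) := by
  have hN0 : (0 : ℝ) < N := by exact_mod_cast hN
  have hs : 0 < √(N : ℝ) := by positivity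
  rw [gaussWeight_eq_of_pos hN]
  set x := (j - 2 * N / 3) / √N with hx
  have hx2 : N / 9216 ≤ 1 + x ^ 2 := by
    have : (N / 96 : ℝ) ^ 2 ≤ |j - 2 * N / 3| ^ 2 := by gcongr
    rw [sq_abs] at this
    have e : x ^ 2 = (j - 2 * N / 3) ^ 2 / N := by rw [hx, div_pow, Real.sq_sqrt hN0.le]
    have : (N / 9216 : ℝ) ≤ x ^ 2 := by
      rw [e, le_div_iff₀ hN0]; nlinarith
    linarith
  have h := one_add_sq_pow_mul_exp_le (a := 2) (k := 2) (by norm_num) (by norm_num) x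
  norm_num at h
  have h1 : Real.exp (-(9 / 4 * x ^ 2)) ≤ Real.exp (-(2 * x ^ 2)) :=
    Real.exp_le_exp.2 (by nlinarith [sq_nonneg x])
  have h2 : Real.exp (-(9 / 4 * x ^ 2)) ≤ 84934656 / N ^ 2 := by
    rw [le_div_iff₀ (by positivity)]
    have h3 : (N / 9216 : ℝ) ^ 2 * Real.exp (-(9 / 4 * x ^ 2)) ≤ 1 := by
      refine le_trans ?_ h
      gcongr
    linarith
  have := gaussWeight_coeff_le N
  gcongr

/-- Same mechanism as in `exp_error_mul_stdNormalPDF_le`. With `u = Y/√N` the error is `E = (u +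
23u³)/√N`; together with the height `1/√N` of the weight this gives `1/N` times a Cauchy kernel of
width `√N`. -/
lemma exp_error_mul_gaussWeight_le {N : ℕ} (hN : 0 < N) {j Y : ℝ}
    (hY : Y = |j - 2 * N / 3| + 2) (hYN : Y ≤ N / 48) :
    gaussWeight N j * (Y * (1 / N + 23 * Y ^ 2 / N ^ 2)
      * Real.exp (Y * (1 / N + 23 * Y ^ 2 / N ^ 2)))
      ≤ 1309000 / N * (1 + ((j - 2 * N / 3) / √N) ^ 2)⁻¹ := by
  have hN1 : (1 : ℝ) ≤ N := by exact_mod_cast hN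
  have hN0 : (0 : ℝ) < N := by linarith
  have hs : 0 < √(N : ℝ) := by positivity
  have hs1 : 1 ≤ √(N : ℝ) := Real.one_le_sqrt.2 hN1
  have hss : √(N : ℝ) ^ 2 = N := Real.sq_sqrt hN0.le
  set x := (j - 2 * N / 3) / √N with hx
  have hxs : |j - 2 * N / 3| = |x| * √N := by
    rw [hx, abs_div, abs_of_pos hs]; field_simp
  have hY0 : 0 ≤ Y := by rw [hY]; positivity
  set u := Y / √N with hu
  have hu0 : 0 ≤ u := by positivity
  have eY : Y = u * √N := by rw [hu]; field_simp
  have hux : u ≤ |x| + 2 := by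
    rw [hu, div_le_iff₀ hs, hY, hxs]; nlinarith
  have hu2 : u ^ 2 ≤ 2 * x ^ 2 + 8 := by
    have : u ^ 2 ≤ (|x| + 2) ^ 2 := by gcongr
    rw [← sq_abs x]
    nlinarith [sq_nonneg (|x| - 2)]
  set E := Y * (1 / N + 23 * Y ^ 2 / N ^ 2) with hE
  have eE : E = 1 / √N * (u + 23 * (u * u ^ 2)) := by
    have key : ∀ s : ℝ, 0 < s → u * s * (1 / s ^ 2 + 23 * (u * s) ^ 2 / (s ^ 2) ^ 2)
        = 1 / s * (u + 23 * (u * u ^ 2)) := by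
      intro s hs; field_simp
    have h := key _ hs
    rw [hss, ← eY] at h
    exact h
  have hE1 : E ≤ 1 / √N * (1700 * (1 + x ^ 2) ^ 2) := by
    rw [eE]
    gcongr
    have h1 : u ≤ 9 * (1 + x ^ 2) := by nlinarith [sq_nonneg (u - 1)]
    have h2 : u * u ^ 2 ≤ 9 * (1 + x ^ 2) * (8 * (1 + x ^ 2)) := by
      gcongr; nlinarith [sq_nonneg x]
    nlinarith [sq_nonneg x, sq_nonneg (x ^ 2)]
  have hYd : Y / N ≤ 1 / 48 := by rw [div_le_iff₀ hN0]; linarith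
  have hYd0 : 0 ≤ Y / N := by positivity
  have hE2 : E ≤ 4 + x ^ 2 := by
    have e2 : E = Y / N + 23 * (Y / N) * u ^ 2 := by
      rw [hE, hu, div_pow, hss]; field_simp
    have h2 : 23 * (Y / N) * u ^ 2 ≤ 23 * (1 / 48) * (2 * x ^ 2 + 8) := by gcongr
    rw [e2]
    linarith [sq_nonneg x]
  have hE0 : 0 ≤ E := by rw [hE]; positivity
  have hexp : Real.exp (-(9 / 4 * x ^ 2)) * Real.exp E ≤ 55 * Real.exp (-(5 / 4 * x ^ 2)) := by
    calc Real.exp (-(9 / 4 * x ^ 2)) * Real.exp E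
        ≤ Real.exp (-(9 / 4 * x ^ 2)) * Real.exp (4 + x ^ 2) := by gcongr
      _ = Real.exp 1 ^ 4 * Real.exp (-(5 / 4 * x ^ 2)) := by
          rw [← Real.exp_nat_mul, ← Real.exp_add, ← Real.exp_add]; congr 1; push_cast; ring
      _ ≤ _ := by
          gcongr
          calc Real.exp 1 ^ 4 ≤ 2.72 ^ 4 := by gcongr; linarith [Real.exp_one_lt_d9]
            _ ≤ 55 := by norm_num
  have h3 := one_add_sq_pow_mul_exp_le (a := 5 / 4) (k := 3) (by norm_num) (by norm_num) x
  have h3' : (1 + x ^ 2) ^ 3 * Real.exp (-(5 / 4 * x ^ 2)) ≤ 14 := by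
    refine h3.trans (by norm_num)
  have hx0 : (0 : ℝ) < 1 + x ^ 2 := by positivity
  rw [gaussWeight_eq_of_pos hN, ← hx, ← div_eq_mul_inv, le_div_iff₀ hx0]
  have hc := gaussWeight_coeff_le N
  calc 3 / (2 * √(Real.pi * N)) * Real.exp (-(9 / 4 * x ^ 2)) * (E * Real.exp E) * (1 + x ^ 2)
      = 3 / (2 * √(Real.pi * N)) * (Real.exp (-(9 / 4 * x ^ 2)) * Real.exp E)
        * (E * (1 + x ^ 2)) := by ring
    _ ≤ 1 / √N * (55 * Real.exp (-(5 / 4 * x ^ 2)))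
        * (1 / √N * (1700 * (1 + x ^ 2) ^ 2) * (1 + x ^ 2)) := by gcongr
    _ = 93500 / √N ^ 2 * ((1 + x ^ 2) ^ 3 * Real.exp (-(5 / 4 * x ^ 2))) := by
        field_simp; ring
    _ ≤ 93500 / √N ^ 2 * 14 := by gcongr
    _ = 1309000 / N := by rw [hss]; ring

/-- The scale at which `binomWeight N (2 / 3)` matches `gaussWeight N`. -/
noncomputable def scaleTwoThirds (N : ℕ) : ℝ :=
  Real.exp (logRatioTwoThirds N (2 * N / 3)) * (2 * √(Real.pi * N) / 3)

lemma abs_binomWeight_two_thirds_sub_le {N j : ℕ} (hN : 0 < N)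
    (hg : |(j : ℝ) - 2 * N / 3| + 2 ≤ N / 48) :
    |binomWeight N (2 / 3) j - scaleTwoThirds N * gaussWeight N j|
      ≤ scaleTwoThirds N * (1309000 / N * (1 + (((j : ℝ) - 2 * N / 3) / √N) ^ 2)⁻¹) := by
  have hN0 : (0 : ℝ) < N := by exact_mod_cast hN
  have hj : j ≤ N := by
    have := le_abs_self ((j : ℝ) - 2 * N / 3)
    have : (j : ℝ) ≤ N := by linarith
    exact_mod_cast this
  have hπ : 0 < √(Real.pi * (N : ℝ)) := by have := Real.pi_pos; positivity
  set Y : ℝ := |(j : ℝ) - 2 * N / 3| + 2 with hY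
  have hmain := exp_error_mul_gaussWeight_le hN hY hg
  have hr := abs_logRatioTwoThirds_sub_le hj hY.ge (by linarith)
  set E := Y * (1 / N + 23 * Y ^ 2 / N ^ 2) with hE
  have hc : 0 < scaleTwoThirds N := by unfold scaleTwoThirds; positivity
  have hgw := gaussWeight_nonneg N j
  have hq : binomWeight N (2 / 3) j = scaleTwoThirds N * gaussWeight N j
      * Real.exp (logRatioTwoThirds N j - logRatioTwoThirds N (2 * N / 3)) := by
    have hp := binomWeight_pos (n := N) (θ := 2 / 3) (by norm_num) (by norm_num) hj
    have e1 : Real.exp (logRatioTwoThirds N j) = binomWeight N (2 / 3) j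
        * Real.exp (9 / (4 * (N : ℝ)) * ((j : ℝ) - 2 * N / 3) ^ 2) := by
      rw [logRatioTwoThirds, Real.exp_add, Real.exp_log hp]
    have e2 : Real.exp (9 / (4 * (N : ℝ)) * ((j : ℝ) - 2 * N / 3) ^ 2)
        * Real.exp (-(9 / (4 * (N : ℝ))) * ((j : ℝ) - 2 * N / 3) ^ 2) = 1 := by
      rw [← Real.exp_add]; simp
    rw [Real.exp_sub, e1, scaleTwoThirds, gaussWeight]
    generalize Real.exp (9 / (4 * (N : ℝ)) * ((j : ℝ) - 2 * N / 3) ^ 2) = A at *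
    generalize Real.exp (-(9 / (4 * (N : ℝ))) * ((j : ℝ) - 2 * N / 3) ^ 2) = B at *
    field_simp
    linear_combination -e2
  rw [hq, ← mul_sub_one, abs_mul, abs_of_nonneg (by positivity), mul_assoc]
  refine mul_le_mul_of_nonneg_left (le_trans ?_ hmain) hc.le
  gcongr
  exact abs_exp_sub_one_le_mul_exp hr

lemma exists_sum_abs_binomWeight_two_thirds_sub_le : ∃ C : ℝ, 0 ≤ C ∧ ∀ N : ℕ, 0 < N →
    ∑ j ∈ Finset.range (2 * (N + 1)), |binomWeight N (2 / 3) j - gaussWeight N j|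
      ≤ C / √N := by
  refine ⟨13 * 400000000, by norm_num, fun N hN => ?_⟩
  have hN' : (1 : ℝ) ≤ N := by exact_mod_cast hN
  have hN0 : (0 : ℝ) < N := by linarith
  have hs : 0 < √(N : ℝ) := by positivity
  have hs1 : 1 ≤ √(N : ℝ) := Real.one_le_sqrt.2 hN'
  have hsN : √(N : ℝ) ≤ N := by rw [Real.sqrt_le_left hN0.le]; nlinarith
  have hss : √(N : ℝ) * √N = N := Real.mul_self_sqrt hN0.le
  have hq0 : ∀ j, 0 ≤ binomWeight N (2 / 3) j :=
    binomWeight_nonneg (by norm_num) (by norm_num)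
  have hq1 : ∑ j ∈ Finset.range (2 * (N + 1)), binomWeight N (2 / 3) j = 1 := by
    have := sum_binomWeight_eq_sum_range (n := N) (θ := 2 / 3) (R := 2 * (N + 1)) (by omega)
      (fun _ => 1)
    simpa [sum_binomWeight] using this
  have hg1 := abs_sum_gaussWeight_sub_one_le hN
  -- From `N ≥ 192` on, `N/48 - 2 ≥ N/96`, so indices outside the bulk are at distance at least
  -- `N/96` from the mean.
  rcases lt_or_ge N 192 with h32 | h32
  · have h2 := (abs_le.1 hg1).2
    have h3 : (3 : ℝ) / √N ≤ 3 := by rw [div_le_iff₀ hs]; linarith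
    calc ∑ j ∈ Finset.range (2 * (N + 1)), |binomWeight N (2 / 3) j - gaussWeight N j|
        ≤ ∑ j ∈ Finset.range (2 * (N + 1)), (binomWeight N (2 / 3) j + gaussWeight N j) := by
          apply Finset.sum_le_sum
          intro i hi
          have := hq0 i; have := gaussWeight_nonneg N i
          rw [abs_le]; constructor <;> linarith
      _ ≤ 5 := by rw [Finset.sum_add_distrib]; linarith
      _ ≤ _ := by
        rw [le_div_iff₀ hs]
        have : (N : ℝ) ≤ 192 := by exact_mod_cast h32.le
        linarith
  have h32' : (192 : ℝ) ≤ N := by exact_mod_cast h32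
  classical
  have := sum_abs_sub_le_of_approx_proportional (Finset.range (2 * (N + 1)))
    (fun j : ℕ => |(j : ℝ) - 2 * N / 3| + 2 ≤ N / 48)
    (q := binomWeight N (2 / 3)) (g := fun j => gaussWeight N j)
    (e := fun j => 1309000 / N * (1 + (((j : ℝ) - 2 * N / 3) / √N) ^ 2)⁻¹)
    (c := scaleTwoThirds N) (η := 400000000 / √N) (fun i _ => hq0 i)
    (fun i _ => gaussWeight_nonneg N i) (by unfold scaleTwoThirds; positivity) hq1
    (hg1.trans (by gcongr; norm_num))
    (by
      refine (sum_binomWeight_filter_le (t := N / 96) (by norm_num) (by norm_num) (by positivity)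
        (fun j hj => ?_) _).trans ?_
      · push Not at hj
        have e : (N * (2 / 3) : ℝ) = 2 * N / 3 := by ring
        rw [e]
        linarith
      · have e : (N : ℝ) * (2 / 3) * (1 - 2 / 3) / (N / 96) ^ 2 = 2048 / N := by
          field_simp; norm_num
        rw [e]
        apply div_le_div₀ (by norm_num) (by norm_num) hs hsN)
    (by
      calc ∑ j ∈ (Finset.range (2 * (N + 1))).filter
              (fun j : ℕ => ¬ |(j : ℝ) - 2 * N / 3| + 2 ≤ N / 48), gaussWeight N j
          ≤ ∑ j ∈ (Finset.range (2 * (N + 1))).filter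
              (fun j : ℕ => ¬ |(j : ℝ) - 2 * N / 3| + 2 ≤ N / 48),
            1 / √N * (84934656 / N ^ 2) :=
            Finset.sum_le_sum fun j hj =>
              gaussWeight_le_of_far hN (by
                have := (Finset.mem_filter.1 hj).2
                push Not at this
                linarith)
        _ ≤ ∑ j ∈ Finset.range (2 * (N + 1)), 1 / √N * (84934656 / N ^ 2) :=
            Finset.sum_le_sum_of_subset_of_nonneg (Finset.filter_subset _ _)
              fun _ _ _ => by positivity
        _ = (2 * (N + 1)) * (1 / √N * (84934656 / N ^ 2)) := by simp
        _ ≤ (2 * (N + N)) * (1 / √N * (84934656 / (1 * N))) := by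
            gcongr
            nlinarith
        _ = 339738624 / √N := by field_simp; norm_num
        _ ≤ 400000000 / √N := by gcongr; norm_num)
    (by
      calc _ ≤ ∑ j ∈ Finset.range (2 * (N + 1)),
            (1309000 : ℝ) / N * (1 + (((j : ℝ) - 2 * N / 3) / √N) ^ 2)⁻¹ :=
            Finset.sum_le_sum_of_subset_of_nonneg (Finset.filter_subset _ _)
              fun _ _ _ => by positivity
        _ ≤ 1309000 / N * (2 + Real.pi * √N) := by
            rw [← Finset.mul_sum]
            gcongr
            exact sum_inv_one_add_sq_le _ (by positivity) _
        _ ≤ 1309000 / N * (6 * √N) := by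
            gcongr
            nlinarith [Real.pi_lt_d2]
        _ = 7854000 / √N := by
            rw [div_mul_eq_mul_div, div_eq_div_iff hN0.ne' hs.ne']
            linear_combination 7854000 * hss
        _ ≤ 400000000 / √N := by gcongr; norm_num)
    (fun j _ hg => abs_binomWeight_two_thirds_sub_le hN hg)
  refine this.trans (le_of_eq ?_)
  ring

/-! ### The joint law of the sum and the sum of squares -/

/-- Pascal's rule tested against `H`. It drives the induction in both binomial sums of the joint
law. -/
lemma sum_choose_succ_mul_eq (N : ℕ) (H : ℕ → ℝ) :
    ∑ n ∈ Finset.range (N + 2), ((N + 1).choose n : ℝ) * H n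
      = ∑ n ∈ Finset.range (N + 1), (N.choose n : ℝ) * (H n + H (n + 1)) := by
  rw [Finset.sum_choose_succ_mul (fun i _ => H i) N, ← Finset.sum_add_distrib]
  exact Finset.sum_congr rfl fun n _ => by ring

namespace IsIIDUniformTernary

variable {Ω : Type*} [MeasurableSpace Ω] {μ : Measure Ω} {X : ℕ → Ω → ℝ}

lemma neg (hX : IsIIDUniformTernary μ X) : IsIIDUniformTernary μ (fun i ω => -X i ω) where
  measurable i := (hX.measurable i).neg
  indep := hX.indep.comp (fun _ x => -x) fun _ => measurable_neg
  prob_neg_one i := by simpa using hX.prob_one i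
  prob_zero i := by simpa using hX.prob_zero i
  prob_one i := by simpa [neg_eq_iff_eq_neg] using hX.prob_neg_one i

lemma measurable_selfNormSum (hX : IsIIDUniformTernary μ X) (N : ℕ) :
    Measurable (selfNormSum X N) := by
  have := hX.measurable
  unfold selfNormSum
  fun_prop

variable [IsProbabilityMeasure μ]

/-- The three prescribed probabilities add up to `1`, so all other values of `X N` form a null
event. -/
lemma measureReal_eq_sum_inter (hX : IsIIDUniformTernary μ X) (N : ℕ) (B : Set Ω) :
    μ.real B = μ.real (B ∩ X N ⁻¹' {-1}) + μ.real (B ∩ X N ⁻¹' {0})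
      + μ.real (B ∩ X N ⁻¹' {1}) := by
  have m : ∀ e : ℝ, MeasurableSet (X N ⁻¹' {e}) := fun e =>
    hX.measurable N (measurableSet_singleton e)
  have d1 : Disjoint (X N ⁻¹' {-1}) (X N ⁻¹' {0}) :=
    Disjoint.preimage _ (by norm_num)
  have d2 : Disjoint (X N ⁻¹' {-1} ∪ X N ⁻¹' {0}) (X N ⁻¹' {1}) := by
    rw [← Set.preimage_union]
    exact Disjoint.preimage _ (by norm_num)
  set E := X N ⁻¹' {-1} ∪ X N ⁻¹' {0} ∪ X N ⁻¹' {1} with hE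
  have mE : MeasurableSet E := ((m _).union (m _)).union (m _)
  have p1 : μ.real (X N ⁻¹' {-1}) = 1 / 3 := hX.prob_neg_one N
  have p2 : μ.real (X N ⁻¹' {0}) = 1 / 3 := hX.prob_zero N
  have p3 : μ.real (X N ⁻¹' {1}) = 1 / 3 := hX.prob_one N
  have pE : μ.real E = 1 := by
    rw [hE, measureReal_union d2 (m _), measureReal_union d1 (m _), p1, p2, p3]
    norm_num
  have pEc : μ.real Eᶜ = 0 := by rw [probReal_compl_eq_one_sub mE, pE, sub_self]
  have h0 : μ.real (B \ E) = 0 :=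
    le_antisymm ((measureReal_mono (fun ω h => h.2)).trans pEc.le) measureReal_nonneg
  have h1 : μ.real (B ∩ E) = μ.real (B ∩ X N ⁻¹' {-1}) + μ.real (B ∩ X N ⁻¹' {0})
      + μ.real (B ∩ X N ⁻¹' {1}) := by
    have a1 := measureReal_inter_add_sdiff (μ := μ) (s := B ∩ E) (m 1)
    have a2 := measureReal_inter_add_sdiff (μ := μ) (s := (B ∩ E) \ X N ⁻¹' {1}) (m 0)
    have e1 : B ∩ E ∩ X N ⁻¹' {1} = B ∩ X N ⁻¹' {1} := by
      ext ω; simp [hE]; grind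
    have e2 : ((B ∩ E) \ X N ⁻¹' {1}) ∩ X N ⁻¹' {0} = B ∩ X N ⁻¹' {0} := by
      ext ω; simp [hE]; grind
    have e3 : ((B ∩ E) \ X N ⁻¹' {1}) \ X N ⁻¹' {0} = B ∩ X N ⁻¹' {-1} := by
      ext ω; simp [hE]; grind
    rw [e1] at a1
    rw [e2, e3] at a2
    linarith
  rw [← measureReal_inter_add_sdiff (s := B) mE, h0, h1, add_zero]

/-- Induction on `N` with `A` arbitrary: conditioning on the value `e` of the next variable replaces
`A` by its preimage under translation by `(e, e²)`. The three translates are the terms that Pascal's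
rule produces, `e = 0` keeping `n` and `e = ±1` raising it. -/
lemma measureReal_sum_sumSq_mem (hX : IsIIDUniformTernary μ X) (N : ℕ) :
    ∀ A : Set (ℝ × ℝ), MeasurableSet A →
      μ.real {ω | (∑ i ∈ Finset.range N, X i ω, ∑ i ∈ Finset.range N, X i ω ^ 2) ∈ A}
        = (1 / 3) ^ N * ∑ n ∈ Finset.range (N + 1), (N.choose n : ℝ)
          * ∑ j ∈ Finset.range (n + 1), (n.choose j : ℝ)
            * A.indicator 1 ((2 * j - n : ℝ), (n : ℝ)) := by
  induction N with
  | zero =>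
    intro A hA
    by_cases h : ((0 : ℝ), (0 : ℝ)) ∈ A <;> simp [h]
  | succ N ih =>
    intro A hA
    set V : Ω → ℝ × ℝ := fun ω =>
      (∑ i ∈ Finset.range N, X i ω, ∑ i ∈ Finset.range N, X i ω ^ 2) with hV
    have hind : IndepFun V (X N) μ := by
      have h := hX.indep.indepFun_finset (Finset.range N) {N} (by simp) hX.measurable
      have hφ : Measurable fun f : (Finset.range N → ℝ) => (∑ i, f i, ∑ i, f i ^ 2) := by fun_prop
      have hψ : Measurable fun f : (({N} : Finset ℕ) → ℝ) => f ⟨N, by simp⟩ :=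
        measurable_pi_apply _
      have h2 := h.comp hφ hψ
      convert h2 using 1
      ext ω
      · simp only [hV, Function.comp]
        exact (Finset.sum_coe_sort (Finset.range N) (fun i => X i ω)).symm
      · simp only [hV, Function.comp]
        exact (Finset.sum_coe_sort (Finset.range N) (fun i => X i ω ^ 2)).symm
      · rfl
    have hstep : ∀ e : ℝ, μ.real (X N ⁻¹' {e}) = 1 / 3 →
        μ.real ({ω | (∑ i ∈ Finset.range (N + 1), X i ω,
          ∑ i ∈ Finset.range (N + 1), X i ω ^ 2) ∈ A} ∩ X N ⁻¹' {e})
        = 1 / 3 * μ.real {ω | V ω ∈ (fun v : ℝ × ℝ => (v.1 + e, v.2 + e ^ 2)) ⁻¹' A} := by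
      intro e he
      have hm : MeasurableSet ((fun v : ℝ × ℝ => (v.1 + e, v.2 + e ^ 2)) ⁻¹' A) :=
        (by fun_prop : Measurable fun v : ℝ × ℝ => (v.1 + e, v.2 + e ^ 2)) hA
      have h := hind.measure_inter_preimage_eq_mul _ _ hm (measurableSet_singleton e)
      have h' := congrArg ENNReal.toReal h
      rw [ENNReal.toReal_mul] at h'
      change μ.real _ = μ.real _ * μ.real _ at h'
      rw [he, mul_comm] at h'
      refine Eq.trans ?_ h'
      congr 1
      ext ω
      simp only [Set.mem_inter_iff, Set.mem_preimage, Set.mem_singleton_iff, Set.mem_ofPred_eq,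
        Finset.sum_range_succ, hV]
      constructor
      · rintro ⟨h1, rfl⟩; exact ⟨h1, rfl⟩
      · rintro ⟨h1, rfl⟩; exact ⟨h1, rfl⟩
    have hmeas : ∀ e : ℝ, MeasurableSet ((fun v : ℝ × ℝ => (v.1 + e, v.2 + e ^ 2)) ⁻¹' A) :=
      fun e => (by fun_prop : Measurable fun v : ℝ × ℝ => (v.1 + e, v.2 + e ^ 2)) hA
    rw [hX.measureReal_eq_sum_inter N, hstep _ (hX.prob_neg_one N), hstep _ (hX.prob_zero N),
      hstep _ (hX.prob_one N), ih _ (hmeas _), ih _ (hmeas _), ih _ (hmeas _),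
      sum_choose_succ_mul_eq N]
    simp_rw [sum_choose_succ_mul_eq]
    rw [pow_succ (1 / 3 : ℝ) N]
    have hr : ∀ a b c d : ℝ, 1 / 3 * (a * b) + 1 / 3 * (a * c) + 1 / 3 * (a * d)
        = a * (1 / 3) * (b + c + d) := by intros; ring
    rw [hr, ← Finset.sum_add_distrib, ← Finset.sum_add_distrib]
    congr 1
    refine Finset.sum_congr rfl fun n _ => ?_
    rw [← mul_add, ← mul_add, ← Finset.sum_add_distrib, ← Finset.sum_add_distrib,
      ← Finset.sum_add_distrib]
    congr 1
    refine Finset.sum_congr rfl fun j _ => ?_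
    rw [← mul_add, ← mul_add, ← mul_add]
    congr 1
    have i1 : ∀ e : ℝ, ((fun v : ℝ × ℝ => (v.1 + e, v.2 + e ^ 2)) ⁻¹' A).indicator
        (1 : ℝ × ℝ → ℝ) ((2 * j - n : ℝ), (n : ℝ))
        = A.indicator 1 ((2 * j - n : ℝ) + e, (n : ℝ) + e ^ 2) := fun e => rfl
    rw [i1, i1, i1]
    push_cast
    have e1 : (2 * j - n + -1 : ℝ) = 2 * j - (n + 1) := by ring
    have e2 : (2 * j - n + 1 : ℝ) = 2 * (j + 1) - (n + 1) := by ring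
    rw [e1, e2]
    norm_num
    ring

/-- The joint weight `3^{-N} C(N,n) C(n,j)` factors as a binomial weight of parameter `2/3` in `n`
times one of parameter `1/2` in `j`. -/
lemma measureReal_selfNormSum_mem (hX : IsIIDUniformTernary μ X) (N : ℕ) {s : Set ℝ}
    (hs : MeasurableSet s) :
    μ.real {ω | selfNormSum X N ω ∈ s}
      = ∑ n ∈ Finset.range (N + 1), binomWeight N (2 / 3) n
        * ∑ j ∈ Finset.range (n + 1), binomWeight n (1 / 2) j
          * s.indicator 1 ((2 * j - n : ℝ) / √n) := by
  have hm : MeasurableSet ((fun v : ℝ × ℝ => v.1 / √v.2) ⁻¹' s) :=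
    (by fun_prop : Measurable fun v : ℝ × ℝ => v.1 / √v.2) hs
  have h := hX.measureReal_sum_sumSq_mem N _ hm
  refine Eq.trans h ?_
  rw [Finset.mul_sum]
  refine Finset.sum_congr rfl fun n hn => ?_
  have hn' : n ≤ N := by have := Finset.mem_range.1 hn; omega
  rw [← mul_assoc, Finset.mul_sum, Finset.mul_sum]
  refine Finset.sum_congr rfl fun j hj => ?_
  have hj' : j ≤ n := by have := Finset.mem_range.1 hj; omega
  have e : ((fun v : ℝ × ℝ => v.1 / √v.2) ⁻¹' s).indicator (1 : ℝ × ℝ → ℝ)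
      ((2 * j - n : ℝ), (n : ℝ)) = s.indicator 1 ((2 * j - n : ℝ) / √n) := rfl
  rw [e]
  unfold binomWeight
  have e3 : (1 / 3 : ℝ) ^ N = (1 / 3) ^ n * (1 / 3) ^ (N - n) := by
    rw [← pow_add]; congr 1; omega
  have e4 : (1 / 2 : ℝ) ^ n = (1 / 2) ^ j * (1 / 2) ^ (n - j) := by
    rw [← pow_add]; congr 1; omega
  have e5 : (1 / 3 : ℝ) ^ n = (2 / 3) ^ n * (1 / 2) ^ n := by
    rw [← mul_pow]; norm_num
  have e6 : (1 - 2 / 3 : ℝ) = 1 / 3 := by norm_num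
  have e7 : (1 - 1 / 2 : ℝ) = 1 / 2 := by norm_num
  rw [e6, e7, e3, e5, e4]
  ring

lemma selfNormCDF_eq (hX : IsIIDUniformTernary μ X) (N : ℕ) (w : ℝ) :
    selfNormCDF μ X N w
      = ∑ n ∈ Finset.range (N + 1), binomWeight N (2 / 3) n * signSumCDF n w := by
  have h := hX.measureReal_selfNormSum_mem N (measurableSet_Iic (a := w))
  refine Eq.trans h (Finset.sum_congr rfl fun n _ => ?_)
  congr 1
  refine Finset.sum_congr rfl fun j _ => ?_
  simp [Set.indicator_apply]

/-- The negated variables satisfy the same hypotheses, and the formula for the law does not involve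
`X`. -/
lemma measureReal_selfNormSum_neg_mem (hX : IsIIDUniformTernary μ X) (N : ℕ) {s : Set ℝ}
    (hs : MeasurableSet s) :
    μ.real {ω | -selfNormSum X N ω ∈ s} = μ.real {ω | selfNormSum X N ω ∈ s} := by
  have h := hX.neg.measureReal_selfNormSum_mem N hs
  rw [hX.measureReal_selfNormSum_mem N hs, ← h]
  congr 1
  ext ω
  simp [selfNormSum, neg_div]

end IsIIDUniformTernary

/-! ### Moments of the weights -/

/-- The factor `1 + (n - 2N/3)²/N` pays for replacing a function of `n` by its size at the mean. It
is bounded on average and of order `N` for `n < N/3`, so small `n` need no separate treatment. -/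
lemma sum_binomWeight_mul_one_add_sq_le {N : ℕ} (hN : 0 < N) :
    ∑ n ∈ Finset.range (N + 1), binomWeight N (2 / 3) n * (1 + ((n : ℝ) - 2 * N / 3) ^ 2 / N)
      ≤ 2 := by
  have hN0 : (0 : ℝ) < N := by exact_mod_cast hN
  have h1 := sum_sq_sub_mul_binomWeight N (2 / 3)
  have e : ∀ n : ℕ, binomWeight N (2 / 3) n * (1 + ((n : ℝ) - 2 * N / 3) ^ 2 / N)
      = binomWeight N (2 / 3) n
        + 1 / N * (((n : ℝ) - N * (2 / 3)) ^ 2 * binomWeight N (2 / 3) n) := by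
    intro n; field_simp
  rw [Finset.sum_congr rfl fun n _ => e n, Finset.sum_add_distrib, sum_binomWeight,
    ← Finset.mul_sum, h1]
  have : 1 / (N : ℝ) * (N * (2 / 3) * (1 - 2 / 3)) = 2 / 9 := by field_simp; norm_num
  rw [this]; norm_num

lemma sum_gaussWeight_mul_one_add_sq_le {N : ℕ} (hN : 0 < N) (R : ℕ) :
    ∑ n ∈ Finset.range R, gaussWeight N n * (1 + ((n : ℝ) - 2 * N / 3) ^ 2 / N) ≤ 6 := by
  have hN1 : (1 : ℝ) ≤ N := by exact_mod_cast hN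
  have hN0 : (0 : ℝ) < N := by linarith
  have hs : 0 < √(N : ℝ) := by positivity
  have hs1 : 1 ≤ √(N : ℝ) := Real.one_le_sqrt.2 hN1
  have h : ∀ n : ℕ, gaussWeight N n * (1 + ((n : ℝ) - 2 * N / 3) ^ 2 / N)
      ≤ 1 / √N * (1 + (((n : ℝ) - 2 * N / 3) / √N) ^ 2)⁻¹ := by
    intro n
    have e : ((n : ℝ) - 2 * N / 3) ^ 2 / N = (((n : ℝ) - 2 * N / 3) / √N) ^ 2 := by
      rw [div_pow, Real.sq_sqrt hN0.le]
    rw [gaussWeight_eq_of_pos hN, e]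
    set x := ((n : ℝ) - 2 * N / 3) / √N
    have hx0 : (0 : ℝ) < 1 + x ^ 2 := by positivity
    have h2 := one_add_sq_pow_mul_exp_le (a := 2) (k := 2) (by norm_num) (by norm_num) x
    norm_num at h2
    have h1 : Real.exp (-(9 / 4 * x ^ 2)) ≤ Real.exp (-(2 * x ^ 2)) :=
      Real.exp_le_exp.2 (by nlinarith [sq_nonneg x])
    have hc := gaussWeight_coeff_le N
    rw [← div_eq_mul_inv, le_div_iff₀ hx0]
    calc 3 / (2 * √(Real.pi * N)) * Real.exp (-(9 / 4 * x ^ 2)) * (1 + x ^ 2) * (1 + x ^ 2)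
        ≤ 1 / √N * Real.exp (-(2 * x ^ 2)) * (1 + x ^ 2) * (1 + x ^ 2) := by gcongr
      _ = 1 / √N * ((1 + x ^ 2) ^ 2 * Real.exp (-(2 * x ^ 2))) := by ring
      _ ≤ 1 / √N * 1 := by gcongr
      _ = 1 / √N := mul_one _
  calc _ ≤ ∑ n ∈ Finset.range R, 1 / √N * (1 + (((n : ℝ) - 2 * N / 3) / √N) ^ 2)⁻¹ :=
        Finset.sum_le_sum fun n _ => h n
    _ ≤ 1 / √N * (2 + Real.pi * √N) := by
        rw [← Finset.mul_sum]
        gcongr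
        exact sum_inv_one_add_sq_le _ hs _
    _ ≤ 1 / √N * (6 * √N) := by
        gcongr
        nlinarith [Real.pi_lt_d2]
    _ = 6 := by field_simp

lemma sum_gaussWeight_le {N : ℕ} (hN : 0 < N) (R : ℕ) :
    ∑ n ∈ Finset.range R, gaussWeight N n ≤ 6 := by
  refine le_trans (Finset.sum_le_sum fun n _ => ?_) (sum_gaussWeight_mul_one_add_sq_le hN R)
  refine le_mul_of_one_le_right (gaussWeight_nonneg N n) ?_
  have : 0 ≤ ((n : ℝ) - 2 * N / 3) ^ 2 / N := by positivity
  linarith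

/-- A point `n` below half of the mean is far from the mean on the scale `√N`. -/
lemma div_nine_le_of_lt {N : ℕ} (hN : 0 < N) {x : ℝ} (hx : x < N / 3) :
    (N : ℝ) / 9 ≤ (x - 2 * N / 3) ^ 2 / N := by
  have hN0 : (0 : ℝ) < N := by exact_mod_cast hN
  rw [le_div_iff₀ hN0]
  nlinarith

lemma one_div_succ_le {N : ℕ} (hN : 0 < N) (n : ℕ) :
    1 / ((n : ℝ) + 1) ≤ 9 / N * (1 + ((n : ℝ) - 2 * N / 3) ^ 2 / N) := by
  have hN0 : (0 : ℝ) < N := by exact_mod_cast hN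
  have hx : 0 ≤ ((n : ℝ) - 2 * N / 3) ^ 2 / N := by positivity
  rcases lt_or_ge (n : ℝ) (N / 3) with h | h
  · have h1 := div_nine_le_of_lt hN h
    calc 1 / ((n : ℝ) + 1) ≤ 1 := by
          rw [div_le_one (by positivity)]; linarith [(Nat.cast_nonneg n : (0 : ℝ) ≤ n)]
      _ = 9 / N * (N / 9) := by field_simp
      _ ≤ _ := by gcongr; linarith
  · calc 1 / ((n : ℝ) + 1) ≤ 1 / (N / 3) := by gcongr; linarith
      _ = 3 / N * 1 := by field_simp
      _ ≤ _ := by gcongr <;> linarith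

lemma one_div_sqrt_succ_le {N : ℕ} (hN : 0 < N) (n : ℕ) :
    1 / √((n : ℝ) + 1) ≤ 9 / √N * (1 + ((n : ℝ) - 2 * N / 3) ^ 2 / N) := by
  have hN1 : (1 : ℝ) ≤ N := by exact_mod_cast hN
  have hN0 : (0 : ℝ) < N := by linarith
  have hs : 0 < √(N : ℝ) := by positivity
  have hs1 : 1 ≤ √(N : ℝ) := Real.one_le_sqrt.2 hN1
  have hx : 0 ≤ ((n : ℝ) - 2 * N / 3) ^ 2 / N := by positivity
  rcases lt_or_ge (n : ℝ) (N / 3) with h | h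
  · have h1 := div_nine_le_of_lt hN h
    calc 1 / √((n : ℝ) + 1) ≤ 1 := by
          rw [div_le_one (by positivity)]
          exact Real.one_le_sqrt.2 (by linarith [(Nat.cast_nonneg n : (0 : ℝ) ≤ n)])
      _ ≤ √N := hs1
      _ = 9 / √N * (N / 9) := by
          rw [div_mul_div_comm, eq_div_iff (by positivity)]
          nlinarith [Real.mul_self_sqrt hN0.le]
      _ ≤ _ := by gcongr; linarith
  · have h2 : √N / 2 ≤ √((n : ℝ) + 1) := by
      apply Real.le_sqrt_of_sq_le
      rw [div_pow, Real.sq_sqrt hN0.le]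
      linarith
    calc 1 / √((n : ℝ) + 1) ≤ 1 / (√N / 2) := by gcongr
      _ = 2 / √N * 1 := by field_simp
      _ ≤ _ := by gcongr <;> linarith

/-- The squares `4/n` and `6/N` differ by a multiple of `n - 2N/3`; dividing by the sum of the
roots, at least `2/√N`, gives the bound for `n ≥ N/3`. Below that the moment factor exceeds `N/9`,
which also covers `n = 0`. -/
lemma abs_two_div_sqrt_sub_le {N : ℕ} (hN : 0 < N) (n : ℕ) :
    |2 / √(n : ℝ) - √6 / √N| ≤ 27 / N * (1 + ((n : ℝ) - 2 * N / 3) ^ 2 / N) := by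
  have hN1 : (1 : ℝ) ≤ N := by exact_mod_cast hN
  have hN0 : (0 : ℝ) < N := by linarith
  have hs : 0 < √(N : ℝ) := by positivity
  have hs1 : 1 ≤ √(N : ℝ) := Real.one_le_sqrt.2 hN1
  have hss : √(N : ℝ) ^ 2 = N := Real.sq_sqrt hN0.le
  have h6 : √(6 : ℝ) ^ 2 = 6 := Real.sq_sqrt (by norm_num)
  have h62 : (2 : ℝ) ≤ √6 := Real.le_sqrt_of_sq_le (by norm_num)
  have h63 : √6 ≤ (3 : ℝ) := by rw [Real.sqrt_le_left (by norm_num)]; norm_num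
  have hx : 0 ≤ ((n : ℝ) - 2 * N / 3) ^ 2 / N := by positivity
  rcases lt_or_ge (n : ℝ) (N / 3) with h | h
  · have h1 := div_nine_le_of_lt hN h
    have h2 : 2 / √(n : ℝ) ≤ 2 := by
      rcases Nat.eq_zero_or_pos n with rfl | hn
      · simp
      · have hn1 : (1 : ℝ) ≤ n := by exact_mod_cast hn
        have : 1 ≤ √(n : ℝ) := Real.one_le_sqrt.2 hn1
        rw [div_le_iff₀ (by linarith)]; linarith
    have h3 : √6 / √(N : ℝ) ≤ 3 := by rw [div_le_iff₀ hs]; nlinarith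
    have h4 : 0 ≤ 2 / √(n : ℝ) := by positivity
    have h5 : 0 ≤ √6 / √(N : ℝ) := by positivity
    calc |2 / √(n : ℝ) - √6 / √N| ≤ 3 := by rw [abs_le]; constructor <;> linarith
      _ = 27 / N * (N / 9) := by field_simp; norm_num
      _ ≤ _ := by gcongr; linarith
  · have hn0 : (0 : ℝ) < n := by linarith [div_pos hN0 (by norm_num : (0 : ℝ) < 3)]
    have hns : 0 < √(n : ℝ) := by positivity
    have hnn : √(n : ℝ) ^ 2 = n := Real.sq_sqrt hn0.le
    set a := 2 / √(n : ℝ) with ha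
    set b := √6 / √(N : ℝ) with hb
    set x := ((n : ℝ) - 2 * N / 3) / √N with hxdef
    have ex : ((n : ℝ) - 2 * N / 3) ^ 2 / N = x ^ 2 := by
      rw [hxdef, div_pow, hss]
    have hab : (a - b) * (a + b) = -(6 / (n * √N) * x) := by
      have e1 : (a - b) * (a + b) = a ^ 2 - b ^ 2 := by ring
      rw [e1, ha, hb, hxdef, div_pow, div_pow, hss, h6, hnn, div_mul_div_comm, mul_assoc,
        Real.mul_self_sqrt hN0.le]
      field_simp; ring
    have ha0 : 0 < a := by positivity
    have hb2 : 2 / √N ≤ b := by rw [hb]; gcongr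
    have h7 : |a - b| * (2 / √N) ≤ 6 / (n * √N) * |x| := by
      calc |a - b| * (2 / √N) ≤ |a - b| * (a + b) := by gcongr; linarith
        _ = |(a - b) * (a + b)| := by
            rw [abs_mul, abs_of_pos (a := a + b) (by positivity)]
        _ = 6 / (n * √N) * |x| := by
            rw [hab, abs_neg, abs_mul, abs_of_pos (by positivity)]
    have h8 : |a - b| ≤ 3 / n * |x| := by
      rw [mul_div_assoc', div_le_iff₀ hs] at h7
      have e : 6 / (n * √N) * |x| * √(N : ℝ) = 6 / n * |x| := by field_simp
      rw [e] at h7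
      have e2 : 6 / (n : ℝ) * |x| = 2 * (3 / n * |x|) := by ring
      linarith
    have h9 : (3 : ℝ) / n ≤ 27 / N := by
      rw [div_le_div_iff₀ hn0 hN0]; linarith
    rw [ex]
    refine h8.trans ?_
    have : |x| ≤ 1 + x ^ 2 := by rw [← sq_abs]; nlinarith [sq_nonneg (|x| - 1), abs_nonneg x]
    gcongr

/-! ### Variation of floors along square roots -/

/-- Abel summation: a floor is the identity minus a fractional part in `[0, 1)`, and the differences
of the fractional parts are moved onto the weight, whose total variation is `O(1/√N)`. No
equidistribution is needed. -/
lemma sum_gaussWeight_mul_floor_sub_le (N R : ℕ) (u : ℕ → ℝ) :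
    ∑ n ∈ Finset.range R, gaussWeight N n * ((⌊u (n + 1)⌋ : ℝ) - ⌊u n⌋)
      ≤ ∑ n ∈ Finset.range R, gaussWeight N n * (u (n + 1) - u n) + 3 / √N := by
  have habel : ∑ n ∈ Finset.range R, gaussWeight N n * ((⌊u (n + 1)⌋ : ℝ) - ⌊u n⌋)
      = ∑ n ∈ Finset.range R, gaussWeight N n * (u (n + 1) - u n)
        - (gaussWeight N R * Int.fract (u R) - gaussWeight N (0 : ℕ) * Int.fract (u 0))
        + ∑ n ∈ Finset.range R,
          Int.fract (u (n + 1)) * (gaussWeight N ((n : ℝ) + 1) - gaussWeight N n) := by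
    have := Finset.sum_range_sub (fun n : ℕ => gaussWeight N n * Int.fract (u n)) R
    rw [← this, ← Finset.sum_sub_distrib, ← Finset.sum_add_distrib]
    refine Finset.sum_congr rfl fun n _ => ?_
    unfold Int.fract
    push_cast
    ring
  have h1 : ∑ n ∈ Finset.range R,
      Int.fract (u (n + 1)) * (gaussWeight N ((n : ℝ) + 1) - gaussWeight N n) ≤ 2 / √N := by
    refine le_trans (Finset.sum_le_sum fun n _ => ?_) (sum_abs_gaussWeight_sub_le N R)
    have f0 := Int.fract_nonneg (u (n + 1))
    have f1 := (Int.fract_lt_one (u (n + 1))).le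
    calc _ ≤ Int.fract (u (n + 1)) * |gaussWeight N ((n : ℝ) + 1) - gaussWeight N n| := by
          gcongr; exact le_abs_self _
      _ ≤ 1 * |gaussWeight N ((n : ℝ) + 1) - gaussWeight N n| := by gcongr
      _ = _ := one_mul _
  have h2 : 0 ≤ gaussWeight N R * Int.fract (u R) :=
    mul_nonneg (gaussWeight_nonneg _ _) (Int.fract_nonneg _)
  have h3 : gaussWeight N (0 : ℕ) * Int.fract (u 0) ≤ 1 / √N := by
    calc _ ≤ 1 / √(N : ℝ) * 1 := mul_le_mul (gaussWeight_le _ _) (Int.fract_lt_one _).le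
          (Int.fract_nonneg _) (by positivity)
      _ = _ := mul_one _
  have e : 3 / √(N : ℝ) = 1 / √N + 2 / √N := by ring
  rw [habel, e]
  linarith

lemma sqrt_succ_sub_sqrt_le {x : ℝ} (hx : 0 ≤ x) : √(x + 1) - √x ≤ 1 / √(x + 1) := by
  have h1 : 0 < √(x + 1) := by positivity
  have h2 : √x ≤ √(x + 1) := Real.sqrt_le_sqrt (by linarith)
  rw [le_div_iff₀ h1]
  nlinarith [Real.mul_self_sqrt hx, Real.mul_self_sqrt (by linarith : 0 ≤ x + 1), Real.sqrt_nonneg x]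

lemma sum_gaussWeight_mul_sqrt_sub_le {N : ℕ} (hN : 0 < N) (R l : ℕ) :
    ∑ n ∈ Finset.range R, gaussWeight N n * (√((n : ℝ) + l + 1) - √((n : ℝ) + l))
      ≤ 54 / √N := by
  have hN0 : (0 : ℝ) < N := by exact_mod_cast hN
  have hs : 0 < √(N : ℝ) := by positivity
  calc _ ≤ ∑ n ∈ Finset.range R,
        9 / √N * (gaussWeight N n * (1 + ((n : ℝ) - 2 * N / 3) ^ 2 / N)) := by
        refine Finset.sum_le_sum fun n _ => ?_
        have h1 := sqrt_succ_sub_sqrt_le (by positivity : (0 : ℝ) ≤ (n : ℝ) + l)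
        have h2 : 1 / √((n : ℝ) + l + 1) ≤ 1 / √((n : ℝ) + 1) := by
          gcongr; linarith [(Nat.cast_nonneg l : (0 : ℝ) ≤ l)]
        have h3 := one_div_sqrt_succ_le hN n
        have h4 := mul_le_mul_of_nonneg_left (h1.trans (h2.trans h3)) (gaussWeight_nonneg N n)
        linarith
    _ ≤ 9 / √N * 6 := by
        rw [← Finset.mul_sum]
        gcongr
        exact sum_gaussWeight_mul_one_add_sq_le hN R
    _ = _ := by ring

/-- A shift by `L` is `L` unit shifts, and the Abel bound applies to each of them. -/
lemma sum_gaussWeight_mul_floor_sqrt_sub_le {N : ℕ} (hN : 0 < N) (R : ℕ) {c : ℝ} (hc : 0 ≤ c)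
    (d : ℝ) (L : ℕ) :
    ∑ n ∈ Finset.range R,
      gaussWeight N n * ((⌊c * √((n : ℝ) + L) + d⌋ : ℝ) - ⌊c * √(n : ℝ) + d⌋)
      ≤ L * (54 * (1 + c) / √N) := by
  induction L with
  | zero => simp
  | succ L ih =>
    have h := sum_gaussWeight_mul_floor_sub_le N R (fun n => c * √((n : ℝ) + L) + d)
    have h2 := sum_gaussWeight_mul_sqrt_sub_le hN R L
    have e1 : ∑ n ∈ Finset.range R, gaussWeight N n
        * (c * √(((n + 1 : ℕ) : ℝ) + L) + d - (c * √((n : ℝ) + L) + d))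
        = c * ∑ n ∈ Finset.range R, gaussWeight N n * (√((n : ℝ) + L + 1) - √((n : ℝ) + L)) := by
      rw [Finset.mul_sum]
      refine Finset.sum_congr rfl fun n _ => ?_
      have : ((n + 1 : ℕ) : ℝ) + L = (n : ℝ) + L + 1 := by push_cast; ring
      rw [this]; ring
    rw [e1] at h
    have h3 : c * ∑ n ∈ Finset.range R, gaussWeight N n * (√((n : ℝ) + L + 1) - √((n : ℝ) + L))
        ≤ c * (54 / √N) := by gcongr
    have e2 : ∑ n ∈ Finset.range R, gaussWeight N n
        * ((⌊c * √((n : ℝ) + (L + 1 : ℕ)) + d⌋ : ℝ) - ⌊c * √(n : ℝ) + d⌋)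
        = ∑ n ∈ Finset.range R, gaussWeight N n
            * ((⌊c * √((n : ℝ) + L) + d⌋ : ℝ) - ⌊c * √(n : ℝ) + d⌋)
          + ∑ n ∈ Finset.range R, gaussWeight N n
            * ((⌊c * √(((n + 1 : ℕ) : ℝ) + L) + d⌋ : ℝ) - ⌊c * √((n : ℝ) + L) + d⌋) := by
      rw [← Finset.sum_add_distrib]
      refine Finset.sum_congr rfl fun n _ => ?_
      have : ((n + 1 : ℕ) : ℝ) + L = (n : ℝ) + (L + 1 : ℕ) := by push_cast; ring
      rw [this]; ring
    have h4 : (0 : ℝ) ≤ 51 / √N := by positivity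
    have e3 : ((L + 1 : ℕ) : ℝ) * (54 * (1 + c) / √N)
        = L * (54 * (1 + c) / √N) + (c * (54 / √N) + 3 / √N + 51 / √N) := by
      push_cast; ring
    rw [e2, e3]
    linarith

lemma sum_range_two_mul_eq (f : ℕ → ℝ) (M : ℕ) :
    ∑ n ∈ Finset.range (2 * M), f n = ∑ m ∈ Finset.range M, (f (2 * m) + f (2 * m + 1)) := by
  induction M with
  | zero => simp
  | succ M ih =>
    rw [Finset.sum_range_succ, ← ih, show 2 * (M + 1) = 2 * M + 1 + 1 by ring,
      Finset.sum_range_succ, Finset.sum_range_succ]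
    ring

lemma sum_even_le_sum_range (f : ℕ → ℝ) (hf : ∀ n, 0 ≤ f n) (M : ℕ) :
    ∑ m ∈ Finset.range M, f (2 * m) ≤ ∑ n ∈ Finset.range (2 * M), f n := by
  rw [sum_range_two_mul_eq]
  exact Finset.sum_le_sum fun m _ => le_add_of_nonneg_right (hf _)

lemma abs_sawtooth_sub_le {x y : ℝ} (hxy : x ≤ y) :
    |sawtooth y - sawtooth x| ≤ (y - x) + ((⌊y⌋ : ℝ) - ⌊x⌋) := by
  have h : (⌊x⌋ : ℝ) ≤ ⌊y⌋ := by exact_mod_cast Int.floor_mono hxy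
  unfold sawtooth Int.fract
  rw [abs_le]; constructor <;> linarith

/-! ### The expansion on the positive half-line -/

/-- The sawtooth average occurring in the expansion. -/
noncomputable def sawtoothMean (N : ℕ) (w : ℝ) : ℝ :=
  ∑ m ∈ Finset.range (N + 1), gaussWeight N (2 * m) * sawtooth (w * √(2 * m))

lemma expansionNonneg_eq (N : ℕ) (w : ℝ) :
    expansionNonneg N w
      = stdNormalCDF w - √6 / √N * (stdNormalPDF w * sawtoothMean N w) := by
  have h6 : √(6 : ℝ) = 2 * √(3 / 2) := by
    rw [show (6 : ℝ) = 2 ^ 2 * (3 / 2) by norm_num, Real.sqrt_mul (by norm_num),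
      Real.sqrt_sq (by norm_num)]
  have hs : ∑ n ∈ Finset.range (N + 1),
      3 / √(Real.pi * N) * Real.exp (-(9 / (N : ℝ)) * ((n : ℝ) - N / 3) ^ 2) *
        (Int.fract (w * √(2 * n)) - 1 / 2) = 2 * sawtoothMean N w := by
    rw [sawtoothMean, Finset.mul_sum]
    refine Finset.sum_congr rfl fun n _ => ?_
    have e : -(9 / (4 * (N : ℝ))) * (2 * n - 2 * N / 3) ^ 2
        = -(9 / (N : ℝ)) * ((n : ℝ) - N / 3) ^ 2 := by
      have : (2 * n - 2 * N / 3 : ℝ) = 2 * (n - N / 3) := by ring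
      rw [this, mul_pow]
      rcases Nat.eq_zero_or_pos N with rfl | hN
      · simp
      · have : (0 : ℝ) < N := by exact_mod_cast hN
        field_simp; norm_num
    rw [gaussWeight, e, sawtooth]
    have e2 : 3 / √(Real.pi * N) = 2 * (3 / (2 * √(Real.pi * N))) := by
      rw [← mul_div_assoc, mul_div_mul_left _ _ (by norm_num : (2 : ℝ) ≠ 0)]
    rw [e2]; ring
  rw [expansionNonneg, sawtoothTerm, hs, h6]
  ring

lemma one_add_mul_stdNormalPDF_le {w : ℝ} (hw : 0 ≤ w) : (1 + w) * stdNormalPDF w ≤ 2 := by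
  have h1 := abs_mul_stdNormalPDF_le w
  rw [abs_of_nonneg hw] at h1
  have h2 := stdNormalPDF_le w
  linarith

lemma sqrt_six_div_le (N : ℕ) : √6 / √(N : ℝ) ≤ 3 / √N := by
  have h63 : √6 ≤ (3 : ℝ) := by rw [Real.sqrt_le_left (by norm_num)]; norm_num
  gcongr

lemma sum_gaussWeight_even_le {N : ℕ} (hN : 0 < N) :
    ∑ m ∈ Finset.range (N + 1), gaussWeight N (2 * m) ≤ 6 := by
  have h := sum_even_le_sum_range (fun n => gaussWeight N n)
    (fun n => gaussWeight_nonneg N n) (N + 1)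
  push_cast at h
  exact h.trans (sum_gaussWeight_le hN _)

lemma abs_sawtoothMean_le {N : ℕ} (hN : 0 < N) (w : ℝ) : |sawtoothMean N w| ≤ 3 := by
  unfold sawtoothMean
  refine (Finset.abs_sum_le_sum_abs _ _).trans ?_
  calc _ ≤ ∑ m ∈ Finset.range (N + 1), gaussWeight N (2 * m) * (1 / 2) := by
        refine Finset.sum_le_sum fun m _ => ?_
        rw [abs_mul, abs_of_nonneg (gaussWeight_nonneg _ _)]
        exact mul_le_mul_of_nonneg_left (abs_sawtooth_le _) (gaussWeight_nonneg _ _)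
    _ ≤ 6 * (1 / 2) := by
        rw [← Finset.sum_mul]
        gcongr
        exact sum_gaussWeight_even_le hN
    _ = 3 := by norm_num

/-- Replacing the sawtooth of the lattice positions by that of `w * √(2 * m)`. -/
lemma abs_sum_gaussWeight_mul_sawtooth_sub_le {N : ℕ} (hN : 0 < N) {w : ℝ} (hw : 0 ≤ w) :
    |∑ n ∈ Finset.range (2 * (N + 1)), gaussWeight N n * sawtooth ((w * √n + n) / 2)
      - sawtoothMean N w| ≤ 109 * (1 + w) / √N := by
  have hN0 : (0 : ℝ) < N := by exact_mod_cast hN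
  have hs : 0 < √(N : ℝ) := by positivity
  set T : ℕ → ℝ := fun n => sawtooth ((w * √(n : ℝ) + n) / 2) with hT
  set u : ℕ → ℝ := fun n => w / 2 * √(n : ℝ) + 1 / 2 with hu
  -- For `n = 2m` the shift `n/2` is an integer, and the doubling identity splits off the wanted
  -- sawtooth; what remains cancels against `n = 2m + 1`.
  have hT0 : ∀ m : ℕ, T (2 * m) = sawtooth (w * √(2 * m)) - sawtooth (u (2 * m)) := by
    intro m
    have e1 : (w * √((2 * m : ℕ) : ℝ) + (2 * m : ℕ)) / 2 = w / 2 * √((2 * m : ℕ) : ℝ) + m := by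
      push_cast; ring
    have h := sawtooth_add_half (w / 2 * √((2 * m : ℕ) : ℝ))
    have e2 : 2 * (w / 2 * √((2 * m : ℕ) : ℝ)) = w * √(2 * m) := by push_cast; ring
    rw [e2] at h
    simp only [hT, hu]
    rw [e1, sawtooth_add_nat]
    linarith
  have hT1 : ∀ m : ℕ, T (2 * m + 1) = sawtooth (u (2 * m + 1)) := by
    intro m
    have e1 : (w * √((2 * m + 1 : ℕ) : ℝ) + (2 * m + 1 : ℕ)) / 2
        = (w / 2 * √((2 * m + 1 : ℕ) : ℝ) + 1 / 2) + m := by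
      push_cast; ring
    simp only [hT, hu]
    rw [e1, sawtooth_add_nat]
  have humono : ∀ n : ℕ, u n ≤ u (n + 1) := by
    intro n
    simp only [hu]
    gcongr
    linarith
  have key : ∑ n ∈ Finset.range (2 * (N + 1)), gaussWeight N n * T n - sawtoothMean N w
      = ∑ m ∈ Finset.range (N + 1),
          (gaussWeight N ((2 * m : ℕ) + 1 : ℝ) - gaussWeight N (2 * m : ℕ)) * T (2 * m + 1)
        + ∑ m ∈ Finset.range (N + 1),
          gaussWeight N (2 * m : ℕ) * (sawtooth (u (2 * m + 1)) - sawtooth (u (2 * m))) := by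
    rw [sum_range_two_mul_eq, sawtoothMean, ← Finset.sum_sub_distrib, ← Finset.sum_add_distrib]
    refine Finset.sum_congr rfl fun m _ => ?_
    rw [hT0, hT1]
    push_cast
    ring
  have b1 : |∑ m ∈ Finset.range (N + 1),
      (gaussWeight N ((2 * m : ℕ) + 1 : ℝ) - gaussWeight N (2 * m : ℕ)) * T (2 * m + 1)|
      ≤ 1 / √N := by
    refine (Finset.abs_sum_le_sum_abs _ _).trans ?_
    calc _ ≤ ∑ m ∈ Finset.range (N + 1), 1 / 2 *
          |gaussWeight N ((2 * m : ℕ) + 1 : ℝ) - gaussWeight N (2 * m : ℕ)| := by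
          refine Finset.sum_le_sum fun m _ => ?_
          rw [abs_mul, mul_comm]
          gcongr
          exact abs_sawtooth_le _
      _ ≤ 1 / 2 * (2 / √N) := by
          rw [← Finset.mul_sum]
          gcongr
          exact (sum_even_le_sum_range
            (fun n => |gaussWeight N ((n : ℝ) + 1) - gaussWeight N n|)
            (fun n => abs_nonneg _) (N + 1)).trans (sum_abs_gaussWeight_sub_le N _)
      _ = _ := by ring
  -- An increment of the sawtooth is at most that of its argument plus the number of jumps crossed.
  -- Both are nonnegative, so the sum over even indices extends to all indices.
  have b2 : |∑ m ∈ Finset.range (N + 1),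
      gaussWeight N (2 * m : ℕ) * (sawtooth (u (2 * m + 1)) - sawtooth (u (2 * m)))|
      ≤ w / 2 * (54 / √N) + 54 * (1 + w / 2) / √N := by
    refine (Finset.abs_sum_le_sum_abs _ _).trans ?_
    have hfl : ∀ n : ℕ, (⌊u n⌋ : ℝ) ≤ ⌊u (n + 1)⌋ := fun n => by
      exact_mod_cast Int.floor_mono (humono n)
    have hterm : ∀ n : ℕ, 0 ≤ gaussWeight N n *
        ((u (n + 1) - u n) + ((⌊u (n + 1)⌋ : ℝ) - ⌊u n⌋)) := fun n =>
      mul_nonneg (gaussWeight_nonneg _ _) (by linarith [humono n, hfl n])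
    calc _ ≤ ∑ m ∈ Finset.range (N + 1), (fun n : ℕ => gaussWeight N n *
          ((u (n + 1) - u n) + ((⌊u (n + 1)⌋ : ℝ) - ⌊u n⌋))) (2 * m) := by
          refine Finset.sum_le_sum fun m _ => ?_
          rw [abs_mul, abs_of_nonneg (gaussWeight_nonneg _ _)]
          exact mul_le_mul_of_nonneg_left (abs_sawtooth_sub_le (humono _))
            (gaussWeight_nonneg _ _)
      _ ≤ ∑ n ∈ Finset.range (2 * (N + 1)), gaussWeight N n *
          ((u (n + 1) - u n) + ((⌊u (n + 1)⌋ : ℝ) - ⌊u n⌋)) :=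
          sum_even_le_sum_range _ hterm _
      _ = w / 2 * ∑ n ∈ Finset.range (2 * (N + 1)),
            gaussWeight N n * (√((n : ℝ) + (0 : ℕ) + 1) - √((n : ℝ) + (0 : ℕ)))
          + ∑ n ∈ Finset.range (2 * (N + 1)), gaussWeight N n
            * ((⌊w / 2 * √((n : ℝ) + (1 : ℕ)) + 1 / 2⌋ : ℝ) - ⌊w / 2 * √(n : ℝ) + 1 / 2⌋) := by
          rw [Finset.mul_sum, ← Finset.sum_add_distrib]
          refine Finset.sum_congr rfl fun n _ => ?_
          simp only [hu]
          push_cast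
          rw [add_zero]
          ring
      _ ≤ w / 2 * (54 / √N) + (1 : ℕ) * (54 * (1 + w / 2) / √N) := by
          gcongr
          · exact sum_gaussWeight_mul_sqrt_sub_le hN _ 0
          · exact sum_gaussWeight_mul_floor_sqrt_sub_le hN _ (by positivity) _ 1
      _ = _ := by push_cast; ring
  rw [key]
  refine (abs_add_le _ _).trans ((add_le_add b1 b2).trans ?_)
  have e : 1 / √(N : ℝ) + (w / 2 * (54 / √N) + 54 * (1 + w / 2) / √N)
      = (55 + 54 * w) / √N := by ring
  rw [e]
  gcongr
  linarith

/-- Four replacements: each sign-sum distribution by its expansion (`s1`), `2/√n` by `√6/√N` (`s2`),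
binomial by Gaussian weights (`s3`), and the parity-dependent sawtooth by `sawtoothMean` (`s4`). The
last two are accurate only to `N^{-1/2}` but are multiplied by `√6/√N`. -/
lemma exists_abs_sum_signSumCDF_sub_expansionNonneg_le : ∃ K : ℝ, 0 ≤ K ∧ ∀ (N : ℕ) (w : ℝ),
    0 < N → 0 ≤ w →
    |∑ n ∈ Finset.range (N + 1), binomWeight N (2 / 3) n * signSumCDF n w
      - expansionNonneg N w| ≤ K / N := by
  obtain ⟨C₁, hC₁0, hC₁⟩ := exists_abs_signSumCDF_sub_le
  obtain ⟨C₂, hC₂0, hC₂⟩ := exists_sum_abs_binomWeight_two_thirds_sub_le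
  refine ⟨18 * C₁ + 54 + 3 * C₂ + 654, by positivity, fun N w hN hw => ?_⟩
  have hN0 : (0 : ℝ) < N := by exact_mod_cast hN
  have hs : 0 < √(N : ℝ) := by positivity
  have hss : √(N : ℝ) * √N = N := Real.mul_self_sqrt hN0.le
  have hp : ∀ n, 0 ≤ binomWeight N (2 / 3) n := binomWeight_nonneg (by norm_num) (by norm_num)
  have hφ := stdNormalPDF_nonneg w
  have hφ1 : stdNormalPDF w ≤ 1 := (stdNormalPDF_le w).trans (by norm_num)
  set T : ℕ → ℝ := fun n => sawtooth ((w * √(n : ℝ) + n) / 2) with hT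
  have hT1 : ∀ n, |T n| ≤ 1 := fun n => (abs_sawtooth_le _).trans (by norm_num)
  set b : ℝ := √6 / √N with hb
  have hb0 : 0 ≤ b := by positivity
  have hb3 : b ≤ 3 / √N := sqrt_six_div_le N
  set A := ∑ n ∈ Finset.range (N + 1), binomWeight N (2 / 3) n * signSumCDF n w with hA
  set S₁ := ∑ n ∈ Finset.range (N + 1), binomWeight N (2 / 3) n * (2 / √n * T n) with hS₁
  set S₂ := ∑ n ∈ Finset.range (N + 1), binomWeight N (2 / 3) n * T n with hS₂
  set S₃ := ∑ n ∈ Finset.range (2 * (N + 1)), gaussWeight N n * T n with hS₃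
  have hmom := sum_binomWeight_mul_one_add_sq_le hN
  have s1 : |A - (stdNormalCDF w - stdNormalPDF w * S₁)| ≤ 18 * C₁ / N := by
    have e : A - (stdNormalCDF w - stdNormalPDF w * S₁)
        = ∑ n ∈ Finset.range (N + 1), binomWeight N (2 / 3) n *
          (signSumCDF n w - (stdNormalCDF w - 2 / √n * stdNormalPDF w * T n)) := by
      have h1 : stdNormalCDF w
          = ∑ n ∈ Finset.range (N + 1), binomWeight N (2 / 3) n * stdNormalCDF w := by
        rw [← Finset.sum_mul, sum_binomWeight, one_mul]
      rw [hA, hS₁, h1, Finset.mul_sum, ← Finset.sum_sub_distrib, ← Finset.sum_sub_distrib, ← h1]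
      exact Finset.sum_congr rfl fun n _ => by ring
    rw [e]
    refine (Finset.abs_sum_le_sum_abs _ _).trans ?_
    calc _ ≤ ∑ n ∈ Finset.range (N + 1), C₁ * (9 / N) *
          (binomWeight N (2 / 3) n * (1 + ((n : ℝ) - 2 * N / 3) ^ 2 / N)) := by
          refine Finset.sum_le_sum fun n _ => ?_
          rw [abs_mul, abs_of_nonneg (hp n)]
          have h1 := hC₁ n w hw
          have h2 := mul_le_mul_of_nonneg_left (one_div_succ_le hN n) hC₁0
          calc _ ≤ binomWeight N (2 / 3) n *
                (C₁ * (9 / N * (1 + ((n : ℝ) - 2 * N / 3) ^ 2 / N))) := by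
                refine mul_le_mul_of_nonneg_left (h1.trans ?_) (hp n)
                rw [mul_one_div] at h2
                exact h2
            _ = _ := by ring
      _ ≤ C₁ * (9 / N) * 2 := by
          rw [← Finset.mul_sum]
          gcongr
      _ = _ := by ring
  have s2 : |S₁ - b * S₂| ≤ 54 / N := by
    have e : S₁ - b * S₂ = ∑ n ∈ Finset.range (N + 1), binomWeight N (2 / 3) n *
        ((2 / √n - b) * T n) := by
      rw [hS₁, hS₂, Finset.mul_sum, ← Finset.sum_sub_distrib]
      exact Finset.sum_congr rfl fun n _ => by ring
    rw [e]
    refine (Finset.abs_sum_le_sum_abs _ _).trans ?_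
    calc _ ≤ ∑ n ∈ Finset.range (N + 1), (27 : ℝ) / N *
          (binomWeight N (2 / 3) n * (1 + ((n : ℝ) - 2 * N / 3) ^ 2 / N)) := by
          refine Finset.sum_le_sum fun n _ => ?_
          rw [abs_mul, abs_of_nonneg (hp n), abs_mul]
          have h1 := abs_two_div_sqrt_sub_le hN n
          calc _ ≤ binomWeight N (2 / 3) n *
                (27 / N * (1 + ((n : ℝ) - 2 * N / 3) ^ 2 / N) * 1) := by
                refine mul_le_mul_of_nonneg_left ?_ (hp n)
                exact mul_le_mul h1 (hT1 n) (abs_nonneg _) (by positivity)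
            _ = _ := by ring
      _ ≤ (27 : ℝ) / N * 2 := by
          rw [← Finset.mul_sum]
          gcongr
      _ = _ := by ring
  have s3 : |S₂ - S₃| ≤ C₂ / √N := by
    have e1 : S₂ = ∑ n ∈ Finset.range (2 * (N + 1)), binomWeight N (2 / 3) n * T n := by
      have := sum_binomWeight_eq_sum_range (n := N) (θ := 2 / 3) (R := 2 * (N + 1)) (by omega) T
      simp only [mul_comm (T _)] at this
      exact this.symm
    rw [e1, hS₃, ← Finset.sum_sub_distrib]
    refine (Finset.abs_sum_le_sum_abs _ _).trans (le_trans ?_ (hC₂ N hN))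
    refine Finset.sum_le_sum fun n _ => ?_
    rw [← sub_mul, abs_mul]
    exact mul_le_of_le_one_right (abs_nonneg _) (hT1 n)
  have s4 : |stdNormalPDF w * (S₃ - sawtoothMean N w)| ≤ 218 / √N := by
    rw [abs_mul, abs_of_nonneg hφ]
    calc _ ≤ stdNormalPDF w * (109 * (1 + w) / √N) := by
          gcongr
          exact abs_sum_gaussWeight_mul_sawtooth_sub_le hN hw
      _ = 109 / √N * ((1 + w) * stdNormalPDF w) := by ring
      _ ≤ 109 / √N * 2 := by
          gcongr
          exact one_add_mul_stdNormalPDF_le hw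
      _ = _ := by ring
  have e : A - expansionNonneg N w
      = (A - (stdNormalCDF w - stdNormalPDF w * S₁)) - stdNormalPDF w * (S₁ - b * S₂)
        - b * (stdNormalPDF w * (S₂ - S₃)) - b * (stdNormalPDF w * (S₃ - sawtoothMean N w)) := by
    rw [expansionNonneg_eq]; ring
  have t2 : |stdNormalPDF w * (S₁ - b * S₂)| ≤ 54 / N := by
    rw [abs_mul, abs_of_nonneg hφ]
    exact (mul_le_of_le_one_left (abs_nonneg _) hφ1).trans s2
  have t3 : |b * (stdNormalPDF w * (S₂ - S₃))| ≤ 3 * C₂ / N := by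
    rw [abs_mul, abs_of_nonneg hb0, abs_mul, abs_of_nonneg hφ]
    calc _ ≤ 3 / √N * (1 * (C₂ / √N)) := by gcongr
      _ = 3 * C₂ / (√N * √N) := by field_simp
      _ = _ := by rw [hss]
  have t4 : |b * (stdNormalPDF w * (S₃ - sawtoothMean N w))| ≤ 654 / N := by
    rw [abs_mul, abs_of_nonneg hb0]
    calc _ ≤ 3 / √N * (218 / √N) := by gcongr
      _ = 654 / (√N * √N) := by rw [div_mul_div_comm]; norm_num
      _ = _ := by rw [hss]
  have e2 : (18 * C₁ + 54 + 3 * C₂ + 654) / (N : ℝ)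
      = 18 * C₁ / N + 54 / N + 3 * C₂ / N + 654 / N := by ring
  rw [e, e2]
  refine (abs_sub _ _).trans (add_le_add ((abs_sub _ _).trans
    (add_le_add ((abs_sub _ _).trans (add_le_add s1 t2)) t3)) t4)

/-- Increments of the expansion over intervals `[v, w]` with `w / v = 1 + O(1 / N)`. -/
lemma exists_abs_expansionNonneg_sub_le (L : ℕ) : ∃ K : ℝ, 0 ≤ K ∧ ∀ (N : ℕ) (v w : ℝ),
    0 < N → 0 < v → v ≤ w → w ^ 2 * N ≤ v ^ 2 * (N + L) →
    |expansionNonneg N w - expansionNonneg N v| ≤ K / N := by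
  refine ⟨L + 9 * L + 3 * (12 * L + 216 * L), by positivity, fun N v w hN hv hvw hL => ?_⟩
  have hN0 : (0 : ℝ) < N := by exact_mod_cast hN
  have hs : 0 < √(N : ℝ) := by positivity
  have hss : √(N : ℝ) * √N = N := Real.mul_self_sqrt hN0.le
  have hw : 0 < w := hv.trans_le hvw
  have hφw := stdNormalPDF_nonneg w
  have hφv := stdNormalPDF_nonneg v
  have hvφ : v * stdNormalPDF v ≤ 1 := by
    have := abs_mul_stdNormalPDF_le v
    rwa [abs_of_pos hv] at this
  have hφwv : stdNormalPDF w ≤ stdNormalPDF v :=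
    stdNormalPDF_antitoneOn (Set.mem_Ici.2 hv.le) (Set.mem_Ici.2 hw.le) hvw
  have hsq : w ^ 2 - v ^ 2 ≤ v ^ 2 * L / N := by
    rw [le_div_iff₀ hN0]; linarith
  have hdiff : w - v ≤ v * (L / N) := by
    have h1 : v * (w - v) ≤ v * (v * (L / N)) := by
      have : v ^ 2 * L / N = v * (v * (L / N)) := by ring
      nlinarith
    exact le_of_mul_le_mul_left h1 hv
  have c1 : |stdNormalCDF w - stdNormalCDF v| ≤ L / N := by
    rw [abs_of_nonneg (sub_nonneg.2 (stdNormalCDF_mono hvw))]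
    calc _ ≤ (w - v) * stdNormalPDF v := stdNormalCDF_sub_le hv.le hvw
      _ ≤ v * (L / N) * stdNormalPDF v := by gcongr
      _ = L / N * (v * stdNormalPDF v) := by ring
      _ ≤ L / N * 1 := by gcongr
      _ = _ := mul_one _
  have c2 : |stdNormalPDF w - stdNormalPDF v| ≤ L / N := by
    have h1 : stdNormalPDF w = stdNormalPDF v * Real.exp (-((w ^ 2 - v ^ 2) / 2)) := by
      have := stdNormalPDF_add v (w - v)
      rw [add_sub_cancel] at this
      rw [this]; congr 2; ring
    have h2 := Real.add_one_le_exp (-((w ^ 2 - v ^ 2) / 2))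
    have h3 : stdNormalPDF v - stdNormalPDF w ≤ stdNormalPDF v * (v ^ 2 * L / N) := by
      rw [h1]
      have : stdNormalPDF v * (1 - Real.exp (-((w ^ 2 - v ^ 2) / 2)))
          ≤ stdNormalPDF v * (v ^ 2 * L / N) := by
        apply mul_le_mul_of_nonneg_left _ hφv
        have : 0 ≤ w ^ 2 - v ^ 2 := by nlinarith
        linarith
      linarith
    have h4 : v ^ 2 * stdNormalPDF v ≤ 1 := by
      have := one_add_sq_mul_stdNormalPDF_le v
      linarith
    have h5 : stdNormalPDF v * (v ^ 2 * L / N) ≤ L / N := by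
      calc _ = L / N * (v ^ 2 * stdNormalPDF v) := by ring
        _ ≤ L / N * 1 := by gcongr
        _ = _ := mul_one _
    rw [abs_of_nonpos (by linarith)]
    linarith
  -- The bounds on the sawtooth increment grow linearly in `v`; the density in front keeps them
  -- uniform.
  have c3 : stdNormalPDF w * |sawtoothMean N w - sawtoothMean N v|
      ≤ (12 * L + 216 * L) / √N := by
    have hle : ∀ m ∈ Finset.range (N + 1), v * √(2 * m) ≤ w * √(2 * m) := by
      intro m _; gcongr
    have h1 : |sawtoothMean N w - sawtoothMean N v|
        ≤ ∑ m ∈ Finset.range (N + 1), gaussWeight N (2 * m) * ((w - v) * √(2 * N))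
          + ∑ m ∈ Finset.range (N + 1), gaussWeight N (2 * m) *
            ((⌊w * √(2 * m)⌋ : ℝ) - ⌊v * √(2 * m)⌋) := by
      rw [sawtoothMean, sawtoothMean, ← Finset.sum_sub_distrib, ← Finset.sum_add_distrib]
      refine (Finset.abs_sum_le_sum_abs _ _).trans (Finset.sum_le_sum fun m hm => ?_)
      rw [← mul_sub, abs_mul, abs_of_nonneg (gaussWeight_nonneg _ _), ← mul_add]
      refine mul_le_mul_of_nonneg_left ((abs_sawtooth_sub_le (hle m hm)).trans ?_)
        (gaussWeight_nonneg _ _)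
      have : (m : ℝ) ≤ N := by
        have := Finset.mem_range.1 hm
        exact_mod_cast (by omega : m ≤ N)
      rw [← sub_mul]
      have : (w - v) * √(2 * m) ≤ (w - v) * √(2 * N) := by
        have : 0 ≤ w - v := sub_nonneg.2 hvw
        gcongr
      linarith
    have h2 : ∑ m ∈ Finset.range (N + 1), gaussWeight N (2 * m) * ((w - v) * √(2 * N))
        ≤ 12 * L * v / √N := by
      have h22 : √(2 * (N : ℝ)) ≤ 2 * √N := by
        rw [Real.sqrt_mul (by norm_num)]
        gcongr
        rw [Real.sqrt_le_left (by norm_num)]; norm_num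
      rw [← Finset.sum_mul]
      calc _ ≤ 6 * (v * (L / N) * (2 * √N)) := by
            have : 0 ≤ w - v := sub_nonneg.2 hvw
            gcongr
            exact sum_gaussWeight_even_le hN
        _ = 12 * L * v * (√N / (√N * √N)) := by rw [hss]; ring
        _ = _ := by field_simp
    have h3 : ∑ m ∈ Finset.range (N + 1), gaussWeight N (2 * m) *
        ((⌊w * √(2 * m)⌋ : ℝ) - ⌊v * √(2 * m)⌋) ≤ 108 * L * (1 + v) / √N := by
      have hfl : ∀ n : ℕ, 0 ≤ gaussWeight N n *
          ((⌊v * √((n : ℝ) + (2 * L : ℕ)) + 0⌋ : ℝ) - ⌊v * √(n : ℝ) + 0⌋) := by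
        intro n
        refine mul_nonneg (gaussWeight_nonneg _ _) (sub_nonneg.2 ?_)
        have : v * √(n : ℝ) + 0 ≤ v * √((n : ℝ) + (2 * L : ℕ)) + 0 := by
          gcongr
          linarith [(Nat.cast_nonneg (2 * L) : (0 : ℝ) ≤ (2 * L : ℕ))]
        exact_mod_cast Int.floor_mono this
      calc _ ≤ ∑ m ∈ Finset.range (N + 1), (fun n : ℕ => gaussWeight N n *
            ((⌊v * √((n : ℝ) + (2 * L : ℕ)) + 0⌋ : ℝ) - ⌊v * √(n : ℝ) + 0⌋)) (2 * m) := by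
            refine Finset.sum_le_sum fun m hm => ?_
            have hmN : (m : ℝ) ≤ N := by
              have := Finset.mem_range.1 hm
              exact_mod_cast (by omega : m ≤ N)
            -- For `m ≤ N` the hypothesis gives `w² m ≤ v² (m + L)`: the dilation from `v` to `w` is
            -- dominated by a shift of `2m` by `2L`.
            have h4 : w * √(2 * m) ≤ v * √(2 * m + 2 * L) := by
              have e1 : w * √(2 * m) = √(w ^ 2 * (2 * m)) := by
                rw [Real.sqrt_mul (sq_nonneg w), Real.sqrt_sq hw.le]
              have e2 : v * √(2 * m + 2 * L) = √(v ^ 2 * (2 * m + 2 * L)) := by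
                rw [Real.sqrt_mul (sq_nonneg v), Real.sqrt_sq hv.le]
              rw [e1, e2]
              apply Real.sqrt_le_sqrt
              have h5 : (w ^ 2 - v ^ 2) * m ≤ (w ^ 2 - v ^ 2) * N := by
                have : 0 ≤ w ^ 2 - v ^ 2 := by nlinarith
                gcongr
              nlinarith
            have h5 : (⌊w * √(2 * m)⌋ : ℝ) ≤ ⌊v * √(2 * m + 2 * L)⌋ := by
              exact_mod_cast Int.floor_mono h4
            push_cast
            simp only [add_zero]
            exact mul_le_mul_of_nonneg_left (by linarith) (gaussWeight_nonneg _ _)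
        _ ≤ _ := sum_even_le_sum_range _ hfl _
        _ ≤ (2 * L : ℕ) * (54 * (1 + v) / √N) :=
            sum_gaussWeight_mul_floor_sqrt_sub_le hN _ hv.le 0 (2 * L)
        _ = _ := by push_cast; ring
    have h6 : stdNormalPDF w * v ≤ 1 := by
      calc _ ≤ stdNormalPDF v * v := by gcongr
        _ ≤ 1 := by linarith
    have h7 : stdNormalPDF w * (1 + v) ≤ 2 := by
      have := one_add_mul_stdNormalPDF_le hv.le
      have h8 : stdNormalPDF w * (1 + v) ≤ stdNormalPDF v * (1 + v) := by gcongr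
      linarith
    calc _ ≤ stdNormalPDF w * (12 * L * v / √N + 108 * L * (1 + v) / √N) := by
          gcongr; exact h1.trans (add_le_add h2 h3)
      _ = 12 * L / √N * (stdNormalPDF w * v) + 108 * L / √N * (stdNormalPDF w * (1 + v)) := by
          ring
      _ ≤ 12 * L / √N * 1 + 108 * L / √N * 2 := by gcongr
      _ = _ := by ring
  have hb3 := sqrt_six_div_le N
  have hb33 : √6 / √(N : ℝ) ≤ 3 := by
    refine hb3.trans ?_
    have : 1 ≤ √(N : ℝ) := Real.one_le_sqrt.2 (by exact_mod_cast hN)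
    rw [div_le_iff₀ hs]; linarith
  have e : expansionNonneg N w - expansionNonneg N v
      = (stdNormalCDF w - stdNormalCDF v)
        - √6 / √N * ((stdNormalPDF w - stdNormalPDF v) * sawtoothMean N v)
        - √6 / √N * (stdNormalPDF w * (sawtoothMean N w - sawtoothMean N v)) := by
    rw [expansionNonneg_eq, expansionNonneg_eq]; ring
  have d2 : |√6 / √N * ((stdNormalPDF w - stdNormalPDF v) * sawtoothMean N v)| ≤ 9 * L / N := by
    rw [abs_mul, abs_mul, abs_of_nonneg (by positivity : 0 ≤ √6 / √(N : ℝ))]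
    calc _ ≤ 3 * ((L : ℝ) / N * 3) := by
          gcongr
          exact abs_sawtoothMean_le hN v
      _ = _ := by ring
  have d3 : |√6 / √N * (stdNormalPDF w * (sawtoothMean N w - sawtoothMean N v))|
      ≤ 3 * (12 * L + 216 * L) / N := by
    rw [abs_mul, abs_mul, abs_of_nonneg hφw, abs_of_nonneg (by positivity : 0 ≤ √6 / √(N : ℝ))]
    calc _ ≤ 3 / √N * ((12 * L + 216 * L) / √N) := by gcongr
      _ = 3 * (12 * L + 216 * L) / (√N * √N) := by rw [div_mul_div_comm]
      _ = _ := by rw [hss]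
  rw [e]
  refine (abs_sub _ _).trans ((add_le_add ((abs_sub _ _).trans (add_le_add c1 d2)) d3).trans ?_)
  rw [← add_div, ← add_div]

/-! ### Left limits and the value at the origin -/

/-- Where no left limit exists, `Function.leftLim` takes the value at the point itself. Requiring
the bound on `𝓝[≤] a` covers both cases, so the existence of the limit never has to be proved. -/
lemma abs_leftLim_sub_le {f : ℝ → ℝ} {a y K : ℝ} (h : ∀ᶠ v in 𝓝[≤] a, |f v - y| ≤ K) :
    |Function.leftLim f a - y| ≤ K := by
  by_cases hc : ∃ z, Tendsto f (𝓝[<] a) (𝓝 z)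
  · obtain ⟨z, hz⟩ := hc
    rw [leftLim_eq_of_tendsto hz]
    exact le_of_tendsto ((hz.sub_const y).abs)
      (h.filter_mono (nhdsWithin_mono a Set.Iio_subset_Iic_self))
  · rw [leftLim_eq_of_not_tendsto f hc]
    exact h.self_of_nhdsWithin Set.self_mem_Iic

/-- Even and odd indices carry nearly equal mass, since their difference is bounded by the total
variation of the weight. -/
lemma abs_two_mul_sum_gaussWeight_even_sub_one_le {N : ℕ} (hN : 0 < N) :
    |2 * ∑ m ∈ Finset.range (N + 1), gaussWeight N (2 * m) - 1| ≤ 5 / √N := by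
  have h1 := abs_sum_gaussWeight_sub_one_le hN
  have h2 := sum_range_two_mul_eq (fun n => gaussWeight N n) (N + 1)
  have h3 : |∑ m ∈ Finset.range (N + 1),
      (gaussWeight N ((2 * m : ℕ) + 1 : ℝ) - gaussWeight N (2 * m : ℕ))| ≤ 2 / √N :=
    (Finset.abs_sum_le_sum_abs _ _).trans ((sum_even_le_sum_range
      (fun n => |gaussWeight N ((n : ℝ) + 1) - gaussWeight N n|)
      (fun n => abs_nonneg _) (N + 1)).trans (sum_abs_gaussWeight_sub_le N _))
  rw [Finset.sum_sub_distrib] at h3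
  rw [Finset.sum_add_distrib] at h2
  push_cast at h2 h3
  have e : (5 : ℝ) / √N = 3 / √N + 2 / √N := by ring
  obtain ⟨a1, a2⟩ := abs_le.1 h1
  obtain ⟨b1, b2⟩ := abs_le.1 h3
  rw [e, abs_le]
  constructor <;> linarith

/-- At `w = 0` every sawtooth equals `-1/2`, so only the mass of the even indices, close to `1/2`,
enters. -/
lemma abs_expansionNonneg_zero_sub_le {N : ℕ} (hN : 0 < N) :
    |2 * expansionNonneg N 0 - 1 - √(3 / (4 * Real.pi * N))| ≤ 15 / N := by
  have hN0 : (0 : ℝ) < N := by exact_mod_cast hN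
  have hs : 0 < √(N : ℝ) := by positivity
  have hss : √(N : ℝ) * √N = N := Real.mul_self_sqrt hN0.le
  set G := ∑ m ∈ Finset.range (N + 1), gaussWeight N (2 * m) with hG
  have h0 : sawtoothMean N 0 = -(1 / 2) * G := by
    rw [sawtoothMean, hG, Finset.mul_sum]
    refine Finset.sum_congr rfl fun m _ => ?_
    simp [sawtooth]; ring
  have h1 : √(3 / (4 * Real.pi * N)) = √6 / √N * stdNormalPDF 0 / 2 := by
    rw [stdNormalPDF_eq]
    have hπ := Real.pi_pos
    have e : √6 / √N * ((√(2 * Real.pi))⁻¹ * Real.exp (-0 ^ 2 / 2)) / 2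
        = √(6 / (N * (2 * Real.pi)) / 4) := by
      rw [Real.sqrt_div' _ (by norm_num : (0 : ℝ) ≤ 4), Real.sqrt_div' _ (by positivity),
        Real.sqrt_mul hN0.le, show (4 : ℝ) = 2 ^ 2 by norm_num, Real.sqrt_sq (by norm_num)]
      simp
      field_simp
    rw [e]
    congr 1
    field_simp
    norm_num
  have h2 : 2 * expansionNonneg N 0 - 1 - √(3 / (4 * Real.pi * N))
      = √6 / √N * stdNormalPDF 0 / 2 * (2 * G - 1) := by
    rw [expansionNonneg_eq, stdNormalCDF_zero, h0, h1]; ring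
  have h3 := stdNormalPDF_nonneg 0
  have h4 : stdNormalPDF 0 ≤ 1 := (stdNormalPDF_le 0).trans (by norm_num)
  rw [h2, abs_mul, abs_of_nonneg (by positivity)]
  have h5 := sqrt_six_div_le N
  calc _ ≤ 3 / √N * 1 / 1 * (5 / √N) := by
        gcongr ?_ * ?_ / ?_ * ?_
        · norm_num
        · exact abs_two_mul_sum_gaussWeight_even_sub_one_le hN
    _ = 15 / (√N * √N) := by rw [mul_one, div_one, div_mul_div_comm]; norm_num
    _ = _ := by rw [hss]

/-! ### Consequences for the law of the self-normalized sum -/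

namespace IsIIDUniformTernary

variable {Ω : Type*} [MeasurableSpace Ω] {μ : Measure Ω} [IsProbabilityMeasure μ]
  {X : ℕ → Ω → ℝ}

lemma selfNormCDF_mono (N : ℕ) : Monotone (selfNormCDF μ X N) := fun _ _ hxy =>
  measureReal_mono fun _ h => le_trans (h : _ ≤ _) hxy

lemma selfNormCDF_sub (hX : IsIIDUniformTernary μ X) (N : ℕ) {v w : ℝ} (hvw : v ≤ w) :
    selfNormCDF μ X N w - selfNormCDF μ X N v = μ.real {ω | selfNormSum X N ω ∈ Set.Ioc v w} := by
  have hm : MeasurableSet {ω | selfNormSum X N ω ≤ v} :=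
    hX.measurable_selfNormSum N measurableSet_Iic
  have h := measureReal_inter_add_sdiff (μ := μ) (s := {ω | selfNormSum X N ω ≤ w}) hm
  have e1 : {ω | selfNormSum X N ω ≤ w} ∩ {ω | selfNormSum X N ω ≤ v}
      = {ω | selfNormSum X N ω ≤ v} := by
    ext ω
    simp only [Set.mem_inter_iff, Set.mem_ofPred_eq]
    exact ⟨fun h => h.2, fun h => ⟨h.trans hvw, h⟩⟩
  have e2 : {ω | selfNormSum X N ω ≤ w} \ {ω | selfNormSum X N ω ≤ v}
      = {ω | selfNormSum X N ω ∈ Set.Ioc v w} := by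
    ext ω
    simp only [Set.mem_sdiff, Set.mem_ofPred_eq, Set.mem_Ioc, not_le]
    exact and_comm
  rw [e1, e2] at h
  unfold selfNormCDF
  linarith

lemma exists_abs_selfNormCDF_sub_expansionNonneg_le (hX : IsIIDUniformTernary μ X) :
    ∃ K : ℝ, 0 ≤ K ∧ ∀ (N : ℕ) (w : ℝ), 0 < N → 0 ≤ w →
      |selfNormCDF μ X N w - expansionNonneg N w| ≤ K / N := by
  obtain ⟨K, hK0, hK⟩ := exists_abs_sum_signSumCDF_sub_expansionNonneg_le
  refine ⟨K, hK0, fun N w hN hw => ?_⟩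
  rw [hX.selfNormCDF_eq]
  exact hK N w hN hw

lemma exists_selfNormCDF_sub_le (hX : IsIIDUniformTernary μ X) (L : ℕ) :
    ∃ K : ℝ, 0 ≤ K ∧ ∀ (N : ℕ) (v w : ℝ), 0 < N → 0 < v → v ≤ w →
      w ^ 2 * N ≤ v ^ 2 * (N + L) → selfNormCDF μ X N w - selfNormCDF μ X N v ≤ K / N := by
  obtain ⟨K₁, h1, hK₁⟩ := hX.exists_abs_selfNormCDF_sub_expansionNonneg_le
  obtain ⟨K₂, h2, hK₂⟩ := exists_abs_expansionNonneg_sub_le L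
  refine ⟨K₁ + K₁ + K₂, by positivity, fun N v w hN hv hvw hL => ?_⟩
  obtain ⟨a1, a2⟩ := abs_le.1 (hK₁ N v hN hv.le)
  obtain ⟨b1, b2⟩ := abs_le.1 (hK₁ N w hN (hv.le.trans hvw))
  obtain ⟨c1, c2⟩ := abs_le.1 (hK₂ N v w hN hv hvw hL)
  rw [add_div, add_div]
  linarith

/-- A point to the left of `w > 0` at relative distance of order `1 / N`. -/
lemma exists_lt_sq_mul_le (N : ℕ) {w : ℝ} (hw : 0 < w) (hN : 0 < N) :
    ∃ v, 0 < v ∧ v < w ∧ w ^ 2 * N ≤ v ^ 2 * (N + (1 : ℕ)) := by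
  have hN0 : (0 : ℝ) < N := by exact_mod_cast hN
  have h1 : (N : ℝ) / (N + 1) < 1 := by rw [div_lt_one (by positivity)]; linarith
  refine ⟨w * √(N / (N + 1)), by positivity, ?_, ?_⟩
  · have : √((N : ℝ) / (N + 1)) < 1 := by
      rw [Real.sqrt_lt' one_pos]; simpa using h1
    nlinarith
  · rw [mul_pow, Real.sq_sqrt (by positivity)]
    push_cast
    have : w ^ 2 * (N / (N + 1)) * ((N : ℝ) + 1) = w ^ 2 * N := by field_simp
    exact this.ge

/-- For `w > 0` the atom lies in a half-open interval `(v, w]` whose relative length is of order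
`1/N`; the constant does not depend on `w`. Symmetry gives `w < 0`. -/
lemma exists_measureReal_selfNormSum_eq_le (hX : IsIIDUniformTernary μ X) :
    ∃ K : ℝ, 0 ≤ K ∧ ∀ (N : ℕ) (w : ℝ), 0 < N → w ≠ 0 →
      μ.real {ω | selfNormSum X N ω = w} ≤ K / N := by
  obtain ⟨K, hK0, hK⟩ := hX.exists_selfNormCDF_sub_le 1
  have hpos : ∀ (N : ℕ) (w : ℝ), 0 < N → 0 < w →
      μ.real {ω | selfNormSum X N ω = w} ≤ K / N := by
    intro N w hN hw
    obtain ⟨v, hv, hvw, h⟩ := exists_lt_sq_mul_le N hw hN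
    refine le_trans ?_ (hK N v w hN hv hvw.le h)
    rw [hX.selfNormCDF_sub N hvw.le]
    refine measureReal_mono fun ω hω => ?_
    have hω' : selfNormSum X N ω = w := hω
    exact ⟨by rw [hω']; exact hvw, hω'.le⟩
  refine ⟨K, hK0, fun N w hN hw => ?_⟩
  rcases lt_or_gt_of_ne hw with h | h
  · have h1 := hX.measureReal_selfNormSum_neg_mem N (measurableSet_singleton w)
    have h2 := hpos N (-w) hN (by linarith)
    have e : {ω | -selfNormSum X N ω ∈ ({w} : Set ℝ)} = {ω | selfNormSum X N ω = -w} := by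
      ext ω; simp [neg_eq_iff_eq_neg]
    rw [e] at h1
    rw [h1] at h2
    exact h2
  · exact hpos N w hN h

/-- For `w < 0`, `F_N(w) = 1 - P(W_N < -w)`. Just to the left of `-w` the distribution function
stays within `O(1/N)` of `P(W_N < -w)`, so the left limit of the expansion does too. -/
lemma exists_abs_selfNormCDF_sub_expansion_le (hX : IsIIDUniformTernary μ X) :
    ∃ K : ℝ, 0 ≤ K ∧ ∀ (N : ℕ) (w : ℝ), 0 < N →
      |selfNormCDF μ X N w - expansion N w| ≤ K / N := by
  obtain ⟨K₁, h1, hK₁⟩ := hX.exists_abs_selfNormCDF_sub_expansionNonneg_le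
  obtain ⟨K₂, h2, hK₂⟩ := hX.exists_selfNormCDF_sub_le 1
  refine ⟨K₁ + K₂, by positivity, fun N w hN => ?_⟩
  have hK₂N : 0 ≤ K₂ / N := by positivity
  rw [add_div]
  unfold expansion
  split_ifs with hw
  · linarith [hK₁ N w hN hw]
  push Not at hw
  have ha : 0 < -w := by linarith
  set a := -w with ha_def
  have hm : MeasurableSet {ω | selfNormSum X N ω < a} :=
    hX.measurable_selfNormSum N measurableSet_Iio
  have hF : selfNormCDF μ X N w = 1 - μ.real {ω | selfNormSum X N ω < a} := by
    have h3 := hX.measureReal_selfNormSum_neg_mem N (measurableSet_Iic (a := w))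
    have e : {ω | -selfNormSum X N ω ∈ Set.Iic w} = {ω | selfNormSum X N ω < a}ᶜ := by
      ext ω
      simp only [Set.mem_Iic, Set.mem_ofPred_eq, Set.mem_compl_iff, not_lt, ha_def]
      constructor <;> intro h <;> linarith
    rw [e, probReal_compl_eq_one_sub hm] at h3
    exact h3.symm
  have h4 : |Function.leftLim (expansionNonneg N) a - μ.real {ω | selfNormSum X N ω < a}|
      ≤ K₁ / N + K₂ / N := by
    apply abs_leftLim_sub_le
    obtain ⟨v₀, hv₀, hv₀a, hL⟩ := exists_lt_sq_mul_le N ha hN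
    have hinc := hK₂ N v₀ a hN hv₀ hv₀a.le hL
    have l1 : selfNormCDF μ X N v₀ ≤ μ.real {ω | selfNormSum X N ω < a} :=
      measureReal_mono fun ω (h : _ ≤ _) => show _ < _ from lt_of_le_of_lt h hv₀a
    have l2 : μ.real {ω | selfNormSum X N ω < a} ≤ selfNormCDF μ X N a :=
      measureReal_mono fun ω (h : selfNormSum X N ω < a) => h.le
    have hev : ∀ᶠ v in 𝓝[≤] a, v ∈ Set.Ioc v₀ a := Ioc_mem_nhdsLE hv₀a
    filter_upwards [hev] with v hv
    have l3 := selfNormCDF_mono (μ := μ) (X := X) N hv.1.le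
    have l4 := selfNormCDF_mono (μ := μ) (X := X) N hv.2
    obtain ⟨b1, b2⟩ := abs_le.1 (hK₁ N v hN (hv₀.trans hv.1).le)
    rw [abs_le]; constructor <;> linarith
  rw [hF]
  have e : 1 - μ.real {ω | selfNormSum X N ω < a} - (1 - Function.leftLim (expansionNonneg N) a)
      = Function.leftLim (expansionNonneg N) a - μ.real {ω | selfNormSum X N ω < a} := by ring
  rw [e]
  exact h4

lemma exists_measureReal_selfNormSum_mem_Icc_le (hX : IsIIDUniformTernary μ X) {ε C : ℝ}
    (hε : 0 < ε) (hC : 0 < C) :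
    ∃ K : ℝ, 0 ≤ K ∧ ∀ N : ℕ, 0 < N → C / N ≤ ε / 2 → ∀ a b : ℝ, a ≤ b → b - a ≤ C / N →
      (ε ≤ a ∨ b ≤ -ε) → μ.real {ω | selfNormSum X N ω ∈ Set.Icc a b} ≤ K / N := by
  -- With `v = a - C/N ≥ ε/2`, the quantity `(b² - v²)N` is at most `4Cv + 4C²`. Since `1 ≤ 2v/ε`,
  -- this is at most `v²(8C/ε + 16C²/ε²)`.
  obtain ⟨L, hL⟩ := exists_nat_ge (8 * C / ε + 16 * C ^ 2 / ε ^ 2)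
  obtain ⟨K, hK0, hK⟩ := hX.exists_selfNormCDF_sub_le L
  have hpos : ∀ N : ℕ, 0 < N → C / N ≤ ε / 2 → ∀ a b : ℝ, a ≤ b → b - a ≤ C / N →
      ε ≤ a → μ.real {ω | selfNormSum X N ω ∈ Set.Icc a b} ≤ K / N := by
    intro N hN hNε a b hab hba ha
    have hN1 : (1 : ℝ) ≤ N := by exact_mod_cast hN
    have hN0 : (0 : ℝ) < N := by linarith
    have hCN : 0 < C / N := by positivity
    have hCN1 : C / N ≤ C := div_le_self hC.le hN1
    -- Increments of `F_N` measure half-open intervals, so the left end is moved strictly below `a`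
    -- to include the atom there.
    obtain ⟨v, hv⟩ : ∃ v, v = a - C / N := ⟨_, rfl⟩
    have hvε : ε / 2 ≤ v := by linarith
    have hv0 : 0 < v := by linarith
    have hvb : v ≤ b := by linarith
    have hcond : b ^ 2 * N ≤ v ^ 2 * (N + L) := by
      have h1 : (b - v) * N ≤ 2 * C := by
        have : b - v ≤ 2 * (C / N) := by linarith
        calc (b - v) * N ≤ 2 * (C / N) * N := by gcongr
          _ = 2 * C := by field_simp
      have h2 : b + v ≤ 2 * v + 2 * C := by linarith
      have h20 : 0 ≤ b + v := by linarith
      have h3 : (b - v) * N * (b + v) ≤ 2 * C * (2 * v + 2 * C) := by gcongr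
      have hr : 1 ≤ 2 * v / ε := by rw [le_div_iff₀ hε]; linarith
      have h4 : 4 * C * v ≤ v ^ 2 * (8 * C / ε) := by
        calc 4 * C * v = 4 * C * v * 1 := by ring
          _ ≤ 4 * C * v * (2 * v / ε) := by gcongr
          _ = _ := by ring
      have h5 : 4 * C ^ 2 ≤ v ^ 2 * (16 * C ^ 2 / ε ^ 2) := by
        calc 4 * C ^ 2 = 4 * C ^ 2 * 1 ^ 2 := by ring
          _ ≤ 4 * C ^ 2 * (2 * v / ε) ^ 2 := by gcongr
          _ = _ := by rw [div_pow]; ring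
      have h6 : v ^ 2 * (8 * C / ε + 16 * C ^ 2 / ε ^ 2) ≤ v ^ 2 * L := by gcongr
      nlinarith
    refine le_trans ?_ (hK N v b hN hv0 hvb hcond)
    rw [hX.selfNormCDF_sub N hvb]
    refine measureReal_mono fun ω hω => ?_
    have hω' : selfNormSum X N ω ∈ Set.Icc a b := hω
    exact ⟨lt_of_lt_of_le (by linarith) hω'.1, hω'.2⟩
  refine ⟨K, hK0, fun N hN hNε a b hab hba h => ?_⟩
  rcases h with h | h
  · exact hpos N hN hNε a b hab hba h
  · have h1 := hpos N hN hNε (-b) (-a) (by linarith) (by linarith) (by linarith)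
    have h2 := hX.measureReal_selfNormSum_neg_mem N (measurableSet_Icc (a := a) (b := b))
    have e : {ω | -selfNormSum X N ω ∈ Set.Icc a b}
        = {ω | selfNormSum X N ω ∈ Set.Icc (-b) (-a)} := by
      ext ω
      simp only [Set.mem_Icc, Set.mem_ofPred_eq]
      constructor <;> rintro ⟨h3, h4⟩ <;> constructor <;> linarith
    rw [e] at h2
    rw [← h2]
    exact h1

lemma measureReal_selfNormSum_eq_zero (hX : IsIIDUniformTernary μ X) (N : ℕ) :
    μ.real {ω | selfNormSum X N ω = 0} = 2 * selfNormCDF μ X N 0 - 1 := by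
  have hm : MeasurableSet {ω | selfNormSum X N ω < 0} :=
    hX.measurable_selfNormSum N measurableSet_Iio
  have h1 := hX.measureReal_selfNormSum_neg_mem N (measurableSet_Iic (a := 0))
  have e1 : {ω | -selfNormSum X N ω ∈ Set.Iic 0} = {ω | selfNormSum X N ω < 0}ᶜ := by
    ext ω; simp
  rw [e1, probReal_compl_eq_one_sub hm] at h1
  have h2 := measureReal_inter_add_sdiff (μ := μ) (s := {ω | selfNormSum X N ω ≤ 0}) hm
  have e2 : {ω | selfNormSum X N ω ≤ 0} ∩ {ω | selfNormSum X N ω < 0}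
      = {ω | selfNormSum X N ω < 0} := by
    ext ω
    simp only [Set.mem_inter_iff, Set.mem_ofPred_eq]
    exact ⟨fun h => h.2, fun h => ⟨h.le, h⟩⟩
  have e3 : {ω | selfNormSum X N ω ≤ 0} \ {ω | selfNormSum X N ω < 0}
      = {ω | selfNormSum X N ω = 0} := by
    ext ω
    simp only [Set.mem_sdiff, Set.mem_ofPred_eq, not_lt]
    exact ⟨fun h => le_antisymm h.1 h.2, fun h => ⟨h.le, h.ge⟩⟩
  rw [e2, e3] at h2
  have h3 : μ.real {ω | selfNormSum X N ω ∈ Set.Iic 0} = selfNormCDF μ X N 0 := rfl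
  have h4 : μ.real {ω | selfNormSum X N ω ≤ 0} = selfNormCDF μ X N 0 := rfl
  rw [h3] at h1
  rw [h4] at h2
  linarith

lemma isEquivalent_measureReal_selfNormSum_eq_zero (hX : IsIIDUniformTernary μ X) :
    (fun N : ℕ => μ.real {ω | selfNormSum X N ω = 0})
      ~[atTop] (fun N : ℕ => √(3 / (4 * Real.pi * N))) := by
  obtain ⟨K, hK0, hK⟩ := hX.exists_abs_selfNormCDF_sub_expansionNonneg_le
  have hbound : ∀ N : ℕ, 0 < N →
      |μ.real {ω | selfNormSum X N ω = 0} - √(3 / (4 * Real.pi * N))| ≤ (2 * K + 15) / N := by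
    intro N hN
    obtain ⟨a1, a2⟩ := abs_le.1 (hK N 0 hN le_rfl)
    obtain ⟨b1, b2⟩ := abs_le.1 (abs_expansionNonneg_zero_sub_le hN)
    have e : (2 * K + 15) / (N : ℝ) = K / N + K / N + 15 / N := by ring
    rw [hX.measureReal_selfNormSum_eq_zero, e, abs_le]
    constructor <;> linarith
  rw [IsEquivalent, isLittleO_iff]
  intro c hc
  have ht : Tendsto (fun N : ℕ => √(N : ℝ)) atTop atTop :=
    Real.tendsto_sqrt_atTop.comp tendsto_natCast_atTop_atTop
  have hq : 0 < √(3 / (4 * Real.pi)) := by have := Real.pi_pos; positivity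
  -- The threshold for `√N` at which the error `(2K + 15)/N` drops below `c` times the main term.
  filter_upwards [ht.eventually_ge_atTop ((2 * K + 15) / (c * √(3 / (4 * Real.pi)))),
    eventually_gt_atTop 0] with N hN hN0
  have hN0' : (0 : ℝ) < N := by exact_mod_cast hN0
  have hs : 0 < √(N : ℝ) := by positivity
  have hss : √(N : ℝ) * √N = N := Real.mul_self_sqrt hN0'.le
  rw [Pi.sub_apply, Real.norm_eq_abs, Real.norm_eq_abs, abs_of_nonneg (Real.sqrt_nonneg _)]
  refine (hbound N hN0).trans ?_
  rw [← div_div, Real.sqrt_div' _ hN0'.le, div_le_iff₀ hN0']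
  rw [div_le_iff₀ (by positivity)] at hN
  have e : c * (√(3 / (4 * Real.pi)) / √N) * N = √N * (c * √(3 / (4 * Real.pi))) := by
    rw [div_eq_mul_inv]
    have : (√(N : ℝ))⁻¹ * N = √N := by rw [inv_mul_eq_iff_eq_mul₀ hs.ne', hss]
    linear_combination c * √(3 / (4 * Real.pi)) * this
  rw [e]
  exact hN

end IsIIDUniformTernary

theorem theorem1p1 {Ω : Type*} [MeasurableSpace Ω] (μ : Measure Ω) [IsProbabilityMeasure μ]
    (X : ℕ → Ω → ℝ) (hX : IsIIDUniformTernary μ X) :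
    -- the atom at the origin
    ((fun N : ℕ => μ.real {ω | selfNormSum X N ω = 0})
        ~[atTop] (fun N : ℕ => √(3 / (4 * Real.pi * N)))) ∧
    ((fun N : ℕ => μ.real {ω | selfNormSum X N ω = 0})
        =O[atTop] (fun N : ℕ => 1 / √(N : ℝ))) ∧
    -- all other atoms, uniformly in their position
    (∃ K : ℝ, ∀ᶠ N : ℕ in atTop, ∀ w : ℝ, w ≠ 0 →
      μ.real {ω | selfNormSum X N ω = w} ≤ K / N) ∧
    -- the expansion, uniformly on the real line
    (∃ K : ℝ, ∀ᶠ N : ℕ in atTop, ∀ w : ℝ,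
      |selfNormCDF μ X N w - expansion N w| ≤ K / N) ∧
    -- closed intervals of length at most `C / N`, bounded away from the origin
    (∀ ε : ℝ, 0 < ε → ∀ C : ℝ, 0 < C → ∃ K : ℝ, ∀ᶠ N : ℕ in atTop, ∀ a b : ℝ,
      a ≤ b → b - a ≤ C / N → (ε ≤ a ∨ b ≤ -ε) →
        |expansion N b - Function.leftLim (expansion N) a| ≤ K / N ∧
        μ.real {ω | selfNormSum X N ω ∈ Set.Icc a b} ≤ K / N) := by
  have hequiv := hX.isEquivalent_measureReal_selfNormSum_eq_zero
  obtain ⟨K₀, hK₀0, hK₀⟩ := hX.exists_measureReal_selfNormSum_eq_le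
  obtain ⟨K₁, hK₁0, hK₁⟩ := hX.exists_abs_selfNormCDF_sub_expansion_le
  refine ⟨hequiv, ?_, ⟨K₀, ?_⟩, ⟨K₁, ?_⟩, fun ε hε C hC => ?_⟩
  · refine hequiv.isBigO.trans (IsBigO.of_bound (√(3 / (4 * Real.pi))) ?_)
    filter_upwards with N
    rw [Real.norm_eq_abs, Real.norm_eq_abs, abs_of_nonneg (Real.sqrt_nonneg _),
      abs_of_nonneg (by positivity), ← div_div, Real.sqrt_div' _ (Nat.cast_nonneg N),
      mul_one_div]
  · filter_upwards [eventually_gt_atTop 0] with N hN w hw using hK₀ N w hN hw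
  · filter_upwards [eventually_gt_atTop 0] with N hN w using hK₁ N w hN
  -- The left limit at `a` is approached through points of `(a - 1/N, a]`. This lengthens the
  -- interval to at most `(C + 1)/N` and may bring it closer to the origin, hence `ε/2`.
  · obtain ⟨K₂, hK₂0, hK₂⟩ :=
      hX.exists_measureReal_selfNormSum_mem_Icc_le (half_pos hε) (add_pos hC one_pos)
    -- The bound for the expansion is read off from that for `F_N`, at the price of one
    -- approximation error `K₁/N` at each end; this treats both half-lines at once.
    refine ⟨2 * K₁ + K₂, ?_⟩
    have ht : Tendsto (fun N : ℕ => (C + 1) / (N : ℝ)) atTop (𝓝 0) :=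
      tendsto_const_div_atTop_nhds_zero_nat _
    filter_upwards [ht.eventually_le_const (by positivity : 0 < ε / 2 / 2),
      eventually_gt_atTop 0] with N hNε hN a b hab hba hor
    have hN0 : (0 : ℝ) < N := by exact_mod_cast hN
    have e1 : (C + 1) / (N : ℝ) = C / N + 1 / N := by ring
    have hC0 : 0 < C / N := by positivity
    have h1N : 0 < 1 / (N : ℝ) := by positivity
    have hI : ∀ v, a - 1 / N ≤ v → v ≤ a →
        μ.real {ω | selfNormSum X N ω ∈ Set.Icc v b} ≤ K₂ / N := by
      intro v hv hva
      refine hK₂ N hN hNε v b (hva.trans hab) (by linarith) ?_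
      rcases hor with h | h
      · left; linarith
      · right; linarith
    have e2 : (2 * K₁ + K₂) / (N : ℝ) = K₁ / N + K₁ / N + K₂ / N := by ring
    have hK₁N : 0 ≤ K₁ / N := by positivity
    rw [e2]
    refine ⟨?_, by linarith [hI a (by linarith) le_rfl]⟩
    rw [abs_sub_comm]
    apply abs_leftLim_sub_le
    have hev : ∀ᶠ v in 𝓝[≤] a, v ∈ Set.Ioc (a - 1 / N) a := Ioc_mem_nhdsLE (by linarith)
    filter_upwards [hev] with v hv
    have l1 := hX.selfNormCDF_sub N (hv.2.trans hab)
    have l2 : μ.real {ω | selfNormSum X N ω ∈ Set.Ioc v b}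
        ≤ μ.real {ω | selfNormSum X N ω ∈ Set.Icc v b} :=
      measureReal_mono fun ω h => Set.Ioc_subset_Icc_self h
    have l3 := hI v hv.1.le hv.2
    have l4 := IsIIDUniformTernary.selfNormCDF_mono (μ := μ) (X := X) N (hv.2.trans hab)
    obtain ⟨a1, a2⟩ := abs_le.1 (hK₁ N v hN)
    obtain ⟨b1, b2⟩ := abs_le.1 (hK₁ N b hN)
    rw [abs_le]; constructor <;> linarith
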